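/- Let $s(0)=0$, $s(1)=1$, $s(2n)=s(n)$, $s(2n+1)=s(n)+s(n+1)$ be Stern's diatomic sequence and, for $N\ge 0$, let $\mathbb E_N$ and $\mathrm{Var}_N$ denote mean and variance when $n$ is uniformly distributed among the integers of $[2^N,2^{N+1})$. Let $\Psi=\,?$ be the Minkowski question mark function, i.e. the increasing continuous bijection of $[0,1]$ with $$\Psi([0;a_1,a_2,\dots])=2\sum_{n\ge1}\frac{(-1)^{n+1}}{2^{a_1+\cdots+a_n}},$$ and let $\mu$ be the Minkowski measure $d\mu=d\Psi$ on $[0,1]$. Let $$\alpha=-\frac12\int_0^1\log x\,d\mu(x).$$ Then $\alpha>0$, $\alpha=\lim_{N\to\infty}\frac1N\mathbb E_N[\log s(n)]$, and the following holds (all integrals below converge). (i) With $m_k=\int_0^1x^k\,d\mu(x)$, we have $\displaystyle \alpha=\log 2-\sum_{k=1}^\infty\frac{m_k}{k2^k}$, where the series converges. (ii) $\displaystyle\alpha=\int_0^1\log(1+x)\,d\mu(x)$. Moreover, for $\mu$-almost every $x$ the Lipschitz exponent of $\Psi$ at $x$ is $\beta=\frac{\log2}{2\alpha}$, that is, $\frac{\log|\Psi(y)-\Psi(x)|}{\log|y-x|}\to\beta$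 as $y\to x$, $y\neq x$. (iii) For the Farey map $F(x)=\min\{\frac{x}{1-x},\frac{1-x}{x}\}$, which is differentiable $\mu$-almost everywhere, $\displaystyle 2\alpha=\int_0^1\log|F'(x)|\,d\mu(x)$. (iv) $\alpha$ is the maximal Lyapunov exponent of the measure $\eta=\frac12\delta_{A_0}+\frac12\delta_{A_1}$ on $GL_2(\mathbb R)$, where $A_0=\left(\begin{smallmatrix}1&1\\0&1\end{smallmatrix}\right)$ and $A_1=\left(\begin{smallmatrix}1&0\\1&1\end{smallmatrix}\right)$; that is, $\frac1n\int\log\|g\|\,d\eta^{*n}(g)\to\alpha$. The probability measure $\xi=\frac12\mu+\frac12T^*\mu$ on $\mathbb P(\mathbb R^2)=\mathbb R\cup\{\infty\}$ is $\eta$-stationary, i.e. $\eta*\xi=\xi$; here $T(x)=1/x$, $T^*\mu$ is the image of $\mu$ under $T$, $\mu$ is extended trivially to $\mathbb R\cup\{\infty\}$, and matrices act by $\left(\begin{smallmatrix}a&b\\c&d\end{smallmatrix}\right)\cdot x=\frac{ax+b}{cx+d}$. (v) The limit $\sigma^2=\lim_{N\to\infty}\frac1N\mathrm{Var}_N[\log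 s(n)]$ exists and $$\sigma^2=\frac12\int_0^1\bigg(\log x+\alpha\Big\lfloor\frac1x\Big\rfloor+\int_0^1\log\bigg(\frac{1+y\{1/x\}}{1+yx}\bigg)d\mu(y)\bigg)^2d\mu(x).$$ -/

import Mathlib

open MeasureTheory Filter Topology Set

/-! ### Stern's diatomic sequence -/

/-- Stern's diatomic sequence: `s 0 = 0`, `s 1 = 1`, `s (2n) = s n`, `s (2n+1) = s n + s (n+1)`. -/
def stern : ℕ → ℕ
  | 0 => 0
  | 1 => 1
  | n + 2 =>
    if n % 2 = 0 then stern (n / 2 + 1) else stern (n / 2 + 1) + stern (n / 2 + 2)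
  decreasing_by all_goals omega

theorem stern_two_mul (n : ℕ) : stern (2 * n) = stern n := by
  rcases n with _ | n
  · rfl
  · rw [show 2 * (n + 1) = 2 * n + 2 by ring, stern]
    simp

theorem stern_two_mul_add_one (n : ℕ) : stern (2 * n + 1) = stern n + stern (n + 1) := by
  rcases n with _ | n
  · simp [stern]
  · rw [show 2 * (n + 1) + 1 = (2 * n + 1) + 2 by ring, stern]
    have h1 : (2 * n + 1) % 2 = 1 := by omega
    have h2 : (2 * n + 1) / 2 = n := by omega
    simp [h1, h2]

/-- The mean of `log s(n)`, for `n` uniformly distributed among the integers of `[2^N, 2^(N+1))`. -/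
noncomputable def sternLogMean (N : ℕ) : ℝ :=
  (∑ n ∈ Finset.Ico (2 ^ N) (2 ^ (N + 1)), Real.log (stern n)) / 2 ^ N

/-- The variance of `log s(n)`, for `n` uniformly distributed among the integers of
`[2^N, 2^(N+1))`. -/
noncomputable def sternLogVar (N : ℕ) : ℝ :=
  (∑ n ∈ Finset.Ico (2 ^ N) (2 ^ (N + 1)), (Real.log (stern n) - sternLogMean N) ^ 2) / 2 ^ N

/-! ### The Minkowski question mark function and the Minkowski measure -/

/-- The Gauss map `x ↦ {1/x}` (with value `0` at `0`). -/
noncomputable def gaussMap (x : ℝ) : ℝ := Int.fract (1 / x)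

/-- `cfDigit x n` is the partial quotient `a_{n+1}` of `x = [0; a₁, a₂, …] ∈ (0,1]`
(and `0` when the expansion of a rational `x` has stopped before). -/
noncomputable def cfDigit (x : ℝ) (n : ℕ) : ℕ := ⌊1 / gaussMap^[n] x⌋₊

/-- The Minkowski question mark function on `[0,1]`:
`?([0; a₁, a₂, …]) = 2 ∑ₙ (-1)^(n+1) / 2^(a₁ + ⋯ + aₙ)`, the sum being over all `n ≥ 1` for an
irrational number, and over the finitely many partial quotients for a rational number. -/
noncomputable def questionMark (x : ℝ) : ℝ :=
  ∑' n : ℕ, if gaussMap^[n] x = 0 then 0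
    else 2 * (-1) ^ n / 2 ^ (∑ i ∈ Finset.range (n + 1), cfDigit x i)

theorem gaussMap_mem (x : ℝ) : gaussMap x ∈ Icc (0 : ℝ) 1 :=
  ⟨Int.fract_nonneg _, (Int.fract_lt_one _).le⟩

theorem gaussMap_iterate_mem {x : ℝ} (hx : x ∈ Icc (0 : ℝ) 1) (n : ℕ) :
    gaussMap^[n] x ∈ Icc (0 : ℝ) 1 := by
  rcases n with _ | n
  · exact hx
  · rw [Function.iterate_succ_apply']
    exact gaussMap_mem _

theorem gaussMap_iterate_zero (n : ℕ) : gaussMap^[n] 0 = 0 := by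
  induction n with
  | zero => rfl
  | succ n ih => rw [Function.iterate_succ_apply, show gaussMap 0 = 0 by simp [gaussMap], ih]

theorem one_le_floor_inv {y : ℝ} (hy : y ∈ Icc (0 : ℝ) 1) (h : y ≠ 0) : 1 ≤ ⌊1 / y⌋₊ := by
  have h0 : 0 < y := lt_of_le_of_ne hy.1 (Ne.symm h)
  exact (Nat.one_le_floor_iff _).2 ((one_le_div h0).2 hy.2)

theorem le_sum_cfDigit {x : ℝ} (hx : x ∈ Icc (0 : ℝ) 1) (n : ℕ) (h : gaussMap^[n] x ≠ 0) :
    n + 1 ≤ ∑ i ∈ Finset.range (n + 1), cfDigit x i := by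
  have key : ∀ i ∈ Finset.range (n + 1), 1 ≤ cfDigit x i := by
    intro i hi
    have hi' : i ≤ n := by simpa [Nat.lt_succ_iff] using hi
    refine one_le_floor_inv (gaussMap_iterate_mem hx i) fun h0 => h ?_
    rw [← Nat.sub_add_cancel hi', Function.iterate_add_apply, h0, gaussMap_iterate_zero]
  simpa using Finset.card_nsmul_le_sum _ _ 1 key

theorem abs_questionMark_term_le {x : ℝ} (hx : x ∈ Icc (0 : ℝ) 1) (n : ℕ) :
    |(if gaussMap^[n] x = 0 then 0
      else 2 * (-1) ^ n / 2 ^ (∑ i ∈ Finset.range (n + 1), cfDigit x i) : ℝ)|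
      ≤ (1 / 2) ^ n := by
  split_ifs with h
  · simp
  · have h1 := le_sum_cfDigit hx n h
    have h2 : (2 : ℝ) ^ (n + 1) ≤ 2 ^ (∑ i ∈ Finset.range (n + 1), cfDigit x i) :=
      pow_le_pow_right₀ (by norm_num) h1
    rw [abs_div, abs_mul, abs_pow, abs_neg, abs_one, one_pow, mul_one, abs_two,
      abs_of_pos (by positivity : (0 : ℝ) < 2 ^ _), div_le_iff₀ (by positivity)]
    calc (2 : ℝ) = (1 / 2) ^ n * 2 ^ (n + 1) := by
          rw [pow_succ, ← mul_assoc, ← mul_pow]; norm_num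
      _ ≤ _ := by gcongr

theorem questionMark_summable {x : ℝ} (hx : x ∈ Icc (0 : ℝ) 1) :
    Summable fun n : ℕ => (if gaussMap^[n] x = 0 then 0
      else 2 * (-1) ^ n / 2 ^ (∑ i ∈ Finset.range (n + 1), cfDigit x i) : ℝ) :=
  Summable.of_norm_bounded (summable_geometric_of_lt_one (by norm_num) (by norm_num))
    (abs_questionMark_term_le hx)

theorem abs_questionMark_le {x : ℝ} (hx : x ∈ Icc (0 : ℝ) 1) : |questionMark x| ≤ 2 := by
  have := tsum_of_norm_bounded (f := fun n : ℕ => (if gaussMap^[n] x = 0 then 0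
      else 2 * (-1) ^ n / 2 ^ (∑ i ∈ Finset.range (n + 1), cfDigit x i) : ℝ))
    hasSum_geometric_two (abs_questionMark_term_le hx)
  simpa [questionMark] using this

theorem questionMark_zero : questionMark 0 = 0 := by
  simp [questionMark, gaussMap_iterate_zero]

theorem questionMark_rec {x : ℝ} (hx : x ∈ Icc (0 : ℝ) 1) (h : x ≠ 0) :
    questionMark x = (2 - questionMark (gaussMap x)) / 2 ^ ⌊1 / x⌋₊ := by
  unfold questionMark
  rw [(questionMark_summable hx).tsum_eq_zero_add]
  have e : ∀ n : ℕ, (if gaussMap^[n + 1] x = 0 then 0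
      else 2 * (-1) ^ (n + 1) / 2 ^ (∑ i ∈ Finset.range (n + 1 + 1), cfDigit x i) : ℝ) =
      -(1 / 2 ^ ⌊1 / x⌋₊) * (if gaussMap^[n] (gaussMap x) = 0 then 0
      else 2 * (-1) ^ n / 2 ^ (∑ i ∈ Finset.range (n + 1), cfDigit (gaussMap x) i)) := by
    intro n
    have e1 : ∑ i ∈ Finset.range (n + 1 + 1), cfDigit x i =
        ⌊1 / x⌋₊ + ∑ i ∈ Finset.range (n + 1), cfDigit (gaussMap x) i := by
      rw [Finset.sum_range_succ' _ (n + 1), add_comm]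
      rfl
    rw [e1, Function.iterate_succ_apply]
    split_ifs
    · simp
    · rw [pow_add, pow_succ (-1 : ℝ)]
      ring
  rw [tsum_congr e, tsum_mul_left]
  simp only [Function.iterate_zero, id_eq, h, if_false, zero_add, Finset.range_one,
    Finset.sum_singleton, cfDigit]
  ring

theorem questionMark_mem {x : ℝ} (hx : x ∈ Icc (0 : ℝ) 1) : questionMark x ∈ Icc (0 : ℝ) 1 := by
  have step : ∀ C : ℝ, (∀ y ∈ Icc (0 : ℝ) 1, 2 - questionMark y ∈ Icc 0 C) →
      ∀ y ∈ Icc (0 : ℝ) 1, questionMark y ∈ Icc 0 (C / 2) := by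
    intro C hC y hy
    have hC0 : 0 ≤ C := (hC y hy).1.trans (hC y hy).2
    by_cases h : y = 0
    · rw [h, questionMark_zero]
      exact ⟨le_rfl, by positivity⟩
    · rw [questionMark_rec hy h]
      obtain ⟨h1, h2⟩ := hC _ (gaussMap_mem y)
      have h3 : (2 : ℝ) ^ 1 ≤ 2 ^ ⌊1 / y⌋₊ :=
        pow_le_pow_right₀ (by norm_num) (one_le_floor_inv hy h)
      refine ⟨by positivity, ?_⟩
      rw [pow_one] at h3
      gcongr
  have s1 := step 4 fun y hy => by
    have := abs_le.1 (abs_questionMark_le hy)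
    exact ⟨by linarith, by linarith⟩
  have s2 := step 2 fun y hy => by
    have := s1 y hy
    exact ⟨by linarith [this.2], by linarith [this.1]⟩
  simpa using s2 x hx

theorem questionMark_sub_le (k : ℕ) : ∀ x ∈ Icc (0 : ℝ) 1, ∀ y ∈ Icc (0 : ℝ) 1, x ≤ y →
    questionMark x - questionMark y ≤ (1 / 2) ^ k := by
  induction k with
  | zero =>
    intro x hx y hy _
    have h1 := (questionMark_mem hx).2
    have h2 := (questionMark_mem hy).1
    simp only [pow_zero]
    linarith
  | succ k ih =>
    intro x hx y hy hxy
    by_cases hx0 : x = 0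
    · rw [hx0, questionMark_zero]
      have h2 := (questionMark_mem hy).1
      have : (0 : ℝ) ≤ (1 / 2) ^ (k + 1) := by positivity
      linarith
    have hxp : 0 < x := lt_of_le_of_ne hx.1 (Ne.symm hx0)
    have hyp : 0 < y := hxp.trans_le hxy
    have hy0 : y ≠ 0 := hyp.ne'
    have hinv : 1 / y ≤ 1 / x := one_div_le_one_div_of_le hxp hxy
    have hfl : ⌊1 / y⌋₊ ≤ ⌊1 / x⌋₊ := Nat.floor_mono hinv
    have hgx := questionMark_mem (gaussMap_mem x)
    have hgy := questionMark_mem (gaussMap_mem y)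
    rw [questionMark_rec hx hx0, questionMark_rec hy hy0]
    rcases hfl.eq_or_lt with he | hlt
    · rw [← he, ← sub_div]
      have hg : gaussMap y ≤ gaussMap x := by
        have e1 : ∀ z : ℝ, 0 < z → gaussMap z = 1 / z - (⌊1 / z⌋₊ : ℝ) := by
          intro z hz
          rw [gaussMap, Int.fract, natCast_floor_eq_intCast_floor (by positivity)]
        rw [e1 x hxp, e1 y hyp, he]
        linarith
      have h1 := ih _ (gaussMap_mem y) _ (gaussMap_mem x) hg
      have h3 : (2 : ℝ) ^ 1 ≤ 2 ^ ⌊1 / y⌋₊ :=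
        pow_le_pow_right₀ (by norm_num) (one_le_floor_inv hy hy0)
      rw [pow_one] at h3
      rw [div_le_iff₀ (by positivity), pow_succ]
      have h4 : (0 : ℝ) < (1 / 2) ^ k := by positivity
      nlinarith
    · have h1 : (2 - questionMark (gaussMap x)) / 2 ^ ⌊1 / x⌋₊ ≤
          (2 - questionMark (gaussMap y)) / 2 ^ ⌊1 / y⌋₊ := by
        have h2 : (2 : ℝ) ^ (⌊1 / y⌋₊ + 1) ≤ 2 ^ ⌊1 / x⌋₊ :=
          pow_le_pow_right₀ (by norm_num) hlt
        rw [pow_succ] at h2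
        have h5 : (0 : ℝ) < 2 ^ ⌊1 / y⌋₊ := by positivity
        rw [div_le_div_iff₀ (by positivity) (by positivity)]
        nlinarith [hgx.1, hgy.2, mul_nonneg hgx.1 h5.le,
          mul_le_mul_of_nonneg_right hgy.2 (by positivity : (0 : ℝ) ≤ 2 ^ ⌊1 / x⌋₊)]
      have : (0 : ℝ) ≤ (1 / 2) ^ (k + 1) := by positivity
      linarith

theorem questionMark_monotoneOn : MonotoneOn questionMark (Icc 0 1) := by
  intro x hx y hy hxy
  have h := fun k => questionMark_sub_le k x hx y hy hxy
  have := ge_of_tendsto' (tendsto_pow_atTop_nhds_zero_of_lt_one (r := (1 / 2 : ℝ))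
    (by norm_num) (by norm_num)) h
  linarith

/-- The distribution function of the Minkowski measure: the question mark function on `[0,1]`,
continued by `0` on the left and by `1` on the right. -/
noncomputable def minkowskiCDF (x : ℝ) : ℝ := questionMark (max 0 (min x 1))

theorem minkowskiCDF_monotone : Monotone minkowskiCDF := by
  intro x y hxy
  exact questionMark_monotoneOn ⟨le_max_left _ _, max_le zero_le_one (min_le_right _ _)⟩
    ⟨le_max_left _ _, max_le zero_le_one (min_le_right _ _)⟩
    (max_le_max le_rfl (min_le_min hxy le_rfl))

/-- The Minkowski measure `dμ = d?(x)`, the Lebesgue–Stieltjes measure of the question mark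
function. It is a measure on `ℝ` carried by `[0,1]`. -/
noncomputable def minkowskiMeasure : Measure ℝ := minkowskiCDF_monotone.stieltjesFunction.measure

/-- The mean-value constant `α = -(1/2) ∫ log x dμ(x)`. -/
noncomputable def sternAlpha : ℝ := -(1 / 2) * ∫ x, Real.log x ∂minkowskiMeasure

/-- The Farey map. -/
noncomputable def fareyMap (x : ℝ) : ℝ := min (x / (1 - x)) ((1 - x) / x)

/-- `f` has Lipschitz exponent `β` at `x`, i.e. `|f y - f x| = |y - x| ^ (β + o(1))` as `y → x`. -/
def HasLipschitzExponentAt (f : ℝ → ℝ) (β x : ℝ) : Prop :=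
  Tendsto (fun y => Real.log |f y - f x| / Real.log |y - x|) (𝓝[≠] x) (𝓝 β)

/-! ### Random products of matrices -/

/-- The Borel σ-algebra of `GL₂(ℝ)`. -/
noncomputable instance instMeasurableSpaceGLTwo :
    MeasurableSpace (Matrix.GeneralLinearGroup (Fin 2) ℝ) := borel _

/-- The Borel σ-algebra of the real projective line, `ℝ ∪ {∞}`. -/
noncomputable instance instMeasurableSpaceOnePointReal : MeasurableSpace (OnePoint ℝ) := borel _

/-- The Euclidean operator norm of an invertible matrix. -/
noncomputable def glNorm (g : Matrix.GeneralLinearGroup (Fin 2) ℝ) : ℝ :=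
  ‖Matrix.toEuclideanCLM (n := Fin 2) (𝕜 := ℝ) g.val‖

/-- The convolution powers of a measure on `GL₂(ℝ)`: the law of a product of `n` independent
random matrices of law `η`. -/
noncomputable def convPow (η : Measure (Matrix.GeneralLinearGroup (Fin 2) ℝ)) :
    ℕ → Measure (Matrix.GeneralLinearGroup (Fin 2) ℝ)
  | 0 => Measure.dirac 1
  | n + 1 => Measure.mconv η (convPow η n)

/-- `l` is the maximal (first) Lyapunov exponent of `η`: the measure `η` has a finite first moment,
and `(1/n) ∫ log ‖g‖ dη^{*n}(g) → l`. -/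
def IsMaxLyapunovExponent (η : Measure (Matrix.GeneralLinearGroup (Fin 2) ℝ)) (l : ℝ) : Prop :=
  Integrable (fun g => Real.log (max (glNorm g) (glNorm g⁻¹))) η ∧
  (∀ n : ℕ, Integrable (fun g => Real.log (glNorm g)) (convPow η n)) ∧
  Tendsto (fun n : ℕ => (∫ g, Real.log (glNorm g) ∂(convPow η n)) / n) atTop (𝓝 l)

/-- `ξ` is an `η`-stationary probability measure on the projective line: `η * ξ = ξ`. Here `GL₂(ℝ)`
acts on `ℝ ∪ {∞}` by `x ↦ (a x + b) / (c x + d)`. -/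
def IsStationaryMeasure (η : Measure (Matrix.GeneralLinearGroup (Fin 2) ℝ))
    (ξ : Measure (OnePoint ℝ)) : Prop :=
  IsProbabilityMeasure ξ ∧
  (η.prod ξ).map (fun p : Matrix.GeneralLinearGroup (Fin 2) ℝ × OnePoint ℝ => p.1 • p.2) = ξ

/-- The matrix `A₀`. -/
noncomputable def matA0 : Matrix.GeneralLinearGroup (Fin 2) ℝ :=
  Matrix.GeneralLinearGroup.mkOfDetNeZero !![1, 1; 0, 1] (by simp)

/-- The matrix `A₁`. -/
noncomputable def matA1 : Matrix.GeneralLinearGroup (Fin 2) ℝ :=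
  Matrix.GeneralLinearGroup.mkOfDetNeZero !![1, 0; 1, 1] (by simp)

/-- The measure `η = (1/2) δ_{A₀} + (1/2) δ_{A₁}` on `GL₂(ℝ)`. -/
noncomputable def sternEta : Measure (Matrix.GeneralLinearGroup (Fin 2) ℝ) :=
  (1 / 2 : ENNReal) • Measure.dirac matA0 + (1 / 2 : ENNReal) • Measure.dirac matA1

/-- The Minkowski measure as a measure on `ℝ ∪ {∞}`. -/
noncomputable def minkowskiMeasureProj : Measure (OnePoint ℝ) :=
  minkowskiMeasure.map (fun x : ℝ => (x : OnePoint ℝ))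

/-- The involution `T(x) = 1/x` of `ℝ ∪ {∞}`, which exchanges `0` and `∞`. -/
noncomputable def projInv (p : OnePoint ℝ) : OnePoint ℝ :=
  p.elim ((0 : ℝ) : OnePoint ℝ) fun x => if x = 0 then OnePoint.infty else ((1 / x : ℝ) : OnePoint ℝ)

/-- The measure `ξ = (1/2) μ + (1/2) T^* μ` on `ℝ ∪ {∞}`. -/
noncomputable def sternXi : Measure (OnePoint ℝ) :=
  (1 / 2 : ENNReal) • minkowskiMeasureProj +
    (1 / 2 : ENNReal) • minkowskiMeasureProj.map projInv

/-! Everything rests on self-similarity. Let L(x) = x/(1+x) and R(x) = 1/(1+x) be the inverse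
branches of the Farey map F. Then ?(Lx) = ?(x)/2 and ?(Rx) = 1 - ?(x)/2, so μ is the average of its
images under L and R (`minkowskiMeasure_selfSimilar`). Hence μ is F-invariant, with transfer
operator Pu = (u∘L + u∘R)/2. Integrating log this way gives α = ∫ log(1+x) dμ. The symmetry 1 - L =
R turns this integral into the moment series, and |F'| = (1+x)^2 at both Lx and Rx gives (iii). The
matrices A₀, A₁ act on x and 1/x through L and R up to inversion, so stationarity of ξ is
self-similarity once more.

The limit theorems come from an explicit solution of a Poisson equation. Put h(x) = ∫ log(1+xy)
dμ(y), g(x) = ∫ log(x+y) dμ(y), k = (h+g)/2 and ψ = (g-h)/2. Then k(Lx) + log(1+x) = k(x) + α +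
ψ(x), and the same holds for R with -ψ. Let M(n) be the larger of s(n), s(n+1), and r(n) the ratio
of the smaller to the larger. Both 2n and 2n+1 have maximum M(n)(1+r(n)), and their ratios are
L(r(n)) and R(r(n)) in some order. So X = log M + k(r) is a martingale with drift α and increments
±ψ(r). Its row means are exactly linear, and its centred second moments are X(1)^2 plus the sum of
P^j ψ^2 (1) over j < N. Since P^2 contracts Lipschitz seminorms, these moments divided by N tend to
∫ ψ^2 dμ. Now log s(n) is X up to O(log N), and the log norms of the matrix products are X up to
O(1); this gives the mean, the variance and the Lyapunov exponent. Comparing the Gauss map with the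
Farey map rewrites ∫ ψ^2 dμ in the form (v) (`integral_gaussIncrement_sq`).

For the Lipschitz exponent, the same k writes log|F'| - 2α as a coboundary plus a function equal to
±2ψ(x) at the two preimages of x. Its translates along orbits are orthogonal, so a second moment
argument gives Birkhoff averages 2α almost everywhere. The Farey interval of order n around x has
?-length 2^(-n), and length exp(-S_n) up to a factor polynomial in n, S_n being the Birkhoff sum of
log|F'|. By Borel-Cantelli, x is eventually not too close to its ends. Comparing y with the first
Farey interval that misses it yields the exponent log 2/(2α). -/

/-! ### Functional equations and continuity of the question mark function -/

/-- The left inverse branch of the Farey map. -/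
noncomputable def fareyLeft (x : ℝ) : ℝ := x / (1 + x)

/-- The right inverse branch of the Farey map. -/
noncomputable def fareyRight (x : ℝ) : ℝ := 1 / (1 + x)

theorem fareyLeft_mem {x : ℝ} (hx : x ∈ Icc (0 : ℝ) 1) : fareyLeft x ∈ Icc (0 : ℝ) 1 := by
  obtain ⟨h0, h1⟩ := hx
  refine ⟨by unfold fareyLeft; positivity, ?_⟩
  rw [fareyLeft, div_le_one (by positivity)]
  linarith

theorem fareyRight_mem {x : ℝ} (hx : x ∈ Icc (0 : ℝ) 1) : fareyRight x ∈ Icc (0 : ℝ) 1 := by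
  obtain ⟨h0, h1⟩ := hx
  refine ⟨by unfold fareyRight; positivity, ?_⟩
  rw [fareyRight, div_le_one (by positivity)]
  linarith

theorem fareyLeft_mem_Ioo {x : ℝ} (hx : x ∈ Ioo (0 : ℝ) 1) : fareyLeft x ∈ Ioo (0 : ℝ) 1 := by
  obtain ⟨h0, h1⟩ := hx
  refine ⟨by unfold fareyLeft; positivity, ?_⟩
  rw [fareyLeft, div_lt_one (by positivity)]
  linarith

theorem fareyRight_mem_Ioo {x : ℝ} (hx : x ∈ Ioo (0 : ℝ) 1) : fareyRight x ∈ Ioo (0 : ℝ) 1 := by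
  obtain ⟨h0, h1⟩ := hx
  refine ⟨by unfold fareyRight; positivity, ?_⟩
  rw [fareyRight, div_lt_one (by positivity)]
  linarith

theorem one_sub_fareyLeft {x : ℝ} (hx : 0 ≤ x) : 1 - fareyLeft x = fareyRight x := by
  unfold fareyLeft fareyRight
  have : 1 + x ≠ 0 := by positivity
  field_simp
  ring

theorem one_div_fareyLeft {x : ℝ} (h : 0 < x) : 1 / fareyLeft x = 1 / x + 1 := by
  unfold fareyLeft
  field_simp

theorem questionMark_fareyLeft {x : ℝ} (hx : x ∈ Icc (0 : ℝ) 1) :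
    questionMark (fareyLeft x) = questionMark x / 2 := by
  rcases hx.1.eq_or_lt with h | h
  · rw [← h]
    simp [fareyLeft, questionMark_zero]
  have hpos : 0 < fareyLeft x := by unfold fareyLeft; positivity
  rw [questionMark_rec (fareyLeft_mem hx) hpos.ne', questionMark_rec hx h.ne']
  have e2 : gaussMap (fareyLeft x) = gaussMap x := by
    rw [gaussMap, one_div_fareyLeft h, Int.fract_add_one, gaussMap]
  have e3 : ⌊1 / fareyLeft x⌋₊ = ⌊1 / x⌋₊ + 1 := by
    rw [one_div_fareyLeft h, Nat.floor_add_one (by positivity)]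
  rw [e2, e3, pow_succ]
  field_simp

theorem questionMark_fareyRight {x : ℝ} (hx : x ∈ Icc (0 : ℝ) 1) :
    questionMark (fareyRight x) = 1 - questionMark x / 2 := by
  have hpos : 0 < fareyRight x := by
    have := hx.1
    unfold fareyRight; positivity
  have e1 : 1 / fareyRight x = 1 + x := by simp [fareyRight]
  rw [questionMark_rec (fareyRight_mem hx) hpos.ne', e1, gaussMap, e1]
  rcases hx.2.eq_or_lt with h | h
  -- At x = 1 the expansion of 1/2 has the single digit 2, not 1 followed by 1, so the generic
  -- computation with floor 1 does not apply.
  · have h1 : questionMark 1 = 1 := by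
      rw [questionMark_rec ⟨zero_le_one, le_rfl⟩ one_ne_zero]
      simp [gaussMap, questionMark_zero]
    rw [h, h1, show (1 : ℝ) + 1 = ((2 : ℕ) : ℝ) by norm_num, Nat.floor_natCast, Int.fract_natCast,
      questionMark_zero]
    norm_num
  · have h2 : ⌊1 + x⌋₊ = 1 := by
      rw [Nat.floor_eq_iff (by linarith [hx.1])]
      push_cast
      exact ⟨by linarith [hx.1], by linarith⟩
    have h3 : Int.fract (1 + x) = x := by
      rw [Int.fract_one_add, Int.fract_eq_self]
      exact ⟨hx.1, h⟩
    rw [h2, h3]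
    ring

theorem questionMark_one : questionMark 1 = 1 := by
  have := questionMark_fareyRight (x := 0) ⟨le_rfl, zero_le_one⟩
  simpa [fareyRight, questionMark_zero] using this

theorem minkowskiCDF_of_mem {x : ℝ} (hx : x ∈ Icc (0 : ℝ) 1) :
    minkowskiCDF x = questionMark x := by
  rw [minkowskiCDF, min_eq_left hx.2, max_eq_right hx.1]

theorem minkowskiCDF_of_nonpos {x : ℝ} (hx : x ≤ 0) : minkowskiCDF x = 0 := by
  rw [minkowskiCDF, min_eq_left (by linarith), max_eq_left hx, questionMark_zero]

theorem minkowskiCDF_of_one_le {x : ℝ} (hx : 1 ≤ x) : minkowskiCDF x = 1 := by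
  rw [minkowskiCDF, min_eq_right hx, max_eq_right zero_le_one, questionMark_one]

/-- The functional equations halve the mesh: the left branch attains the values in the lower half,
the right branch those in the upper half, with numerator reflected to 2^(n+1) - j. -/
theorem exists_questionMark_eq_dyadic (n : ℕ) :
    ∀ j : ℕ, j ≤ 2 ^ n → ∃ x ∈ Icc (0 : ℝ) 1, questionMark x = (j : ℝ) / 2 ^ n := by
  induction n with
  | zero =>
    intro j hj
    interval_cases j
    · exact ⟨0, by simp, by simp [questionMark_zero]⟩
    · exact ⟨1, by simp, by simp [questionMark_one]⟩
  | succ n ih =>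
    intro j hj
    rcases le_total j (2 ^ n) with h | h
    · obtain ⟨x, hx, he⟩ := ih j h
      refine ⟨_, fareyLeft_mem hx, ?_⟩
      rw [questionMark_fareyLeft hx, he, pow_succ, div_div]
    · have hj' : 2 ^ (n + 1) - j ≤ 2 ^ n := by
        rw [pow_succ] at hj ⊢; omega
      obtain ⟨x, hx, he⟩ := ih _ hj'
      refine ⟨_, fareyRight_mem hx, ?_⟩
      rw [questionMark_fareyRight hx, he, Nat.cast_sub hj, pow_succ]
      push_cast
      field_simp
      ring

/-- A monotone function with dense range is continuous. To have dense range in all of ℝ, the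
distribution function is modified to `h`, which is the identity outside `[0,1]`; inside, the dyadic
values suffice. -/
theorem minkowskiCDF_continuous : Continuous minkowskiCDF := by
  set c : ℝ → ℝ := fun x => max 0 (min x 1) with hc
  have hcc : Continuous c := by fun_prop
  set h : ℝ → ℝ := fun x => minkowskiCDF x + (x - c x) with hh
  have hin : ∀ x ∈ Icc (0 : ℝ) 1, h x = questionMark x := by
    intro x hx
    simp only [hh, hc]
    rw [minkowskiCDF_of_mem hx, min_eq_left hx.2, max_eq_right hx.1]
    ring
  have hmono : Monotone h := by
    refine minkowskiCDF_monotone.add ?_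
    intro x y hxy
    simp only [hc]
    rcases le_total x 1 with h1 | h1 <;> rcases le_total y 1 with h2 | h2 <;>
    rcases le_total 0 x with h3 | h3 <;> rcases le_total 0 y with h4 | h4 <;>
    simp [h1, h2, h3, h4] <;> linarith
  have hdense : DenseRange h := by
    intro y
    rw [Metric.mem_closure_iff]
    intro ε hε
    by_cases hy0 : y < 0
    · refine ⟨h y, mem_range_self _, ?_⟩
      simp only [hh, hc]
      rw [minkowskiCDF_of_nonpos hy0.le, min_eq_left (by linarith), max_eq_left hy0.le]
      simpa using hε
    by_cases hy1 : 1 < y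
    · refine ⟨h y, mem_range_self _, ?_⟩
      simp only [hh, hc]
      rw [minkowskiCDF_of_one_le hy1.le, min_eq_right hy1.le, max_eq_right zero_le_one]
      simpa using hε
    push Not at hy0 hy1
    obtain ⟨n, hn⟩ := exists_pow_lt_of_lt_one hε (by norm_num : (1 / 2 : ℝ) < 1)
    have hp : (0 : ℝ) < 2 ^ n := by positivity
    have hfl : ⌊y * 2 ^ n⌋₊ ≤ 2 ^ n := by
      have : ⌊y * 2 ^ n⌋₊ ≤ ⌊((2 ^ n : ℕ) : ℝ)⌋₊ := Nat.floor_mono (by push_cast; nlinarith)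
      rwa [Nat.floor_natCast] at this
    obtain ⟨x, hx, he⟩ := exists_questionMark_eq_dyadic n _ hfl
    refine ⟨h x, mem_range_self _, ?_⟩
    rw [hin x hx, he, Real.dist_eq]
    have h1 := Nat.floor_le (by positivity : 0 ≤ y * 2 ^ n)
    have h2 := Nat.lt_floor_add_one (y * 2 ^ n)
    refine lt_of_le_of_lt ?_ hn
    rw [one_div_pow, abs_le]
    constructor
    · rw [neg_le, neg_sub, sub_le_iff_le_add, div_le_iff₀ hp]
      have : 0 ≤ 1 / 2 ^ n * (2 : ℝ) ^ n := by positivity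
      nlinarith
    · rw [sub_le_iff_le_add, ← add_div, le_div_iff₀ hp]
      linarith
  have := hmono.continuous_of_denseRange hdense
  have e : minkowskiCDF = fun x => h x - (x - c x) := by
    ext x; simp [hh]
  rw [e]
  fun_prop

theorem questionMark_continuousOn : ContinuousOn questionMark (Icc 0 1) :=
  minkowskiCDF_continuous.continuousOn.congr fun _ hx => (minkowskiCDF_of_mem hx).symm

/-! ### The Minkowski measure -/

theorem minkowskiCDF_stieltjes_apply (x : ℝ) :
    minkowskiCDF_monotone.stieltjesFunction x = minkowskiCDF x := by
  rw [Monotone.stieltjesFunction_eq]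
  exact rightLim_eq_of_tendsto 
    (minkowskiCDF_continuous.continuousAt.tendsto.mono_left nhdsWithin_le_nhds)

theorem minkowskiCDF_tendsto_atBot :
    Tendsto minkowskiCDF_monotone.stieltjesFunction atBot (𝓝 0) := by
  refine tendsto_const_nhds.congr' ?_
  filter_upwards [eventually_le_atBot 0] with x hx
  rw [minkowskiCDF_stieltjes_apply, minkowskiCDF_of_nonpos hx]

theorem minkowskiCDF_tendsto_atTop :
    Tendsto minkowskiCDF_monotone.stieltjesFunction atTop (𝓝 1) := by
  refine tendsto_const_nhds.congr' ?_
  filter_upwards [eventually_ge_atTop 1] with x hx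
  rw [minkowskiCDF_stieltjes_apply, minkowskiCDF_of_one_le hx]

instance minkowskiMeasure_isProbabilityMeasure : IsProbabilityMeasure minkowskiMeasure :=
  StieltjesFunction.isProbabilityMeasure _ minkowskiCDF_tendsto_atBot minkowskiCDF_tendsto_atTop

theorem minkowskiMeasure_Iic (x : ℝ) :
    minkowskiMeasure (Iic x) = ENNReal.ofReal (minkowskiCDF x) := by
  rw [minkowskiMeasure, StieltjesFunction.measure_Iic _ minkowskiCDF_tendsto_atBot, sub_zero,
    minkowskiCDF_stieltjes_apply]

instance minkowskiMeasure_nullSingletonClass : NullSingletonClass minkowskiMeasure := by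
  refine ⟨fun x => ?_⟩
  rw [minkowskiMeasure, StieltjesFunction.measure_singleton]
  have : (minkowskiCDF_monotone.stieltjesFunction : ℝ → ℝ) = minkowskiCDF :=
    funext minkowskiCDF_stieltjes_apply
  rw [this, leftLim_eq_of_tendsto 
    (minkowskiCDF_continuous.continuousAt.tendsto.mono_left nhdsWithin_le_nhds)]
  simp

theorem minkowskiMeasure_Ici (x : ℝ) :
    minkowskiMeasure (Ici x) = ENNReal.ofReal (1 - minkowskiCDF x) := by
  rw [← measure_congr (Ioi_ae_eq_Ici (μ := minkowskiMeasure) (a := x)), minkowskiMeasure,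
    StieltjesFunction.measure_Ioi _ minkowskiCDF_tendsto_atTop, minkowskiCDF_stieltjes_apply]

theorem ae_minkowskiMeasure_mem_Ioo : ∀ᵐ x ∂minkowskiMeasure, x ∈ Ioo (0 : ℝ) 1 := by
  have h1 : ∀ᵐ x ∂minkowskiMeasure, x ∉ Iic (0 : ℝ) := by
    rw [← measure_eq_zero_iff_ae_notMem, minkowskiMeasure_Iic, minkowskiCDF_of_nonpos le_rfl]
    simp
  have h2 : ∀ᵐ x ∂minkowskiMeasure, x ∉ Ici (1 : ℝ) := by
    rw [← measure_eq_zero_iff_ae_notMem, minkowskiMeasure_Ici, minkowskiCDF_of_one_le le_rfl]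
    simp
  filter_upwards [h1, h2] with x hx1 hx2
  exact ⟨not_le.1 hx1, not_le.1 hx2⟩

theorem ae_minkowskiMeasure_mem_Icc : ∀ᵐ x ∂minkowskiMeasure, x ∈ Icc (0 : ℝ) 1 :=
  ae_minkowskiMeasure_mem_Ioo.mono fun _ hx => Ioo_subset_Icc_self hx

@[fun_prop]
theorem measurable_fareyLeft : Measurable fareyLeft := by unfold fareyLeft; fun_prop

@[fun_prop]
theorem measurable_fareyRight : Measurable fareyRight := by unfold fareyRight; fun_prop

/-- Self-similarity of the Minkowski measure. -/
theorem minkowskiMeasure_selfSimilar :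
    minkowskiMeasure = (1 / 2 : ENNReal) • minkowskiMeasure.map fareyLeft +
      (1 / 2 : ENNReal) • minkowskiMeasure.map fareyRight := by
  refine Measure.ext_of_Iic _ _ fun b => ?_
  -- Preimages under the branches need to be known only on (0,1), which has full measure.
  have key : ∀ {s t : Set ℝ}, (∀ x ∈ Ioo (0 : ℝ) 1, x ∈ s ↔ x ∈ t) →
      minkowskiMeasure s = minkowskiMeasure t := by
    intro s t h
    refine measure_congr ?_
    filter_upwards [ae_minkowskiMeasure_mem_Ioo] with x hx
    exact propext (h x hx)
  simp only [Measure.add_apply, Measure.smul_apply, smul_eq_mul]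
  rw [Measure.map_apply (by fun_prop) measurableSet_Iic,
    Measure.map_apply (by fun_prop) measurableSet_Iic]
  have half : ∀ r : ℝ, (1 / 2 : ENNReal) * ENNReal.ofReal r = ENNReal.ofReal (r / 2) := by
    intro r
    rw [div_eq_inv_mul, ENNReal.ofReal_mul (by norm_num), ENNReal.ofReal_inv_of_pos (by norm_num)]
    simp
  rw [minkowskiMeasure_Iic]
  by_cases hb0 : b < 0
  · rw [key (s := fareyLeft ⁻¹' Iic b) (t := ∅), key (s := fareyRight ⁻¹' Iic b) (t := ∅),
      minkowskiCDF_of_nonpos hb0.le]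
    · simp
    · intro x hx
      have := (fareyRight_mem_Ioo hx).1
      simp only [mem_preimage, mem_Iic, mem_empty_iff_false, iff_false, not_le]
      linarith
    · intro x hx
      have := (fareyLeft_mem_Ioo hx).1
      simp only [mem_preimage, mem_Iic, mem_empty_iff_false, iff_false, not_le]
      linarith
  push Not at hb0
  by_cases hb1 : 1 < b
  · rw [key (s := fareyLeft ⁻¹' Iic b) (t := univ), key (s := fareyRight ⁻¹' Iic b) (t := univ),
      minkowskiCDF_of_one_le hb1.le]
    · simp [ENNReal.inv_two_add_inv_two]
    · intro x hx
      have := (fareyRight_mem_Ioo hx).2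
      simp only [mem_preimage, mem_Iic, mem_univ, iff_true]
      linarith
    · intro x hx
      have := (fareyLeft_mem_Ioo hx).2
      simp only [mem_preimage, mem_Iic, mem_univ, iff_true]
      linarith
  push Not at hb1
  -- The point 1/2 separates the images of the two branches. Below it only the left branch
  -- contributes; above it the left branch contributes its full mass, and the decreasing right
  -- branch turns the lower ray into an upper ray.
  rcases lt_or_ge b (1 / 2) with hb | hb
  · set c := b / (1 - b) with hc
    have hcm : c ∈ Icc (0 : ℝ) 1 := by
      refine ⟨div_nonneg hb0 (by linarith), ?_⟩
      rw [hc, div_le_one (by linarith)]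
      linarith
    have hbc : b = fareyLeft c := by
      have : (1 - b) ≠ 0 := by linarith
      rw [hc, fareyLeft]
      field_simp
      ring
    rw [key (s := fareyLeft ⁻¹' Iic b) (t := Iic c), key (s := fareyRight ⁻¹' Iic b) (t := ∅),
      minkowskiMeasure_Iic, measure_empty, mul_zero, add_zero, half,
      minkowskiCDF_of_mem ⟨hb0, hb1⟩, minkowskiCDF_of_mem hcm, hbc, questionMark_fareyLeft hcm]
    · intro x hx
      simp only [mem_preimage, mem_Iic, mem_empty_iff_false, iff_false, not_le, fareyRight]
      rw [lt_div_iff₀ (by linarith [hx.1])]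
      nlinarith [hx.1, hx.2]
    · intro x hx
      simp only [mem_preimage, mem_Iic, fareyLeft, hc]
      rw [div_le_iff₀ (by linarith [hx.1]), le_div_iff₀ (by linarith)]
      constructor <;> intro h <;> linarith
  · set c := (1 - b) / b with hc
    have hbp : 0 < b := by linarith
    have hcm : c ∈ Icc (0 : ℝ) 1 := by
      refine ⟨div_nonneg (by linarith) (by linarith), ?_⟩
      rw [hc, div_le_one (by linarith)]
      linarith
    have hbc : b = fareyRight c := by
      rw [hc, fareyRight]
      field_simp
      ring
    have hq := questionMark_mem hcm
    rw [key (s := fareyLeft ⁻¹' Iic b) (t := univ), key (s := fareyRight ⁻¹' Iic b) (t := Ici c),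
      minkowskiMeasure_Ici, measure_univ, half,
      show (1 / 2 : ENNReal) * 1 = ENNReal.ofReal (1 / 2) by rw [← half, ENNReal.ofReal_one],
      ← ENNReal.ofReal_add (by norm_num) (by rw [minkowskiCDF_of_mem hcm]; linarith [hq.2]),
      minkowskiCDF_of_mem ⟨hb0, hb1⟩, minkowskiCDF_of_mem hcm, hbc, questionMark_fareyRight hcm]
    · congr 1; ring
    · intro x hx
      simp only [mem_preimage, mem_Iic, mem_Ici, fareyRight, hc]
      rw [div_le_iff₀ (by linarith [hx.1]), div_le_iff₀ (by linarith)]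
      constructor <;> intro h <;> linarith
    · intro x hx
      simp only [mem_preimage, mem_Iic, mem_univ, iff_true, fareyLeft]
      rw [div_le_iff₀ (by linarith [hx.1])]
      nlinarith [hx.1, hx.2]

/-- This domination lets integrability pass from `f` to its composition with a branch. -/
theorem minkowskiMeasure_map_fareyLeft_le :
    minkowskiMeasure.map fareyLeft ≤ (2 : ENNReal) • minkowskiMeasure := by
  conv_rhs => rw [minkowskiMeasure_selfSimilar]
  rw [smul_add, smul_smul, smul_smul]
  simp only [one_div]
  rw [ENNReal.mul_inv_cancel (by norm_num) (by norm_num), one_smul, one_smul]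
  exact Measure.le_add_right le_rfl

theorem minkowskiMeasure_map_fareyRight_le :
    minkowskiMeasure.map fareyRight ≤ (2 : ENNReal) • minkowskiMeasure := by
  conv_rhs => rw [minkowskiMeasure_selfSimilar]
  rw [smul_add, smul_smul, smul_smul]
  simp only [one_div]
  rw [ENNReal.mul_inv_cancel (by norm_num) (by norm_num), one_smul, one_smul]
  exact Measure.le_add_left le_rfl

theorem integrable_comp_fareyLeft {f : ℝ → ℝ} (hf : Integrable f minkowskiMeasure) :
    Integrable (fun x => f (fareyLeft x)) minkowskiMeasure :=
  (Integrable.of_measure_le_smul (by norm_num) minkowskiMeasure_map_fareyLeft_le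
    hf).comp_measurable measurable_fareyLeft

theorem integrable_comp_fareyRight {f : ℝ → ℝ} (hf : Integrable f minkowskiMeasure) :
    Integrable (fun x => f (fareyRight x)) minkowskiMeasure :=
  (Integrable.of_measure_le_smul (by norm_num) minkowskiMeasure_map_fareyRight_le
    hf).comp_measurable measurable_fareyRight

theorem integral_minkowskiMeasure {f : ℝ → ℝ} (hf : Integrable f minkowskiMeasure) :
    ∫ x, f x ∂minkowskiMeasure = (∫ x, f (fareyLeft x) ∂minkowskiMeasure +
      ∫ x, f (fareyRight x) ∂minkowskiMeasure) / 2 := by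
  have h1 : Integrable f (minkowskiMeasure.map fareyLeft) :=
    Integrable.of_measure_le_smul (by norm_num) minkowskiMeasure_map_fareyLeft_le hf
  have h2 : Integrable f (minkowskiMeasure.map fareyRight) :=
    Integrable.of_measure_le_smul (by norm_num) minkowskiMeasure_map_fareyRight_le hf
  conv_lhs => rw [minkowskiMeasure_selfSimilar]
  rw [integral_add_measure (h1.smul_measure (by norm_num)) (h2.smul_measure (by norm_num)),
    integral_smul_measure, integral_smul_measure,
    integral_map (by fun_prop) h1.aestronglyMeasurable,
    integral_map (by fun_prop) h2.aestronglyMeasurable]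
  simp
  ring

/-! ### Integrability and inverse moments -/

/-- A function which is measurable and bounded on `[0,1]` is integrable. -/
theorem integrable_minkowskiMeasure_of_bound {f : ℝ → ℝ} (C : ℝ)
    (hm : AEStronglyMeasurable f minkowskiMeasure) (hf : ∀ x ∈ Ioo (0 : ℝ) 1, |f x| ≤ C) :
    Integrable f minkowskiMeasure :=
  Integrable.of_bound hm C (ae_minkowskiMeasure_mem_Ioo.mono hf)

theorem integral_minkowskiMeasure_congr {f g : ℝ → ℝ} (h : ∀ x ∈ Ioo (0 : ℝ) 1, f x = g x) :
    ∫ x, f x ∂minkowskiMeasure = ∫ x, g x ∂minkowskiMeasure :=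
  integral_congr_ae (ae_minkowskiMeasure_mem_Ioo.mono h)

theorem integrable_minkowskiMeasure_congr {f g : ℝ → ℝ} (hf : Integrable f minkowskiMeasure)
    (h : ∀ x ∈ Ioo (0 : ℝ) 1, f x = g x) : Integrable g minkowskiMeasure :=
  hf.congr (ae_minkowskiMeasure_mem_Ioo.mono h)

/-- The left branch sends 1/x to 1/x + 1 and has weight only 1/2, so self-similarity bounds the
second inverse moment by a fraction of itself plus a constant. The truncation at `M` makes it
finite, so that it can be absorbed. -/
theorem lintegral_inv_sq_minkowskiMeasure_lt_top :
    ∫⁻ x, ENNReal.ofReal ((x⁻¹) ^ 2) ∂minkowskiMeasure < ⊤ := by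
  -- With J the truncated integral, (m+1)^2 ≤ (3/2)m^2 + 3 on the left branch and the bound 4 on the
  -- right one give J ≤ ((3/2)J + 3 + 4)/2, that is, J ≤ 14.
  have key : ∀ M : ℕ, ∫ x, (min x⁻¹ M) ^ 2 ∂minkowskiMeasure ≤ 14 := by
    intro M
    have hmeas : Measurable fun x : ℝ => (min x⁻¹ (M : ℝ)) ^ 2 := by fun_prop
    have hnn : ∀ x ∈ Ioo (0 : ℝ) 1, 0 ≤ min x⁻¹ (M : ℝ) := fun x hx =>
      le_min (inv_nonneg.2 hx.1.le) (Nat.cast_nonneg _)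
    have hint : Integrable (fun x : ℝ => (min x⁻¹ (M : ℝ)) ^ 2) minkowskiMeasure := by
      refine integrable_minkowskiMeasure_of_bound ((M : ℝ) ^ 2) hmeas.aestronglyMeasurable ?_
      intro x hx
      rw [abs_of_nonneg (sq_nonneg _)]
      exact pow_le_pow_left₀ (hnn x hx) (min_le_right _ _) 2
    have h1 : ∫ x, (min (fareyLeft x)⁻¹ (M : ℝ)) ^ 2 ∂minkowskiMeasure ≤
        ∫ x, (3 / 2 * (min x⁻¹ (M : ℝ)) ^ 2 + 3) ∂minkowskiMeasure := by
      refine integral_mono_ae (integrable_comp_fareyLeft hint)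
        ((hint.const_mul _).add (integrable_const _)) ?_
      filter_upwards [ae_minkowskiMeasure_mem_Ioo] with x hx
      have hl := hnn _ (fareyLeft_mem_Ioo hx)
      have hle : min (fareyLeft x)⁻¹ (M : ℝ) ≤ min x⁻¹ (M : ℝ) + 1 := by
        rw [inv_eq_one_div, one_div_fareyLeft hx.1, ← min_add_add_right, one_div]
        exact min_le_min le_rfl (by linarith)
      have := hnn x hx
      nlinarith [sq_nonneg (min x⁻¹ (M : ℝ) - 2)]
    have h2 : ∫ x, (min (fareyRight x)⁻¹ (M : ℝ)) ^ 2 ∂minkowskiMeasure ≤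
        ∫ x, (4 : ℝ) ∂minkowskiMeasure := by
      refine integral_mono_ae (integrable_comp_fareyRight hint) (integrable_const _) ?_
      filter_upwards [ae_minkowskiMeasure_mem_Ioo] with x hx
      have hl := hnn _ (fareyRight_mem_Ioo hx)
      have hle : min (fareyRight x)⁻¹ (M : ℝ) ≤ 2 := by
        refine (min_le_left _ _).trans ?_
        simp only [fareyRight, one_div, inv_inv]
        linarith [hx.2]
      nlinarith
    rw [integral_add (hint.const_mul _) (integrable_const _), integral_const_mul] at h1
    have h3 := integral_minkowskiMeasure hint
    simp only [integral_const, probReal_univ, smul_eq_mul, one_mul] at h1 h2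
    linarith
  have hlim : Tendsto (fun M : ℕ => ∫⁻ x, ENNReal.ofReal ((min x⁻¹ (M : ℝ)) ^ 2) ∂minkowskiMeasure)
      atTop (𝓝 (∫⁻ x, ENNReal.ofReal ((x⁻¹) ^ 2) ∂minkowskiMeasure)) := by
    refine lintegral_tendsto_of_tendsto_of_monotone ?_ ?_ ?_
    · intro M
      fun_prop
    · filter_upwards [ae_minkowskiMeasure_mem_Ioo] with x hx M N hMN
      have : 0 ≤ min x⁻¹ (M : ℝ) := le_min (inv_nonneg.2 hx.1.le) (Nat.cast_nonneg _)
      refine ENNReal.ofReal_le_ofReal (pow_le_pow_left₀ this ?_ 2)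
      exact min_le_min le_rfl (by exact_mod_cast hMN)
    · refine ae_of_all _ fun x => tendsto_const_nhds.congr' ?_
      filter_upwards [eventually_ge_atTop ⌈x⁻¹⌉₊] with M hM
      rw [min_eq_left (Nat.ceil_le.1 hM)]
  refine (le_of_tendsto' hlim fun M => ?_).trans_lt (ENNReal.ofReal_lt_top (r := 14))
  rw [← ofReal_integral_eq_lintegral_ofReal]
  · exact ENNReal.ofReal_le_ofReal (key M)
  · refine integrable_minkowskiMeasure_of_bound ((M : ℝ) ^ 2) (by fun_prop) ?_
    intro x hx
    rw [abs_of_nonneg (sq_nonneg _)]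
    exact pow_le_pow_left₀ (le_min (inv_nonneg.2 hx.1.le) (Nat.cast_nonneg _)) (min_le_right _ _) 2
  · exact ae_of_all _ fun x => sq_nonneg _

theorem integrable_inv_sq_minkowskiMeasure :
    Integrable (fun x : ℝ => (x⁻¹) ^ 2) minkowskiMeasure := by
  refine ⟨by fun_prop, ?_⟩
  rw [hasFiniteIntegral_iff_ofReal (ae_of_all _ fun x => sq_nonneg _)]
  exact lintegral_inv_sq_minkowskiMeasure_lt_top

theorem integrable_inv_minkowskiMeasure : Integrable (fun x : ℝ => x⁻¹) minkowskiMeasure := by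
  refine integrable_inv_sq_minkowskiMeasure.mono' (by fun_prop) ?_
  filter_upwards [ae_minkowskiMeasure_mem_Ioo] with x hx
  have := (one_lt_inv₀ hx.1).2 hx.2
  rw [Real.norm_of_nonneg (by linarith)]
  nlinarith

/-! ### The constant `sternAlpha` -/

theorem abs_log_le_inv {x : ℝ} (hx : x ∈ Ioo (0 : ℝ) 1) : |Real.log x| ≤ x⁻¹ := by
  rw [abs_of_neg (Real.log_neg hx.1 hx.2)]
  linarith [Real.one_sub_inv_le_log_of_pos hx.1]

theorem integrable_log_minkowskiMeasure : Integrable Real.log minkowskiMeasure := by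
  refine integrable_inv_minkowskiMeasure.mono' (by fun_prop) ?_
  filter_upwards [ae_minkowskiMeasure_mem_Ioo] with x hx
  exact abs_log_le_inv hx

theorem integrable_log_one_add_minkowskiMeasure :
    Integrable (fun x : ℝ => Real.log (1 + x)) minkowskiMeasure := by
  refine integrable_minkowskiMeasure_of_bound 1
    (Measurable.aestronglyMeasurable (by fun_prop)) fun x hx => ?_
  have h1 := Real.log_le_sub_one_of_pos (show 0 < 1 + x by linarith [hx.1])
  rw [abs_of_nonneg (Real.log_nonneg (by linarith [hx.1]))]
  linarith [hx.2]

/-- Since log L(x) = log x - log(1+x) and log R(x) = -log(1+x), self-similarity reads I = (I - 2A)/2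
for I = ∫ log x and A = ∫ log(1+x), whence I = -2A. -/
theorem sternAlpha_eq_integral_log_one_add :
    sternAlpha = ∫ x, Real.log (1 + x) ∂minkowskiMeasure := by
  have h := integral_minkowskiMeasure integrable_log_minkowskiMeasure
  have h1 : ∫ x, Real.log (fareyLeft x) ∂minkowskiMeasure =
      ∫ x, Real.log x ∂minkowskiMeasure - ∫ x, Real.log (1 + x) ∂minkowskiMeasure := by
    rw [← integral_sub integrable_log_minkowskiMeasure integrable_log_one_add_minkowskiMeasure]
    refine integral_minkowskiMeasure_congr fun x hx => ?_
    rw [fareyLeft, Real.log_div hx.1.ne' (by linarith [hx.1])]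
  have h2 : ∫ x, Real.log (fareyRight x) ∂minkowskiMeasure =
      - ∫ x, Real.log (1 + x) ∂minkowskiMeasure := by
    rw [← integral_neg]
    refine integral_minkowskiMeasure_congr fun x hx => ?_
    rw [fareyRight, one_div, Real.log_inv]
  rw [h1, h2] at h
  rw [sternAlpha]
  linarith

theorem sternAlpha_pos : 0 < sternAlpha := by
  rw [sternAlpha_eq_integral_log_one_add, integral_pos_iff_support_of_nonneg_ae _
    integrable_log_one_add_minkowskiMeasure]
  · have : ∀ᵐ x ∂minkowskiMeasure, x ∈ Function.support fun x : ℝ => Real.log (1 + x) := by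
      filter_upwards [ae_minkowskiMeasure_mem_Ioo] with x hx
      exact (Real.log_pos (by linarith [hx.1])).ne'
    rw [measure_eq_measure_of_null_sdiff (subset_univ _)]
    · simp
    · rw [← compl_eq_univ_sdiff]
      exact this
  · filter_upwards [ae_minkowskiMeasure_mem_Ioo] with x hx
    exact Real.log_nonneg (by linarith [hx.1])

/-- The Minkowski measure is symmetric about `1 / 2`. -/
theorem integral_one_sub_minkowskiMeasure {f : ℝ → ℝ} (hf : Integrable f minkowskiMeasure)
    (hf' : Integrable (fun x => f (1 - x)) minkowskiMeasure) :
    ∫ x, f (1 - x) ∂minkowskiMeasure = ∫ x, f x ∂minkowskiMeasure := by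
  rw [integral_minkowskiMeasure hf, integral_minkowskiMeasure hf', add_comm]
  congr 2
  · refine integral_minkowskiMeasure_congr fun x hx => ?_
    rw [← one_sub_fareyLeft hx.1.le, sub_sub_cancel]
  · refine integral_minkowskiMeasure_congr fun x hx => ?_
    rw [← one_sub_fareyLeft hx.1.le]

theorem integrable_pow_minkowskiMeasure (k : ℕ) :
    Integrable (fun x : ℝ => x ^ k) minkowskiMeasure := by
  refine integrable_minkowskiMeasure_of_bound 1
    (Measurable.aestronglyMeasurable (by fun_prop)) fun x hx => ?_
  rw [abs_of_nonneg (pow_nonneg hx.1.le _)]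
  exact pow_le_one₀ hx.1.le hx.2.le

/-- By symmetry α = ∫ log(2-x) dμ = log 2 + ∫ log(1 - x/2) dμ. The logarithmic series at x/2 ≤ 1/2
is dominated by a geometric series, so it integrates termwise. -/
theorem sternAlpha_eq_log_two_sub_moments :
    ∃ S : ℝ, HasSum (fun k : ℕ =>
        (∫ x, x ^ (k + 1) ∂minkowskiMeasure) / (((k + 1 : ℕ) : ℝ) * 2 ^ (k + 1))) S ∧
      sternAlpha = Real.log 2 - S := by
  set F : ℕ → ℝ → ℝ := fun k x => (x / 2) ^ (k + 1) / (k + 1) with hF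
  have hFeq : ∀ k, F k = fun x => x ^ (k + 1) / (((k + 1 : ℕ) : ℝ) * 2 ^ (k + 1)) := by
    intro k
    ext x
    simp only [hF, div_pow, div_div]
    push_cast
    ring
  have hFint : ∀ k, Integrable (F k) minkowskiMeasure := fun k => by
    rw [hFeq]
    exact (integrable_pow_minkowskiMeasure _).div_const _
  have hlog : Integrable (fun x => Real.log (1 + (1 - x))) minkowskiMeasure := by
    refine integrable_minkowskiMeasure_of_bound 1
      (Measurable.aestronglyMeasurable (by fun_prop)) fun x hx => ?_
    have h1 := Real.log_le_sub_one_of_pos (show 0 < 1 + (1 - x) by linarith [hx.2])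
    rw [abs_of_nonneg (Real.log_nonneg (by linarith [hx.2]))]
    linarith [hx.1]
  have hsum : HasSum (fun k => ∫ x, F k x ∂minkowskiMeasure)
      (∫ x, ∑' k, F k x ∂minkowskiMeasure) := by
    refine hasSum_integral_of_summable_integral_norm hFint ?_
    refine Summable.of_nonneg_of_le (fun k => integral_nonneg fun x => norm_nonneg _) (fun k => ?_)
      (summable_geometric_of_lt_one (by norm_num) (by norm_num : (1 / 2 : ℝ) < 1))
    refine (integral_mono_of_nonneg (g := fun _ => (1 / 2 : ℝ) ^ k)
      (ae_of_all _ fun x => norm_nonneg _) (integrable_const _) ?_).trans (by simp)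
    filter_upwards [ae_minkowskiMeasure_mem_Ioo] with x hx
    have h0 : 0 ≤ x / 2 := by linarith [hx.1]
    rw [Real.norm_of_nonneg (by positivity)]
    refine (div_le_self (by positivity) (by simp)).trans ?_
    calc (x / 2) ^ (k + 1) ≤ (1 / 2) ^ (k + 1) := by
          gcongr
          exact hx.2.le
      _ ≤ (1 / 2) ^ k := pow_le_pow_of_le_one (by norm_num) (by norm_num) (Nat.le_succ k)
  refine ⟨∫ x, ∑' k, F k x ∂minkowskiMeasure, ?_, ?_⟩
  · convert hsum using 2 with k
    rw [hFeq, integral_div]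
  · rw [sternAlpha_eq_integral_log_one_add, ← integral_one_sub_minkowskiMeasure
      integrable_log_one_add_minkowskiMeasure hlog]
    have : Real.log 2 = ∫ _x, Real.log 2 ∂minkowskiMeasure := by simp
    rw [eq_sub_iff_add_eq, this, ← integral_add hlog]
    · refine integral_minkowskiMeasure_congr fun x hx => ?_
      have h1 : |x / 2| < 1 := by
        rw [abs_lt]; constructor <;> linarith [hx.1, hx.2]
      have h2 := (Real.hasSum_pow_div_log_of_abs_lt_one h1).tsum_eq
      simp only [hF]
      rw [h2, ← sub_eq_add_neg, sub_eq_iff_eq_add, ← Real.log_mul (by norm_num)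
        (by linarith [hx.2])]
      congr 1
      ring
    · have h2 : Integrable (fun x => Real.log 2 - Real.log (1 + (1 - x))) minkowskiMeasure :=
        (integrable_const _).sub hlog
      refine integrable_minkowskiMeasure_congr h2 fun x hx => ?_
      have h1 : |x / 2| < 1 := by
        rw [abs_lt]; constructor <;> linarith [hx.1, hx.2]
      have h2 := (Real.hasSum_pow_div_log_of_abs_lt_one h1).tsum_eq
      simp only [hF]
      rw [h2, sub_eq_iff_eq_add, neg_add_eq_sub, eq_sub_iff_add_eq, ← Real.log_mul (by norm_num)
        (by linarith [hx.2])]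
      congr 1
      ring

/-! ### The Farey map -/

theorem fareyMap_fareyLeft {x : ℝ} (hx : x ∈ Ioo (0 : ℝ) 1) : fareyMap (fareyLeft x) = x := by
  obtain ⟨h0, h1⟩ := hx
  rw [fareyMap, one_sub_fareyLeft h0.le]
  unfold fareyLeft fareyRight
  have : (1 + x) ≠ 0 := by positivity
  rw [min_eq_left]
  · field_simp
  · rw [div_div_div_cancel_right₀ this, div_div_div_cancel_right₀ this, div_le_div_iff₀ one_pos h0]
    nlinarith

theorem fareyMap_fareyRight {x : ℝ} (hx : x ∈ Ioo (0 : ℝ) 1) : fareyMap (fareyRight x) = x := by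
  obtain ⟨h0, h1⟩ := hx
  have e : 1 - fareyRight x = fareyLeft x := by rw [← one_sub_fareyLeft h0.le, sub_sub_cancel]
  rw [fareyMap, e]
  unfold fareyLeft fareyRight
  have : (1 + x) ≠ 0 := by positivity
  rw [min_eq_right]
  · field_simp
  · rw [div_div_div_cancel_right₀ this, div_div_div_cancel_right₀ this, div_le_div_iff₀ one_pos h0]
    nlinarith

theorem hasDerivAt_fareyMap_of_lt {x : ℝ} (h0 : 0 < x) (h1 : x < 1 / 2) :
    HasDerivAt fareyMap (1 / (1 - x) ^ 2) x := by
  have h : HasDerivAt (fun y : ℝ => y / (1 - y)) (1 / (1 - x) ^ 2) x := by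
    have := (hasDerivAt_id x).fun_div ((hasDerivAt_const x (1 : ℝ)).fun_sub (hasDerivAt_id x))
      (by simp only [id]; linarith)
    simpa using this
  refine h.congr_of_eventuallyEq ?_
  filter_upwards [Ioo_mem_nhds h0 h1] with y hy
  rw [fareyMap, min_eq_left]
  rw [div_le_div_iff₀ (by linarith [hy.2]) hy.1]
  nlinarith [hy.1, hy.2]

theorem hasDerivAt_fareyMap_of_gt {x : ℝ} (h0 : 1 / 2 < x) (h1 : x < 1) :
    HasDerivAt fareyMap (-(1 / x ^ 2)) x := by
  have h : HasDerivAt (fun y : ℝ => (1 - y) / y) (-(1 / x ^ 2)) x := by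
    have := ((hasDerivAt_const x (1 : ℝ)).fun_sub (hasDerivAt_id x)).fun_div (hasDerivAt_id x)
      (by simp only [id]; linarith)
    refine this.congr_deriv ?_
    simp only [id]
    ring
  refine h.congr_of_eventuallyEq ?_
  filter_upwards [Ioo_mem_nhds h0 h1] with y hy
  rw [fareyMap, min_eq_right]
  rw [div_le_div_iff₀ (by linarith [hy.1]) (by linarith [hy.2])]
  nlinarith [hy.1, hy.2]

theorem fareyLeft_lt_half {x : ℝ} (hx : x ∈ Ioo (0 : ℝ) 1) : fareyLeft x < 1 / 2 := by
  rw [fareyLeft, div_lt_div_iff₀ (by linarith [hx.1]) (by norm_num)]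
  linarith [hx.2]

theorem half_lt_fareyRight {x : ℝ} (hx : x ∈ Ioo (0 : ℝ) 1) : 1 / 2 < fareyRight x := by
  rw [fareyRight, div_lt_div_iff₀ (by norm_num) (by linarith [hx.1])]
  linarith [hx.2]

theorem log_abs_deriv_fareyMap_fareyLeft {x : ℝ} (hx : x ∈ Ioo (0 : ℝ) 1) :
    Real.log |deriv fareyMap (fareyLeft x)| = 2 * Real.log (1 + x) := by
  rw [(hasDerivAt_fareyMap_of_lt (fareyLeft_mem_Ioo hx).1 (fareyLeft_lt_half hx)).deriv,
    one_sub_fareyLeft hx.1.le, fareyRight]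
  simp [Real.log_pow]

theorem log_abs_deriv_fareyMap_fareyRight {x : ℝ} (hx : x ∈ Ioo (0 : ℝ) 1) :
    Real.log |deriv fareyMap (fareyRight x)| = 2 * Real.log (1 + x) := by
  rw [(hasDerivAt_fareyMap_of_gt (half_lt_fareyRight hx) (fareyRight_mem_Ioo hx).2).deriv,
    fareyRight]
  simp [Real.log_pow]

theorem ae_minkowskiMeasure_ne_half :
    ∀ᵐ x ∂minkowskiMeasure, x ∈ Ioo (0 : ℝ) 1 ∧ x ≠ 1 / 2 := by
  filter_upwards [ae_minkowskiMeasure_mem_Ioo,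
    compl_mem_ae_iff.2 (measure_singleton (μ := minkowskiMeasure) (1 / 2 : ℝ))] with x hx h
  exact ⟨hx, h⟩

/-- A point of `(0,1)` other than `1 / 2` is the image of its Farey image under one of the inverse
branches. -/
theorem exists_farey_preimage {x : ℝ} (hx : x ∈ Ioo (0 : ℝ) 1) (h : x ≠ 1 / 2) :
    fareyMap x ∈ Ioo (0 : ℝ) 1 ∧ (x = fareyLeft (fareyMap x) ∨ x = fareyRight (fareyMap x)) := by
  obtain ⟨h0, h1⟩ := hx
  rcases lt_or_gt_of_ne h with h | h
  · have hm : x / (1 - x) ∈ Ioo (0 : ℝ) 1 := by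
      refine ⟨div_pos h0 (by linarith), ?_⟩
      rw [div_lt_one (by linarith)]; linarith
    have e : x = fareyLeft (x / (1 - x)) := by
      have : 1 - x ≠ 0 := by linarith
      unfold fareyLeft
      field_simp
      ring
    have e2 : fareyMap x = x / (1 - x) := by
      conv_lhs => rw [e]
      exact fareyMap_fareyLeft hm
    rw [e2]
    exact ⟨hm, Or.inl e⟩
  · have hm : (1 - x) / x ∈ Ioo (0 : ℝ) 1 := by
      refine ⟨div_pos (by linarith) h0, ?_⟩
      rw [div_lt_one (by linarith)]; linarith
    have e : x = fareyRight ((1 - x) / x) := by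
      unfold fareyRight
      field_simp
      ring
    have e2 : fareyMap x = (1 - x) / x := by
      conv_lhs => rw [e]
      exact fareyMap_fareyRight hm
    rw [e2]
    exact ⟨hm, Or.inr e⟩

theorem abs_log_abs_deriv_fareyMap_le {x : ℝ} (hx : x ∈ Ioo (0 : ℝ) 1) (h : x ≠ 1 / 2) :
    |Real.log (|deriv fareyMap x|)| ≤ 2 := by
  obtain ⟨hm, h⟩ := exists_farey_preimage hx h
  have e : Real.log |deriv fareyMap x| = 2 * Real.log (1 + fareyMap x) := by
    rcases h with h | h
    · conv_lhs => rw [h]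
      exact log_abs_deriv_fareyMap_fareyLeft hm
    · conv_lhs => rw [h]
      exact log_abs_deriv_fareyMap_fareyRight hm
  have h1 := Real.log_le_sub_one_of_pos (show 0 < 1 + fareyMap x by linarith [hm.1])
  rw [e, abs_of_nonneg (mul_nonneg zero_le_two (Real.log_nonneg (by linarith [hm.1])))]
  linarith [hm.2]

theorem measurable_log_abs_deriv_fareyMap :
    Measurable fun x : ℝ => Real.log |deriv fareyMap x| := by
  have := measurable_deriv fareyMap
  fun_prop

theorem integrable_log_abs_deriv_fareyMap :
    Integrable (fun x : ℝ => Real.log |deriv fareyMap x|) minkowskiMeasure := by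
  refine Integrable.of_bound measurable_log_abs_deriv_fareyMap.aestronglyMeasurable 2 ?_
  filter_upwards [ae_minkowskiMeasure_ne_half] with x hx
  exact abs_log_abs_deriv_fareyMap_le hx.1 hx.2

theorem ae_differentiableAt_fareyMap :
    ∀ᵐ x ∂minkowskiMeasure, DifferentiableAt ℝ fareyMap x := by
  filter_upwards [ae_minkowskiMeasure_ne_half] with x hx
  rcases lt_or_gt_of_ne hx.2 with h | h
  · exact (hasDerivAt_fareyMap_of_lt hx.1.1 h).differentiableAt
  · exact (hasDerivAt_fareyMap_of_gt h hx.1.2).differentiableAt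

theorem two_mul_sternAlpha_eq_integral_log_deriv :
    2 * sternAlpha = ∫ x, Real.log |deriv fareyMap x| ∂minkowskiMeasure := by
  rw [integral_minkowskiMeasure integrable_log_abs_deriv_fareyMap,
    integral_minkowskiMeasure_congr fun x hx => log_abs_deriv_fareyMap_fareyLeft hx,
    integral_minkowskiMeasure_congr fun x hx => log_abs_deriv_fareyMap_fareyRight hx,
    integral_const_mul, ← sternAlpha_eq_integral_log_one_add]
  ring

/-! ### Logarithmic potentials of the Minkowski measure -/

/-- The potential `x ↦ ∫ log (1 + x y) dμ(y)`. -/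
noncomputable def logMulPotential (x : ℝ) : ℝ := ∫ y, Real.log (1 + x * y) ∂minkowskiMeasure

/-- The potential `x ↦ ∫ log (x + y) dμ(y)`. -/
noncomputable def logAddPotential (x : ℝ) : ℝ := ∫ y, Real.log (x + y) ∂minkowskiMeasure

/-- The solution `k` of the Poisson equation `k - P k = log (1 + x) - α` for the transfer
operator `P` of the Farey map. -/
noncomputable def poissonSolution (x : ℝ) : ℝ := (logMulPotential x + logAddPotential x) / 2

/-- The martingale increment `x ↦ (1/2) ∫ log ((x + y) / (1 + x y)) dμ(y)`. -/
noncomputable def logIncrement (x : ℝ) : ℝ := (logAddPotential x - logMulPotential x) / 2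

/-- As soon as one coefficient is at least 1, y ≤ a + by ≤ 4 on (0,1), so the logarithm lies between
1 - 1/y and 3; the inverse first moment is finite. -/
theorem integrable_log_affine {a b : ℝ} (ha : a ∈ Icc (0 : ℝ) 2) (hb : b ∈ Icc (0 : ℝ) 2)
    (h : 1 ≤ a ∨ 1 ≤ b) : Integrable (fun y : ℝ => Real.log (a + b * y)) minkowskiMeasure := by
  refine (integrable_inv_minkowskiMeasure.add (integrable_const 3)).mono'
    (Measurable.aestronglyMeasurable (by fun_prop)) ?_
  filter_upwards [ae_minkowskiMeasure_mem_Ioo] with y hy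
  have hby := mul_nonneg hb.1 hy.1.le
  have h1 : y ≤ a + b * y := by
    rcases h with h | h
    · linarith [hy.2]
    · nlinarith [hy.1, ha.1]
  have h2 := Real.log_le_sub_one_of_pos (hy.1.trans_le h1)
  have h3 := Real.log_le_log hy.1 h1
  have h4 := Real.one_sub_inv_le_log_of_pos hy.1
  have h5 : b * y ≤ 2 := by nlinarith [hy.2, hb.2, hy.1]
  have h6 : 0 < y⁻¹ := inv_pos.2 hy.1
  simp only [Pi.add_apply]
  rw [Real.norm_eq_abs, abs_le]
  constructor <;> linarith [ha.2]

theorem integrable_log_one_add_mul {x : ℝ} (hx : x ∈ Icc (0 : ℝ) 1) :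
    Integrable (fun y : ℝ => Real.log (1 + x * y)) minkowskiMeasure :=
  integrable_log_affine ⟨by norm_num, by norm_num⟩ ⟨hx.1, by linarith [hx.2]⟩ (Or.inl le_rfl)

theorem integrable_log_add {x : ℝ} (hx : x ∈ Icc (0 : ℝ) 1) :
    Integrable (fun y : ℝ => Real.log (x + y)) minkowskiMeasure := by
  simpa using integrable_log_affine (a := x) (b := 1) ⟨hx.1, by linarith [hx.2]⟩
    ⟨by norm_num, by norm_num⟩ (Or.inr le_rfl)

theorem integral_log_sub_const {x : ℝ} {f h : ℝ → ℝ} (hf : Integrable f minkowskiMeasure)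
    (e : ∀ y ∈ Ioo (0 : ℝ) 1, h y = f y - Real.log (1 + x)) :
    ∫ y, h y ∂minkowskiMeasure = ∫ y, f y ∂minkowskiMeasure - Real.log (1 + x) := by
  rw [integral_minkowskiMeasure_congr e, integral_sub hf (integrable_const _)]
  simp

/-- The kernels 1 + xy and x + y are affine in each variable. Applying a branch to the parameter `x`
produces four integrals with denominator 1 + x; applying it to the variable `y`, as self-similarity
does, produces the same four with denominator 1 + y. Matching them solves the Poisson equation. -/
theorem logMulPotential_fareyLeft {x : ℝ} (hx : x ∈ Icc (0 : ℝ) 1) :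
    logMulPotential (fareyLeft x) =
      ∫ y, Real.log (1 + x + x * y) ∂minkowskiMeasure - Real.log (1 + x) := by
  obtain ⟨h0, h1⟩ := hx
  refine integral_log_sub_const (integrable_log_affine (by constructor <;> linarith)
    (by constructor <;> linarith) (Or.inl (by linarith))) fun y hy => ?_
  have hy0 := hy.1
  rw [← Real.log_div (by positivity) (by positivity), fareyLeft]
  congr 1
  field_simp

theorem logMulPotential_fareyRight {x : ℝ} (hx : x ∈ Icc (0 : ℝ) 1) :
    logMulPotential (fareyRight x) =
      ∫ y, Real.log (1 + x + 1 * y) ∂minkowskiMeasure - Real.log (1 + x) := by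
  obtain ⟨h0, h1⟩ := hx
  refine integral_log_sub_const (integrable_log_affine (by constructor <;> linarith)
    (by constructor <;> linarith) (Or.inl (by linarith))) fun y hy => ?_
  have hy0 := hy.1
  rw [← Real.log_div (by positivity) (by positivity), fareyRight]
  congr 1
  field_simp

theorem logAddPotential_fareyLeft {x : ℝ} (hx : x ∈ Icc (0 : ℝ) 1) :
    logAddPotential (fareyLeft x) =
      ∫ y, Real.log (x + (1 + x) * y) ∂minkowskiMeasure - Real.log (1 + x) := by
  obtain ⟨h0, h1⟩ := hx
  refine integral_log_sub_const (integrable_log_affine (by constructor <;> linarith)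
    (by constructor <;> linarith) (Or.inr (by linarith))) fun y hy => ?_
  have hy0 := hy.1
  rw [← Real.log_div (by positivity) (by positivity), fareyLeft]
  congr 1
  field_simp

theorem logAddPotential_fareyRight {x : ℝ} (hx : x ∈ Icc (0 : ℝ) 1) :
    logAddPotential (fareyRight x) =
      ∫ y, Real.log (1 + (1 + x) * y) ∂minkowskiMeasure - Real.log (1 + x) := by
  obtain ⟨h0, h1⟩ := hx
  refine integral_log_sub_const (integrable_log_affine (by constructor <;> linarith)
    (by constructor <;> linarith) (Or.inl (by linarith))) fun y hy => ?_
  have hy0 := hy.1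
  rw [← Real.log_div (by positivity) (by positivity), fareyRight]
  congr 1
  field_simp

theorem integral_log_sub_log_one_add {f h : ℝ → ℝ} (hf : Integrable f minkowskiMeasure)
    (e : ∀ y ∈ Ioo (0 : ℝ) 1, h y = f y - Real.log (1 + y)) :
    ∫ y, h y ∂minkowskiMeasure = ∫ y, f y ∂minkowskiMeasure - sternAlpha := by
  rw [integral_minkowskiMeasure_congr e,
    integral_sub hf integrable_log_one_add_minkowskiMeasure, sternAlpha_eq_integral_log_one_add]

/-- Self-similarity in the variable `y`; the denominators 1 + y contribute α. -/
theorem logMulPotential_eq {x : ℝ} (hx : x ∈ Icc (0 : ℝ) 1) :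
    logMulPotential x = (∫ y, Real.log (1 + (1 + x) * y) ∂minkowskiMeasure +
      ∫ y, Real.log (1 + x + 1 * y) ∂minkowskiMeasure) / 2 - sternAlpha := by
  rw [logMulPotential, integral_minkowskiMeasure (integrable_log_one_add_mul hx)]
  obtain ⟨h0, h1⟩ := hx
  rw [integral_log_sub_log_one_add (f := fun y => Real.log (1 + (1 + x) * y))
    (h := fun y => Real.log (1 + x * fareyLeft y))
    (integrable_log_affine (by constructor <;> linarith)
    (by constructor <;> linarith) (Or.inl (by linarith))),
    integral_log_sub_log_one_add (f := fun y => Real.log (1 + x + 1 * y))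
    (h := fun y => Real.log (1 + x * fareyRight y))
    (integrable_log_affine (by constructor <;> linarith)
    (by constructor <;> linarith) (Or.inl (by linarith)))]
  · ring
  · intro y hy
    have hy0 := hy.1
    rw [← Real.log_div (by positivity) (by positivity), fareyRight]
    congr 1
    field_simp
    ring
  · intro y hy
    have hy0 := hy.1
    rw [← Real.log_div (by positivity) (by positivity), fareyLeft]
    congr 1
    field_simp
    ring

theorem logAddPotential_eq {x : ℝ} (hx : x ∈ Icc (0 : ℝ) 1) :
    logAddPotential x = (∫ y, Real.log (x + (1 + x) * y) ∂minkowskiMeasure +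
      ∫ y, Real.log (1 + x + x * y) ∂minkowskiMeasure) / 2 - sternAlpha := by
  rw [logAddPotential, integral_minkowskiMeasure (integrable_log_add hx)]
  obtain ⟨h0, h1⟩ := hx
  rw [integral_log_sub_log_one_add (f := fun y => Real.log (x + (1 + x) * y))
    (h := fun y => Real.log (x + fareyLeft y))
    (integrable_log_affine (by constructor <;> linarith)
    (by constructor <;> linarith) (Or.inr (by linarith))),
    integral_log_sub_log_one_add (f := fun y => Real.log (1 + x + x * y))
    (h := fun y => Real.log (x + fareyRight y))
    (integrable_log_affine (by constructor <;> linarith)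
    (by constructor <;> linarith) (Or.inl (by linarith)))]
  · ring
  · intro y hy
    have hy0 := hy.1
    rw [← Real.log_div (by positivity) (by positivity), fareyRight]
    congr 1
    field_simp
    ring
  · intro y hy
    have hy0 := hy.1
    rw [← Real.log_div (by positivity) (by positivity), fareyLeft]
    congr 1
    field_simp
    ring

/-- The two integrals left after moving the parameter to the right branch are exactly those in
`logMulPotential_eq`. On the left branch they are those of `logAddPotential_eq`; averaging both
identities gives the Poisson equation. -/
theorem poissonSolution_fareyRight {x : ℝ} (hx : x ∈ Icc (0 : ℝ) 1) :
    poissonSolution (fareyRight x) + Real.log (1 + x) = logMulPotential x + sternAlpha := by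
  rw [poissonSolution, logMulPotential_fareyRight hx, logAddPotential_fareyRight hx,
    logMulPotential_eq hx]
  ring

theorem poissonSolution_fareyLeft {x : ℝ} (hx : x ∈ Icc (0 : ℝ) 1) :
    poissonSolution (fareyLeft x) + Real.log (1 + x) = logAddPotential x + sternAlpha := by
  rw [poissonSolution, logMulPotential_fareyLeft hx, logAddPotential_fareyLeft hx,
    logAddPotential_eq hx]
  ring

@[fun_prop]
theorem measurable_logMulPotential : Measurable logMulPotential := by
  have h : Measurable (Function.uncurry fun x y : ℝ => Real.log (1 + x * y)) := by
    unfold Function.uncurry; fun_prop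
  exact (h.stronglyMeasurable.integral_prod_right (ν := minkowskiMeasure)).measurable

@[fun_prop]
theorem measurable_logAddPotential : Measurable logAddPotential := by
  have h : Measurable (Function.uncurry fun x y : ℝ => Real.log (x + y)) := by
    unfold Function.uncurry; fun_prop
  exact (h.stronglyMeasurable.integral_prod_right (ν := minkowskiMeasure)).measurable

@[fun_prop]
theorem measurable_poissonSolution : Measurable poissonSolution := by
  unfold poissonSolution; fun_prop

@[fun_prop]
theorem measurable_logIncrement : Measurable logIncrement := by
  unfold logIncrement; fun_prop

/-! ### Lipschitz bounds for the potentials -/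

theorem abs_log_sub_log_le {u v m : ℝ} (hm : 0 < m) (hu : m ≤ u) (hv : m ≤ v) :
    |Real.log u - Real.log v| ≤ |u - v| * m⁻¹ := by
  wlog h : v ≤ u generalizing u v
  · rw [abs_sub_comm, abs_sub_comm u v]
    exact this hv hu (le_of_not_ge h)
  have hv0 := hm.trans_le hv
  have hu0 := hm.trans_le hu
  rw [abs_of_nonneg (sub_nonneg.2 h), abs_of_nonneg (sub_nonneg.2 (Real.log_le_log hv0 h)),
    ← Real.log_div hu0.ne' hv0.ne']
  refine (Real.log_le_sub_one_of_pos (div_pos hu0 hv0)).trans ?_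
  rw [div_sub_one hv0.ne', div_eq_mul_inv]
  exact mul_le_mul_of_nonneg_left (inv_anti₀ hm hv) (sub_nonneg.2 h)

theorem abs_logMulPotential_sub_le {x y : ℝ} (hx : x ∈ Icc (0 : ℝ) 1) (hy : y ∈ Icc (0 : ℝ) 1) :
    |logMulPotential x - logMulPotential y| ≤ |x - y| := by
  rw [logMulPotential, logMulPotential,
    ← integral_sub (integrable_log_one_add_mul hx) (integrable_log_one_add_mul hy)]
  rw [← Real.norm_eq_abs (∫ z, _ ∂_)]
  refine (norm_integral_le_of_norm_le_const (μ := minkowskiMeasure) (C := |x - y|) ?_).trans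
    (by simp)
  filter_upwards [ae_minkowskiMeasure_mem_Ioo] with z hz
  refine (abs_log_sub_log_le one_pos ?_ ?_).trans ?_
  · linarith [mul_nonneg hx.1 hz.1.le]
  · linarith [mul_nonneg hy.1 hz.1.le]
  · rw [show 1 + x * z - (1 + y * z) = (x - y) * z by ring, abs_mul, abs_of_pos hz.1]
    nlinarith [abs_nonneg (x - y), hz.2]

/-- The kernel x + z is only bounded below by z, so finiteness of the inverse first moment is what
makes this potential Lipschitz up to 0. -/
theorem abs_logAddPotential_sub_le {x y : ℝ} (hx : x ∈ Icc (0 : ℝ) 1) (hy : y ∈ Icc (0 : ℝ) 1) :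
    |logAddPotential x - logAddPotential y| ≤ (∫ z, z⁻¹ ∂minkowskiMeasure) * |x - y| := by
  rw [logAddPotential, logAddPotential,
    ← integral_sub (integrable_log_add hx) (integrable_log_add hy), mul_comm,
    ← integral_const_mul, ← Real.norm_eq_abs (∫ z, _ ∂_)]
  refine norm_integral_le_of_norm_le (integrable_inv_minkowskiMeasure.const_mul _) ?_
  filter_upwards [ae_minkowskiMeasure_mem_Ioo] with z hz
  refine (abs_log_sub_log_le hz.1 ?_ ?_).trans ?_
  · linarith [hx.1]
  · linarith [hy.1]
  · rw [add_sub_add_right_eq_sub]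

theorem exists_poissonSolution_bound : ∃ C : ℝ, 0 ≤ C ∧ ∀ x ∈ Icc (0 : ℝ) 1,
    |poissonSolution x| ≤ C ∧ |logIncrement x| ≤ C ∧ |logMulPotential x| ≤ C := by
  set I := ∫ z, z⁻¹ ∂minkowskiMeasure
  have hI : 0 ≤ I := integral_nonneg_of_ae
    (ae_minkowskiMeasure_mem_Ioo.mono fun z hz => inv_nonneg.2 hz.1.le)
  refine ⟨1 + I + |logMulPotential 0| + |logAddPotential 0|, by positivity, fun x hx => ?_⟩
  have h1 := abs_logMulPotential_sub_le hx ⟨le_rfl, zero_le_one⟩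
  have h2 := abs_logAddPotential_sub_le hx ⟨le_rfl, zero_le_one⟩
  have h3 : |x - 0| ≤ 1 := by rw [sub_zero, abs_of_nonneg hx.1]; exact hx.2
  have h4 : |logAddPotential x - logAddPotential 0| ≤ I := h2.trans (by nlinarith)
  have h5 : |logMulPotential x| ≤ 1 + |logMulPotential 0| := by
    have := abs_sub_abs_le_abs_sub (logMulPotential x) (logMulPotential 0)
    linarith
  have h6 : |logAddPotential x| ≤ I + |logAddPotential 0| := by
    have := abs_sub_abs_le_abs_sub (logAddPotential x) (logAddPotential 0)
    linarith
  have h7 := abs_nonneg (logAddPotential 0)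
  refine ⟨?_, ?_, by linarith⟩
  · rw [poissonSolution, abs_div, abs_two]
    have := abs_add_le (logMulPotential x) (logAddPotential x)
    linarith [abs_nonneg (logMulPotential 0)]
  · rw [logIncrement, abs_div, abs_two]
    have := abs_sub (logAddPotential x) (logMulPotential x)
    linarith [abs_nonneg (logMulPotential 0)]

theorem exists_logIncrement_sq_lipschitz : ∃ L : ℝ, 0 ≤ L ∧ ∀ x ∈ Icc (0 : ℝ) 1,
    ∀ y ∈ Icc (0 : ℝ) 1, |logIncrement x ^ 2 - logIncrement y ^ 2| ≤ L * |x - y| := by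
  obtain ⟨C, hC, hb⟩ := exists_poissonSolution_bound
  set I := ∫ z, z⁻¹ ∂minkowskiMeasure
  have hI : 0 ≤ I := integral_nonneg_of_ae
    (ae_minkowskiMeasure_mem_Ioo.mono fun z hz => inv_nonneg.2 hz.1.le)
  refine ⟨2 * C * (1 + I), by positivity, fun x hx y hy => ?_⟩
  have h1 := abs_logMulPotential_sub_le hx hy
  have h2 := abs_logAddPotential_sub_le hx hy
  have h3 : |logIncrement x - logIncrement y| ≤ (1 + I) * |x - y| := by
    rw [logIncrement, logIncrement, show ∀ a b c d : ℝ, (a - b) / 2 - (c - d) / 2 =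
      ((a - c) - (b - d)) / 2 by intros; ring, abs_div, abs_two]
    have h4 := abs_sub (logAddPotential x - logAddPotential y)
      (logMulPotential x - logMulPotential y)
    have h5 : 0 ≤ (1 + I) * |x - y| := by positivity
    linarith
  have h4 : |logIncrement x + logIncrement y| ≤ 2 * C := by
    have := abs_add_le (logIncrement x) (logIncrement y)
    linarith [(hb x hx).2.1, (hb y hy).2.1]
  rw [sq_sub_sq, abs_mul, mul_assoc]
  exact mul_le_mul h4 h3 (abs_nonneg _) (by positivity)

/-! ### The transfer operator -/

/-- The transfer operator of the Farey map with respect to the Minkowski measure. -/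
noncomputable def fareyOp (u : ℝ → ℝ) (x : ℝ) : ℝ := (u (fareyLeft x) + u (fareyRight x)) / 2

theorem integrable_fareyOp {u : ℝ → ℝ} (hu : Integrable u minkowskiMeasure) :
    Integrable (fareyOp u) minkowskiMeasure :=
  ((integrable_comp_fareyLeft hu).add (integrable_comp_fareyRight hu)).div_const 2

theorem integral_fareyOp {u : ℝ → ℝ} (hu : Integrable u minkowskiMeasure) :
    ∫ x, fareyOp u x ∂minkowskiMeasure = ∫ x, u x ∂minkowskiMeasure := by
  rw [integral_minkowskiMeasure hu, ← integral_add (integrable_comp_fareyLeft hu)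
    (integrable_comp_fareyRight hu), ← integral_div]
  rfl

theorem iterate_fareyOp_integral {u : ℝ → ℝ} (hu : Integrable u minkowskiMeasure) (n : ℕ) :
    Integrable (fareyOp^[n] u) minkowskiMeasure ∧
      ∫ x, fareyOp^[n] u x ∂minkowskiMeasure = ∫ x, u x ∂minkowskiMeasure := by
  induction n generalizing u with
  | zero => exact ⟨hu, rfl⟩
  | succ n ih =>
    obtain ⟨h1, h2⟩ := ih (integrable_fareyOp hu)
    exact ⟨h1, h2.trans (integral_fareyOp hu)⟩

theorem abs_fareyLeft_sub_le {x y : ℝ} (hx : x ∈ Icc (0 : ℝ) 1) (hy : y ∈ Icc (0 : ℝ) 1) :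
    |fareyLeft x - fareyLeft y| ≤ |x - y| := by
  obtain ⟨hx0, hx1⟩ := hx
  obtain ⟨hy0, hy1⟩ := hy
  have e : fareyLeft x - fareyLeft y = (x - y) / ((1 + x) * (1 + y)) := by
    unfold fareyLeft; field_simp; ring
  rw [e, abs_div]
  refine div_le_self (abs_nonneg _) ?_
  rw [abs_of_nonneg (by positivity)]
  nlinarith

theorem abs_fareyRight_sub_le {x y : ℝ} (hx : x ∈ Icc (0 : ℝ) 1) (hy : y ∈ Icc (0 : ℝ) 1) :
    |fareyRight x - fareyRight y| ≤ |x - y| := by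
  rw [← one_sub_fareyLeft hx.1, ← one_sub_fareyLeft hy.1, sub_sub_sub_cancel_left, abs_sub_comm]
  exact abs_fareyLeft_sub_le hx hy

theorem fareyOp_lipschitz {u : ℝ → ℝ} {L : ℝ} (hL : 0 ≤ L) (hu : ∀ x ∈ Icc (0 : ℝ) 1,
    ∀ y ∈ Icc (0 : ℝ) 1, |u x - u y| ≤ L * |x - y|) :
    ∀ x ∈ Icc (0 : ℝ) 1, ∀ y ∈ Icc (0 : ℝ) 1, |fareyOp u x - fareyOp u y| ≤ L * |x - y| := by
  intro x hx y hy
  have h1 := (hu _ (fareyLeft_mem hx) _ (fareyLeft_mem hy)).trans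
    (mul_le_mul_of_nonneg_left (abs_fareyLeft_sub_le hx hy) hL)
  have h2 := (hu _ (fareyRight_mem hx) _ (fareyRight_mem hy)).trans
    (mul_le_mul_of_nonneg_left (abs_fareyRight_sub_le hx hy) hL)
  have h3 := abs_add_le (u (fareyLeft x) - u (fareyLeft y)) (u (fareyRight x) - u (fareyRight y))
  rw [fareyOp, fareyOp, show ∀ a b c d : ℝ, (a + b) / 2 - (c + d) / 2 =
      ((a - c) + (b - d)) / 2 by intros; ring, abs_div, abs_two]
  linarith

/-- Two steps of the transfer operator contract the Lipschitz seminorm. -/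
theorem fareyOp_fareyOp_lipschitz {u : ℝ → ℝ} {L : ℝ} (hL : 0 ≤ L) (hu : ∀ x ∈ Icc (0 : ℝ) 1,
    ∀ y ∈ Icc (0 : ℝ) 1, |u x - u y| ≤ L * |x - y|) :
    ∀ x ∈ Icc (0 : ℝ) 1, ∀ y ∈ Icc (0 : ℝ) 1,
      |fareyOp (fareyOp u) x - fareyOp (fareyOp u) y| ≤ L * (5 / 8) * |x - y| := by
  intro x hx y hy
  have hll : |fareyLeft (fareyLeft x) - fareyLeft (fareyLeft y)| ≤ |x - y| :=
    (abs_fareyLeft_sub_le (fareyLeft_mem hx) (fareyLeft_mem hy)).trans (abs_fareyLeft_sub_le hx hy)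
  -- A single step need not contract, both branches having derivative ±1 at 0. After an inner right
  -- branch the points lie in [1/2, 1] and two steps contract by 1/4; averaging the factors 1, 1/4,
  -- 1, 1/4 gives 5/8.
  have hlr : |fareyLeft (fareyRight x) - fareyLeft (fareyRight y)| ≤ |x - y| / 4 := by
    obtain ⟨hx0, hx1⟩ := hx
    obtain ⟨hy0, hy1⟩ := hy
    have e : fareyLeft (fareyRight x) - fareyLeft (fareyRight y) =
        (y - x) / ((2 + x) * (2 + y)) := by
      unfold fareyLeft fareyRight; field_simp; ring
    rw [e, abs_div, abs_sub_comm]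
    refine div_le_div_of_nonneg_left (abs_nonneg _) (by norm_num) ?_
    rw [abs_of_nonneg (by positivity)]
    nlinarith
  have hrl : |fareyRight (fareyLeft x) - fareyRight (fareyLeft y)| ≤ |x - y| :=
    (abs_fareyRight_sub_le (fareyLeft_mem hx) (fareyLeft_mem hy)).trans
      (abs_fareyLeft_sub_le hx hy)
  have hrr : |fareyRight (fareyRight x) - fareyRight (fareyRight y)| ≤ |x - y| / 4 := by
    rw [← one_sub_fareyLeft (fareyRight_mem hx).1, ← one_sub_fareyLeft (fareyRight_mem hy).1,
      sub_sub_sub_cancel_left, abs_sub_comm]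
    exact hlr
  have a1 := (hu _ (fareyLeft_mem (fareyLeft_mem hx)) _ (fareyLeft_mem (fareyLeft_mem hy))).trans
    (mul_le_mul_of_nonneg_left hll hL)
  have a2 := (hu _ (fareyLeft_mem (fareyRight_mem hx)) _ (fareyLeft_mem (fareyRight_mem hy))).trans
    (mul_le_mul_of_nonneg_left hlr hL)
  have a3 := (hu _ (fareyRight_mem (fareyLeft_mem hx)) _ (fareyRight_mem (fareyLeft_mem hy))).trans
    (mul_le_mul_of_nonneg_left hrl hL)
  have a4 := (hu _ (fareyRight_mem (fareyRight_mem hx)) _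
    (fareyRight_mem (fareyRight_mem hy))).trans (mul_le_mul_of_nonneg_left hrr hL)
  simp only [fareyOp]
  rw [abs_le] at a1 a2 a3 a4 ⊢
  constructor <;> linarith [a1.1, a1.2, a2.1, a2.2, a3.1, a3.2, a4.1, a4.2]

theorem iterate_fareyOp_lipschitz (n : ℕ) : ∀ {u : ℝ → ℝ} {L : ℝ} (_ : 0 ≤ L)
    (_ : ∀ x ∈ Icc (0 : ℝ) 1, ∀ y ∈ Icc (0 : ℝ) 1, |u x - u y| ≤ L * |x - y|),
    ∀ x ∈ Icc (0 : ℝ) 1, ∀ y ∈ Icc (0 : ℝ) 1,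
      |fareyOp^[n] u x - fareyOp^[n] u y| ≤ L * (5 / 8) ^ (n / 2) * |x - y| := by
  induction n using Nat.twoStepInduction with
  | zero => intro u L hL hu; simpa using hu
  | one => intro u L hL hu; simpa using fareyOp_lipschitz hL hu
  | more n ih _ =>
    intro u L hL hu x hx y hy
    have := ih (by positivity) (fareyOp_fareyOp_lipschitz hL hu) x hx y hy
    rw [Nat.add_div_right _ two_pos, pow_succ]
    simp only [Function.iterate_succ_apply]
    linarith

/-- The iterates keep the integral of `u` while their oscillation on `[0,1]` decays, so they
converge to that integral at every point, in particular at 1, where the Stern ratios start. -/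
theorem iterate_fareyOp_tendsto {u : ℝ → ℝ} {L : ℝ} (hL : 0 ≤ L)
    (hint : Integrable u minkowskiMeasure)
    (hu : ∀ x ∈ Icc (0 : ℝ) 1, ∀ y ∈ Icc (0 : ℝ) 1, |u x - u y| ≤ L * |x - y|) {x : ℝ}
    (hx : x ∈ Icc (0 : ℝ) 1) :
    Tendsto (fun n => fareyOp^[n] u x) atTop (𝓝 (∫ y, u y ∂minkowskiMeasure)) := by
  rw [tendsto_iff_norm_sub_tendsto_zero]
  have hlim : Tendsto (fun n : ℕ => L * (5 / 8 : ℝ) ^ (n / 2)) atTop (𝓝 0) := by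
    rw [← mul_zero L]
    exact ((tendsto_pow_atTop_nhds_zero_of_lt_one (by norm_num) (by norm_num)).comp
      (Nat.tendsto_div_const_atTop two_ne_zero)).const_mul L
  refine squeeze_zero (fun n => norm_nonneg _) (fun n => ?_) hlim
  obtain ⟨h1, h2⟩ := iterate_fareyOp_integral hint n
  have e : fareyOp^[n] u x - ∫ y, u y ∂minkowskiMeasure =
      ∫ y, (fareyOp^[n] u x - fareyOp^[n] u y) ∂minkowskiMeasure := by
    rw [integral_sub (integrable_const _) h1, h2]
    simp
  rw [e]
  refine (norm_integral_le_of_norm_le_const (μ := minkowskiMeasure)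
    (C := L * (5 / 8) ^ (n / 2)) ?_).trans (by simp)
  filter_upwards [ae_minkowskiMeasure_mem_Icc] with y hy
  refine (iterate_fareyOp_lipschitz n hL hu x hx y hy).trans ?_
  refine mul_le_of_le_one_right (by positivity) ?_
  rw [abs_le]
  constructor <;> linarith [hx.1, hx.2, hy.1, hy.2]

/-! ### The variance integrand -/

/-- The integrand, before squaring, of the integral which represents the variance constant. -/
noncomputable def gaussIncrement (x : ℝ) : ℝ :=
  Real.log x + sternAlpha * (⌊1 / x⌋ : ℝ) + logMulPotential (Int.fract (1 / x)) - logMulPotential x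

@[fun_prop]
theorem measurable_gaussIncrement : Measurable gaussIncrement := by
  unfold gaussIncrement
  fun_prop

theorem integrable_log_ratio {x : ℝ} (hx : x ∈ Icc (0 : ℝ) 1) :
    Integrable (fun y : ℝ => Real.log ((1 + y * Int.fract (1 / x)) / (1 + y * x)))
      minkowskiMeasure ∧
    ∫ y, Real.log ((1 + y * Int.fract (1 / x)) / (1 + y * x)) ∂minkowskiMeasure =
      logMulPotential (Int.fract (1 / x)) - logMulPotential x := by
  have hf : Int.fract (1 / x) ∈ Icc (0 : ℝ) 1 := gaussMap_mem x
  have e : ∀ y ∈ Ioo (0 : ℝ) 1, Real.log (1 + Int.fract (1 / x) * y) - Real.log (1 + x * y) =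
      Real.log ((1 + y * Int.fract (1 / x)) / (1 + y * x)) := by
    intro y hy
    have h1 := mul_nonneg hy.1.le hf.1
    have h2 := mul_nonneg hy.1.le hx.1
    rw [Real.log_div (by positivity) (by positivity), mul_comm y, mul_comm y]
  refine ⟨integrable_minkowskiMeasure_congr
    ((integrable_log_one_add_mul hf).sub (integrable_log_one_add_mul hx)) e, ?_⟩
  rw [← integral_minkowskiMeasure_congr e,
    integral_sub (integrable_log_one_add_mul hf) (integrable_log_one_add_mul hx)]
  rfl

theorem poissonSolution_sub_logMulPotential (x : ℝ) :
    poissonSolution x - logMulPotential x = logIncrement x := by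
  rw [poissonSolution, logIncrement]; ring

/-- On the right half the first digit is 1, and the Gauss map is a single Farey step. -/
theorem gaussIncrement_fareyRight {x : ℝ} (hx : x ∈ Ioo (0 : ℝ) 1) :
    gaussIncrement (fareyRight x) = logIncrement (fareyRight x) := by
  have h1 := poissonSolution_fareyRight (Ioo_subset_Icc_self hx)
  have h2 := poissonSolution_sub_logMulPotential (fareyRight x)
  have e1 : 1 / fareyRight x = 1 + x := by simp [fareyRight]
  have e2 : ⌊1 + x⌋ = 1 := by
    rw [Int.floor_eq_iff]
    push_cast
    exact ⟨by linarith [hx.1], by linarith [hx.2]⟩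
  have e3 : Int.fract (1 + x) = x := by
    rw [Int.fract_one_add, Int.fract_eq_self]
    exact ⟨hx.1.le, hx.2⟩
  have e4 : Real.log (fareyRight x) = -Real.log (1 + x) := by rw [fareyRight, one_div, Real.log_inv]
  rw [gaussIncrement, e1, e2, e3, e4]
  push_cast
  linarith

/-- The left branch raises the first digit by one and keeps the Gauss image, so the increment picks
up the contribution of one more Farey step. -/
theorem gaussIncrement_fareyLeft {x : ℝ} (hx : x ∈ Ioo (0 : ℝ) 1) :
    gaussIncrement (fareyLeft x) =
      gaussIncrement x - 2 * logIncrement x + logIncrement (fareyLeft x) := by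
  have h1 := poissonSolution_fareyLeft (Ioo_subset_Icc_self hx)
  have h2 := poissonSolution_sub_logMulPotential (fareyLeft x)
  have h3 : logIncrement x = (logAddPotential x - logMulPotential x) / 2 := rfl
  have e4 : Real.log (fareyLeft x) = Real.log x - Real.log (1 + x) := by
    rw [fareyLeft, Real.log_div hx.1.ne' (by linarith [hx.1])]
  rw [gaussIncrement, gaussIncrement, one_div_fareyLeft hx.1, Int.floor_add_one,
    Int.fract_add_one, e4]
  push_cast
  linarith

theorem integrable_sq_of_abs_le_inv {f : ℝ → ℝ} (hf : Measurable f) {C : ℝ}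
    (h : ∀ x ∈ Ioo (0 : ℝ) 1, |f x| ≤ C * x⁻¹) :
    Integrable (fun x => f x ^ 2) minkowskiMeasure := by
  refine (integrable_inv_sq_minkowskiMeasure.const_mul (C ^ 2)).mono' (by fun_prop) ?_
  filter_upwards [ae_minkowskiMeasure_mem_Ioo] with x hx
  rw [Real.norm_of_nonneg (sq_nonneg _), ← mul_pow, ← sq_abs]
  exact pow_le_pow_left₀ (abs_nonneg _) (h x hx) 2

theorem exists_gaussIncrement_bound :
    ∃ C : ℝ, ∀ x ∈ Ioo (0 : ℝ) 1, |gaussIncrement x| ≤ C * x⁻¹ ∧ |logIncrement x| ≤ C * x⁻¹ := by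
  obtain ⟨C, hC, hb⟩ := exists_poissonSolution_bound
  have hα := sternAlpha_pos
  refine ⟨1 + sternAlpha + 2 * C, fun x hx => ?_⟩
  have hinv : 1 ≤ x⁻¹ := (one_le_inv₀ hx.1).2 hx.2.le
  have h1 := abs_log_le_inv hx
  have h2 := Int.floor_le (1 / x)
  have h3 : (0 : ℝ) ≤ ⌊1 / x⌋ := by
    exact_mod_cast Int.floor_nonneg.2 (one_div_nonneg.2 hx.1.le)
  have h4 := (hb _ (gaussMap_mem x)).2.2
  have h5 := (hb x (Ioo_subset_Icc_self hx))
  have h6 : C ≤ C * x⁻¹ := le_mul_of_one_le_right hC hinv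
  rw [one_div] at h2
  refine ⟨?_, ?_⟩
  · rw [gaussMap] at h4
    have h7 : sternAlpha * (⌊1 / x⌋ : ℝ) ≤ sternAlpha * x⁻¹ := by
      rw [one_div]
      exact mul_le_mul_of_nonneg_left h2 hα.le
    have h8 : 0 ≤ sternAlpha * (⌊1 / x⌋ : ℝ) := by positivity
    have h9 := h5.2.2
    rw [gaussIncrement]
    rw [abs_le] at *
    constructor <;> linarith [h1.1, h1.2, h4.1, h4.2, h9.1, h9.2]
  · have : 0 ≤ (1 + sternAlpha + C) * x⁻¹ := by positivity
    linarith [h5.2.1]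

theorem integrable_gaussIncrement_sq :
    Integrable (fun x => gaussIncrement x ^ 2) minkowskiMeasure := by
  obtain ⟨C, h⟩ := exists_gaussIncrement_bound
  exact integrable_sq_of_abs_le_inv (by fun_prop) fun x hx => (h x hx).1

theorem integrable_logIncrement_sq :
    Integrable (fun x => logIncrement x ^ 2) minkowskiMeasure := by
  obtain ⟨C, h⟩ := exists_gaussIncrement_bound
  exact integrable_sq_of_abs_le_inv (by fun_prop) fun x hx => (h x hx).2

/-- The Gauss map collects on average two steps of the Farey map. -/
theorem integral_gaussIncrement_sq :
    ∫ x, gaussIncrement x ^ 2 ∂minkowskiMeasure =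
      2 * ∫ x, logIncrement x ^ 2 ∂minkowskiMeasure := by
  obtain ⟨C, h⟩ := exists_gaussIncrement_bound
  -- `R` vanishes on the image of the right branch and satisfies R(Lx) = R(x) + ψ(x), with ψ =
  -- `logIncrement`. Self-similarity then gives ∫ R^2 = (1/2) ∫ (R+ψ)^2, and expanding (ψ-R)^2
  -- leaves 2 ∫ ψ^2 without any cross term.
  set R : ℝ → ℝ := fun x => logIncrement x - gaussIncrement x with hR
  have hRm : Measurable R := by fun_prop
  have hRb : ∀ x ∈ Ioo (0 : ℝ) 1, |R x| ≤ (2 * C) * x⁻¹ := by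
    intro x hx
    have h1 := abs_sub (logIncrement x) (gaussIncrement x)
    simp only [hR]
    linarith [(h x hx).1, (h x hx).2]
  have hR2 := integrable_sq_of_abs_le_inv hRm hRb
  have hS2 : Integrable (fun x => (R x + logIncrement x) ^ 2) minkowskiMeasure := by
    refine integrable_sq_of_abs_le_inv (C := 3 * C) (by fun_prop) fun x hx => ?_
    have h1 := abs_add_le (R x) (logIncrement x)
    linarith [(h x hx).2, hRb x hx]
  have hmain : ∫ x, R x ^ 2 ∂minkowskiMeasure =
      (∫ x, (R x + logIncrement x) ^ 2 ∂minkowskiMeasure) / 2 := by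
    rw [integral_minkowskiMeasure hR2]
    congr 1
    have h0 : ∫ x, R (fareyRight x) ^ 2 ∂minkowskiMeasure = 0 := by
      rw [integral_minkowskiMeasure_congr (g := fun _ => (0 : ℝ)), integral_zero]
      intro x hx
      simp only [hR, gaussIncrement_fareyRight hx]
      ring
    rw [h0, add_zero]
    refine integral_minkowskiMeasure_congr fun x hx => ?_
    simp only [hR, gaussIncrement_fareyLeft hx]
    ring
  have e : ∀ x, gaussIncrement x ^ 2 =
      2 * logIncrement x ^ 2 + 2 * R x ^ 2 - (R x + logIncrement x) ^ 2 := by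
    intro x
    simp only [hR]
    ring
  simp_rw [e]
  rw [integral_sub (f := fun x => 2 * logIncrement x ^ 2 + 2 * R x ^ 2)
    ((integrable_logIncrement_sq.const_mul 2).add (hR2.const_mul 2)) hS2,
    integral_add (integrable_logIncrement_sq.const_mul 2) (hR2.const_mul 2), integral_const_mul,
    integral_const_mul, hmain]
  ring

/-! ### Means over the rows of Stern's diatomic array -/

theorem sum_Ico_two_mul {M : Type*} [AddCommMonoid M] (f : ℕ → M) (a b : ℕ) (h : a ≤ b) :
    ∑ n ∈ Finset.Ico (2 * a) (2 * b), f n = ∑ n ∈ Finset.Ico a b, (f (2 * n) + f (2 * n + 1)) := by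
  induction b, h using Nat.le_induction with
  | base => simp
  | succ b hb ih =>
    rw [show 2 * (b + 1) = 2 * b + 1 + 1 by ring, Finset.sum_Ico_succ_top (by omega),
      Finset.sum_Ico_succ_top (by omega), Finset.sum_Ico_succ_top hb, ih, add_assoc]

theorem sum_row_succ {M : Type*} [AddCommMonoid M] (f : ℕ → M) (N : ℕ) :
    ∑ n ∈ Finset.Ico (2 ^ (N + 1)) (2 ^ (N + 1 + 1)), f n =
      ∑ n ∈ Finset.Ico (2 ^ N) (2 ^ (N + 1)), (f (2 * n) + f (2 * n + 1)) := by
  rw [← sum_Ico_two_mul f _ _ (Nat.pow_le_pow_right two_pos N.le_succ), pow_succ' 2 (N + 1),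
    pow_succ' 2 N]

/-- The mean of `f` over the integers of `[2^N, 2^(N+1))`. -/
noncomputable def rowMean (N : ℕ) (f : ℕ → ℝ) : ℝ :=
  (∑ n ∈ Finset.Ico (2 ^ N) (2 ^ (N + 1)), f n) / 2 ^ N

theorem rowMean_zero (f : ℕ → ℝ) : rowMean 0 f = f 1 := by
  simp [rowMean]

theorem rowMean_succ (N : ℕ) (f : ℕ → ℝ) :
    rowMean (N + 1) f = rowMean N fun n => (f (2 * n) + f (2 * n + 1)) / 2 := by
  rw [rowMean, rowMean, sum_row_succ, ← Finset.sum_div, pow_succ (2 : ℝ) N, div_div,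
    mul_comm (2 : ℝ)]

theorem rowMean_congr {N : ℕ} {f g : ℕ → ℝ}
    (h : ∀ n ∈ Finset.Ico (2 ^ N) (2 ^ (N + 1)), f n = g n) : rowMean N f = rowMean N g := by
  rw [rowMean, rowMean, Finset.sum_congr rfl h]

theorem rowMean_mono {N : ℕ} {f g : ℕ → ℝ}
    (h : ∀ n ∈ Finset.Ico (2 ^ N) (2 ^ (N + 1)), f n ≤ g n) : rowMean N f ≤ rowMean N g := by
  rw [rowMean, rowMean]
  gcongr with n hn
  exact h n hn

theorem rowMean_add (N : ℕ) (f g : ℕ → ℝ) :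
    rowMean N (fun n => f n + g n) = rowMean N f + rowMean N g := by
  rw [rowMean, rowMean, rowMean, Finset.sum_add_distrib, add_div]

theorem rowMean_sub (N : ℕ) (f g : ℕ → ℝ) :
    rowMean N (fun n => f n - g n) = rowMean N f - rowMean N g := by
  rw [rowMean, rowMean, rowMean, Finset.sum_sub_distrib, sub_div]

theorem rowMean_const_mul (N : ℕ) (c : ℝ) (f : ℕ → ℝ) :
    rowMean N (fun n => c * f n) = c * rowMean N f := by
  rw [rowMean, rowMean, ← Finset.mul_sum, mul_div_assoc]

theorem rowMean_const (N : ℕ) (c : ℝ) : rowMean N (fun _ => c) = c := by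
  rw [rowMean, Finset.sum_const, Nat.card_Ico, pow_succ, Nat.mul_two, Nat.add_sub_cancel,
    nsmul_eq_mul]
  push_cast
  field_simp

theorem abs_rowMean_le {N : ℕ} {f : ℕ → ℝ} {C : ℝ}
    (h : ∀ n ∈ Finset.Ico (2 ^ N) (2 ^ (N + 1)), |f n| ≤ C) : |rowMean N f| ≤ C := by
  rw [abs_le]
  constructor
  · rw [← rowMean_const N (-C)]
    exact rowMean_mono fun n hn => (abs_le.1 (h n hn)).1
  · rw [← rowMean_const N C]
    exact rowMean_mono fun n hn => (abs_le.1 (h n hn)).2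

/-! ### Consecutive Stern numbers: maxima and ratios -/

theorem stern_pos {n : ℕ} (h : 1 ≤ n) : 0 < stern n := by
  induction n using Nat.strong_induction_on with
  | _ n ih =>
    rcases Nat.even_or_odd' n with ⟨k, rfl | rfl⟩
    · rw [stern_two_mul]
      exact ih k (by omega) (by omega)
    · rw [stern_two_mul_add_one]
      rcases Nat.eq_zero_or_pos k with rfl | hk
      · simp [stern]
      · have := ih k (by omega) hk
        omega

/-- The larger one of two consecutive Stern numbers. -/
noncomputable def sternMax (n : ℕ) : ℝ := max (stern n : ℝ) (stern (n + 1))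

/-- The ratio of two consecutive Stern numbers, the smaller one to the larger one. -/
noncomputable def sternRatio (n : ℕ) : ℝ := min (stern n : ℝ) (stern (n + 1)) / sternMax n

theorem one_le_of_mem_row {N n : ℕ} (h : n ∈ Finset.Ico (2 ^ N) (2 ^ (N + 1))) : 1 ≤ n :=
  (Nat.one_le_two_pow).trans (Finset.mem_Ico.1 h).1

theorem sternMax_pos {n : ℕ} (h : 1 ≤ n) : 0 < sternMax n :=
  lt_max_of_lt_left (by exact_mod_cast stern_pos h)

theorem sternRatio_pos {n : ℕ} (h : 1 ≤ n) : 0 < sternRatio n :=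
  div_pos (lt_min (by exact_mod_cast stern_pos h) (by exact_mod_cast stern_pos (by omega)))
    (sternMax_pos h)

theorem sternRatio_le_one {n : ℕ} (h : 1 ≤ n) : sternRatio n ≤ 1 :=
  (div_le_one (sternMax_pos h)).2 min_le_max

theorem sternRatio_mem {n : ℕ} (h : 1 ≤ n) : sternRatio n ∈ Icc (0 : ℝ) 1 :=
  ⟨(sternRatio_pos h).le, sternRatio_le_one h⟩

theorem sternMax_mul_one_add_ratio {n : ℕ} (h : 1 ≤ n) :
    sternMax n * (1 + sternRatio n) = stern n + stern (n + 1) := by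
  have := (sternMax_pos h).ne'
  rw [sternRatio, mul_add, mul_one, mul_div_cancel₀ _ this, sternMax, max_add_min]

theorem sternMax_two_mul (n : ℕ) : sternMax (2 * n) = stern n + stern (n + 1) := by
  rw [sternMax, stern_two_mul, stern_two_mul_add_one]
  push_cast
  exact max_eq_right (by simp)

theorem sternMax_two_mul_add_one (n : ℕ) : sternMax (2 * n + 1) = stern n + stern (n + 1) := by
  rw [sternMax, stern_two_mul_add_one, show 2 * n + 1 + 1 = 2 * (n + 1) by ring, stern_two_mul]
  push_cast
  exact max_eq_left (by simp)

theorem sternRatio_two_mul (n : ℕ) :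
    sternRatio (2 * n) = stern n / (stern n + stern (n + 1)) := by
  rw [sternRatio, sternMax_two_mul, stern_two_mul, stern_two_mul_add_one]
  push_cast
  rw [min_eq_left (by simp)]

theorem sternRatio_two_mul_add_one (n : ℕ) :
    sternRatio (2 * n + 1) = stern (n + 1) / (stern n + stern (n + 1)) := by
  rw [sternRatio, sternMax_two_mul_add_one, stern_two_mul_add_one,
    show 2 * n + 1 + 1 = 2 * (n + 1) by ring, stern_two_mul]
  push_cast
  rw [min_eq_right (by simp)]

/-- The ratios of the two descendants are the two images of the ratio under the inverse
branches of the Farey map. -/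
theorem sternRatio_descendants {n : ℕ} (h : 1 ≤ n) (G : ℝ → ℝ) :
    G (sternRatio (2 * n)) + G (sternRatio (2 * n + 1)) =
      G (fareyLeft (sternRatio n)) + G (fareyRight (sternRatio n)) := by
  have h1 : (0 : ℝ) < stern n := by exact_mod_cast stern_pos h
  have h2 : (0 : ℝ) < stern (n + 1) := by exact_mod_cast stern_pos (by omega)
  rw [sternRatio_two_mul, sternRatio_two_mul_add_one, fareyLeft, fareyRight, sternRatio, sternMax]
  -- The even descendant takes the left branch exactly when s(n) is the smaller one, up to ties;
  -- hence only the unordered pair is described, through an arbitrary `G`.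
  rcases le_total (stern n : ℝ) (stern (n + 1)) with hle | hle
  · rw [min_eq_left hle, max_eq_right hle]
    congr 2 <;> field_simp <;> ring
  · rw [min_eq_right hle, max_eq_left hle, add_comm]
    congr 2 <;> field_simp

theorem log_sternMax_descendants {n : ℕ} (h : 1 ≤ n) :
    Real.log (sternMax (2 * n)) = Real.log (sternMax n) + Real.log (1 + sternRatio n) ∧
    Real.log (sternMax (2 * n + 1)) = Real.log (sternMax n) + Real.log (1 + sternRatio n) := by
  have h1 := sternRatio_pos h
  rw [sternMax_two_mul, sternMax_two_mul_add_one, ← sternMax_mul_one_add_ratio h,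
    Real.log_mul (sternMax_pos h).ne' (by positivity)]
  exact ⟨rfl, rfl⟩

/-- Passing to a descendant replaces one of the two neighbours by their sum, which raises a bound on
the quotient by at most 1. -/
theorem stern_le_mul {N : ℕ} : ∀ n ∈ Finset.Ico (2 ^ N) (2 ^ (N + 1)),
    stern n ≤ (N + 1) * stern (n + 1) ∧ stern (n + 1) ≤ (N + 1) * stern n := by
  induction N with
  | zero =>
    intro n hn
    have : n = 1 := by simpa using hn
    subst this
    have : stern 2 = 1 := by rw [show 2 = 2 * 1 by ring, stern_two_mul]; simp [stern]
    simp [this, stern]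
  | succ N ih =>
    intro n hn
    rw [Finset.mem_Ico, pow_succ, pow_succ 2 (N + 1)] at hn
    rcases Nat.even_or_odd' n with ⟨m, rfl | rfl⟩
    · obtain ⟨h1, h2⟩ := ih m (Finset.mem_Ico.2 ⟨by omega, by omega⟩)
      rw [stern_two_mul, stern_two_mul_add_one]
      constructor <;> nlinarith
    · obtain ⟨h1, h2⟩ := ih m (Finset.mem_Ico.2 ⟨by omega, by omega⟩)
      rw [stern_two_mul_add_one, show 2 * m + 1 + 1 = 2 * (m + 1) by ring, stern_two_mul]
      constructor <;> nlinarith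

theorem sternMax_le_mul_stern {N n : ℕ} (hn : n ∈ Finset.Ico (2 ^ N) (2 ^ (N + 1))) :
    sternMax n ≤ (N + 1) * stern n := by
  rw [sternMax, max_le_iff]
  constructor
  · have : (0 : ℝ) ≤ N * stern n := by positivity
    linarith
  · exact_mod_cast (stern_le_mul n hn).2

theorem abs_log_stern_sub_log_sternMax {N n : ℕ} (hn : n ∈ Finset.Ico (2 ^ N) (2 ^ (N + 1))) :
    |Real.log (stern n) - Real.log (sternMax n)| ≤ Real.log (N + 1) := by
  have h1 : (0 : ℝ) < stern n := by exact_mod_cast stern_pos (one_le_of_mem_row hn)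
  have h2 := Real.log_le_log h1 (show (stern n : ℝ) ≤ sternMax n from le_max_left _ _)
  have h3 := Real.log_le_log (sternMax_pos (one_le_of_mem_row hn)) (sternMax_le_mul_stern hn)
  rw [Real.log_mul (by positivity) h1.ne'] at h3
  rw [abs_le]
  constructor <;> linarith [Real.log_nonneg (show (1 : ℝ) ≤ N + 1 by simp)]

/-- The ratios of a row are the images of r(1) = 1 under all words of length `N` in the two
branches. -/
theorem rowMean_sternRatio (N : ℕ) (u : ℝ → ℝ) :
    rowMean N (fun n => u (sternRatio n)) = fareyOp^[N] u 1 := by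
  induction N generalizing u with
  | zero =>
    have : stern 2 = 1 := by rw [show 2 = 2 * 1 by ring, stern_two_mul]; simp [stern]
    simp [rowMean_zero, sternRatio, sternMax, this, stern]
  | succ N ih =>
    rw [rowMean_succ, Function.iterate_succ_apply, ← ih]
    refine rowMean_congr fun n hn => ?_
    rw [sternRatio_descendants (one_le_of_mem_row hn), fareyOp]

/-! ### The Stern martingale -/

/-- The logarithm of the larger one of two consecutive Stern numbers, corrected by a bounded
function so that the row means grow linearly. -/
noncomputable def sternMartingale (n : ℕ) : ℝ :=
  Real.log (sternMax n) + poissonSolution (sternRatio n)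

theorem poissonSolution_fareyLeft_eq {x : ℝ} (hx : x ∈ Icc (0 : ℝ) 1) :
    poissonSolution (fareyLeft x) + Real.log (1 + x) =
      poissonSolution x + sternAlpha + logIncrement x := by
  rw [poissonSolution_fareyLeft hx, poissonSolution, logIncrement]
  ring

theorem poissonSolution_fareyRight_eq {x : ℝ} (hx : x ∈ Icc (0 : ℝ) 1) :
    poissonSolution (fareyRight x) + Real.log (1 + x) =
      poissonSolution x + sternAlpha - logIncrement x := by
  rw [poissonSolution_fareyRight hx, poissonSolution, logIncrement]
  ring

/-- Both maxima gain log(1+r), and the Poisson solution at the two new ratios converts this gain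
into α ± the increment. The arbitrary `G` serves for first and second moments alike. -/
theorem sternMartingale_descendants {n : ℕ} (h : 1 ≤ n) (G : ℝ → ℝ) :
    G (sternMartingale (2 * n)) + G (sternMartingale (2 * n + 1)) =
      G (sternMartingale n + sternAlpha + logIncrement (sternRatio n)) +
        G (sternMartingale n + sternAlpha - logIncrement (sternRatio n)) := by
  have hx := sternRatio_mem h
  have e := sternRatio_descendants h fun x =>
    G (Real.log (sternMax n) + Real.log (1 + sternRatio n) + poissonSolution x)
  rw [sternMartingale, sternMartingale, (log_sternMax_descendants h).1,
    (log_sternMax_descendants h).2, e]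
  have h1 := poissonSolution_fareyLeft_eq hx
  have h2 := poissonSolution_fareyRight_eq hx
  congr 2
  · rw [sternMartingale]; linarith
  · rw [sternMartingale]; linarith

theorem rowMean_sternMartingale (N : ℕ) :
    rowMean N sternMartingale = sternMartingale 1 + sternAlpha * N := by
  induction N with
  | zero => simp [rowMean_zero]
  | succ N ih =>
    have : rowMean (N + 1) sternMartingale = rowMean N fun n => sternMartingale n + sternAlpha := by
      rw [rowMean_succ]
      refine rowMean_congr fun n hn => ?_
      have := sternMartingale_descendants (one_le_of_mem_row hn) id
      simp only [id] at this
      rw [this]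
      ring
    rw [this, rowMean_add, rowMean_const, ih]
    push_cast
    ring

/-- The increments come in opposite pairs, so the cross terms cancel and only the squared increment
at the current ratio is added in each row. -/
theorem rowMean_sternMartingale_sq (N : ℕ) :
    rowMean N (fun n => (sternMartingale n - sternAlpha * N) ^ 2) = sternMartingale 1 ^ 2 +
      ∑ j ∈ Finset.range N, fareyOp^[j] (fun x => logIncrement x ^ 2) 1 := by
  induction N with
  | zero => simp [rowMean_zero]
  | succ N ih =>
    rw [Finset.sum_range_succ, ← add_assoc, ← ih,
      ← rowMean_sternRatio N (fun x => logIncrement x ^ 2), ← rowMean_add, rowMean_succ]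
    refine rowMean_congr fun n hn => ?_
    rw [sternMartingale_descendants (one_le_of_mem_row hn)
      fun x => (x - sternAlpha * ((N + 1 : ℕ) : ℝ)) ^ 2]
    push_cast
    ring

/-! ### Asymptotics of mean and variance -/

theorem tendsto_log_nat_add_one_div (C : ℝ) :
    Tendsto (fun N : ℕ => (C + 2 * Real.log (N + 1)) ^ 2 / √(N + 1)) atTop (𝓝 0) := by
  have hx : Tendsto (fun N : ℕ => (N : ℝ) + 1) atTop atTop :=
    tendsto_atTop_add_const_right _ _ tendsto_natCast_atTop_atTop
  -- The exponent 1/4 becomes the square root after squaring.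
  have h1 : (fun x : ℝ => C + 2 * Real.log x) =o[atTop] fun x => x ^ (1 / 4 : ℝ) := by
    refine Asymptotics.IsLittleO.add ?_
      ((isLittleO_log_rpow_atTop (by norm_num)).const_mul_left 2)
    refine Asymptotics.isLittleO_const_left.2 (Or.inr ?_)
    exact tendsto_norm_atTop_atTop.comp (tendsto_rpow_atTop (by norm_num))
  have h2 := ((h1.tendsto_div_nhds_zero).comp hx).pow 2
  simp only [ne_eq, OfNat.ofNat_ne_zero, not_false_eq_true, zero_pow] at h2
  refine h2.congr fun N => ?_
  have h0 : (0 : ℝ) ≤ (N : ℝ) + 1 := by positivity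
  simp only [Function.comp]
  rw [div_pow, ← Real.rpow_natCast (((N : ℝ) + 1) ^ (1 / 4 : ℝ)), ← Real.rpow_mul h0,
    Real.sqrt_eq_rpow]
  norm_num

theorem tendsto_log_nat_add_one_div_nat (C : ℝ) :
    Tendsto (fun N : ℕ => (C + Real.log (N + 1)) / N) atTop (𝓝 0) := by
  have hx : Tendsto (fun N : ℕ => (N : ℝ) + 1) atTop atTop :=
    tendsto_atTop_add_const_right _ _ tendsto_natCast_atTop_atTop
  have h1 : (fun x : ℝ => C + Real.log x) =o[atTop] fun x => x := by
    refine Asymptotics.IsLittleO.add ?_ Real.isLittleO_log_id_atTop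
    exact Asymptotics.isLittleO_const_left.2 (Or.inr (tendsto_norm_atTop_atTop))
  have h2 := (h1.tendsto_div_nhds_zero).comp hx
  have h3 : Tendsto (fun N : ℕ => 1 + 1 / (N : ℝ)) atTop (𝓝 (1 + 0)) :=
    tendsto_const_nhds.add tendsto_one_div_atTop_nhds_zero_nat
  have h4 := h2.mul h3
  rw [zero_mul] at h4
  refine h4.congr' ?_
  filter_upwards [eventually_ge_atTop 1] with N hN
  have h0 : (0 : ℝ) < (N : ℝ) := by exact_mod_cast hN
  simp only [Function.comp]
  field_simp

/-- Functions close to the logarithm of the larger one of two consecutive Stern numbers have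
row means asymptotic to `α N`. -/
theorem tendsto_rowMean_div {f : ℕ → ℕ → ℝ} {C : ℝ}
    (h : ∀ N, ∀ n ∈ Finset.Ico (2 ^ N) (2 ^ (N + 1)),
      |f N n - Real.log (sternMax n)| ≤ C + Real.log (N + 1)) :
    Tendsto (fun N : ℕ => rowMean N (f N) / N) atTop (𝓝 sternAlpha) := by
  obtain ⟨K, hK, hb⟩ := exists_poissonSolution_bound
  rw [tendsto_iff_norm_sub_tendsto_zero]
  refine squeeze_zero' (Eventually.of_forall fun N => norm_nonneg _) ?_
    (tendsto_log_nat_add_one_div_nat (C + K + |sternMartingale 1|))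
  filter_upwards [eventually_ge_atTop 1] with N hN
  have h0 : (0 : ℝ) < (N : ℝ) := by exact_mod_cast hN
  have h1 : |rowMean N (f N) - rowMean N sternMartingale| ≤ C + K + Real.log (N + 1) := by
    rw [← rowMean_sub]
    refine abs_rowMean_le fun n hn => ?_
    have h2 := h N n hn
    have h3 := (hb _ (sternRatio_mem (one_le_of_mem_row hn))).1
    rw [sternMartingale, ← sub_sub]
    linarith [abs_sub (f N n - Real.log (sternMax n)) (poissonSolution (sternRatio n))]
  rw [rowMean_sternMartingale] at h1
  rw [Real.norm_eq_abs, div_sub' h0.ne', abs_div, abs_of_pos h0]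
  gcongr
  have h2 := abs_add_le (rowMean N (f N) - (sternMartingale 1 + sternAlpha * N)) (sternMartingale 1)
  rw [show rowMean N (f N) - (sternMartingale 1 + sternAlpha * N) + sternMartingale 1 =
    rowMean N (f N) - N * sternAlpha by ring] at h2
  linarith

theorem tendsto_sternLogMean_div :
    Tendsto (fun N : ℕ => sternLogMean N / N) atTop (𝓝 sternAlpha) :=
  tendsto_rowMean_div (C := 0) (f := fun _ n => Real.log (stern n)) fun N n hn => by
    rw [zero_add]; exact abs_log_stern_sub_log_sternMax hn

/-- Young's inequality 2|XE| ≤ δX^2 + E^2/δ, averaged over the row; δ is free so that the error can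
be balanced. -/
theorem abs_rowMean_add_sq_sub_le {N : ℕ} {X E : ℕ → ℝ} {B δ : ℝ} (hδ : 0 < δ)
    (h : ∀ n ∈ Finset.Ico (2 ^ N) (2 ^ (N + 1)), |E n| ≤ B) :
    |rowMean N (fun n => (X n + E n) ^ 2) - rowMean N (fun n => X n ^ 2)| ≤
      δ * rowMean N (fun n => X n ^ 2) + B ^ 2 * (1 + δ⁻¹) := by
  have hE : ∀ n ∈ Finset.Ico (2 ^ N) (2 ^ (N + 1)), E n ^ 2 ≤ B ^ 2 := fun n hn => by
    rw [← sq_abs]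
    exact pow_le_pow_left₀ (abs_nonneg _) (h n hn) 2
  rw [← rowMean_sub, ← rowMean_const_mul, ← rowMean_const N (B ^ 2 * (1 + δ⁻¹)), ← rowMean_add,
    abs_le]
  have hd : 0 < δ⁻¹ := inv_pos.2 hδ
  have hdd : δ * δ⁻¹ = 1 := mul_inv_cancel₀ hδ.ne'
  have key : ∀ n, δ * X n ^ 2 + δ⁻¹ * E n ^ 2 + 2 * (X n * E n) = δ⁻¹ * (δ * X n + E n) ^ 2 ∧
      δ * X n ^ 2 + δ⁻¹ * E n ^ 2 - 2 * (X n * E n) = δ⁻¹ * (δ * X n - E n) ^ 2 := by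
    intro n
    constructor <;> field_simp <;> ring
  constructor
  · rw [← neg_one_mul, ← rowMean_const_mul]
    refine rowMean_mono fun n hn => ?_
    have h1 : 0 ≤ δ⁻¹ * (δ * X n + E n) ^ 2 := by positivity
    rw [← (key n).1] at h1
    nlinarith [hE n hn, sq_nonneg (E n), mul_le_mul_of_nonneg_left (hE n hn) hd.le, sq_nonneg B]
  · refine rowMean_mono fun n hn => ?_
    have h1 : 0 ≤ δ⁻¹ * (δ * X n - E n) ^ 2 := by positivity
    rw [← (key n).2] at h1
    nlinarith [hE n hn, mul_le_mul_of_nonneg_left (hE n hn) hd.le]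

/-- The second moment of the centred martingale divided by N is a Cesàro mean of iterates of the
transfer operator plus a vanishing term. Replacing the martingale by log s(n), and its drift by the
true mean, costs O(log N) pointwise, which does not affect the limit. -/
theorem tendsto_sternLogVar_div :
    Tendsto (fun N : ℕ => sternLogVar N / N) atTop
      (𝓝 (∫ x, logIncrement x ^ 2 ∂minkowskiMeasure)) := by
  obtain ⟨K, hK, hb⟩ := exists_poissonSolution_bound
  obtain ⟨L, hL, hLip⟩ := exists_logIncrement_sq_lipschitz
  set σ := ∫ x, logIncrement x ^ 2 ∂minkowskiMeasure
  set X : ℕ → ℕ → ℝ := fun N n => sternMartingale n - sternAlpha * N with hX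
  set V : ℕ → ℝ := fun N => rowMean N (fun n => X N n ^ 2) with hV
  set C := 2 * K + |sternMartingale 1| with hC
  have hVlim : Tendsto (fun N : ℕ => V N / N) atTop (𝓝 σ) := by
    have h1 := (iterate_fareyOp_tendsto hL integrable_logIncrement_sq hLip
      (x := 1) ⟨zero_le_one, le_rfl⟩).cesaro
    have h2 : Tendsto (fun N : ℕ => sternMartingale 1 ^ 2 / (N : ℝ)) atTop (𝓝 0) :=
      tendsto_const_nhds.div_atTop tendsto_natCast_atTop_atTop
    have h3 := h2.add h1
    rw [zero_add] at h3
    refine h3.congr fun N => ?_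
    simp only [hV, hX]
    rw [rowMean_sternMartingale_sq, add_div, inv_mul_eq_div]
  have hw : Tendsto (fun N : ℕ => √((N : ℝ) + 1)) atTop atTop :=
    Real.tendsto_sqrt_atTop.comp
      (tendsto_atTop_add_const_right _ _ tendsto_natCast_atTop_atTop)
  have hbound : Tendsto (fun N : ℕ => V N / N * (√((N : ℝ) + 1))⁻¹ +
      4 * ((C + 2 * Real.log (N + 1)) ^ 2 / √(N + 1))) atTop (𝓝 0) := by
    have h1 := hVlim.mul (tendsto_inv_atTop_zero.comp hw)
    have h2 := (tendsto_log_nat_add_one_div C).const_mul 4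
    have h3 := h1.add h2
    simpa using h3
  have hdiff : Tendsto (fun N : ℕ => sternLogVar N / N - V N / N) atTop (𝓝 0) := by
    refine squeeze_zero_norm' ?_ hbound
    filter_upwards [eventually_ge_atTop 1] with N hN
    have h0 : (1 : ℝ) ≤ (N : ℝ) := by exact_mod_cast hN
    set w := √((N : ℝ) + 1)
    have hw2 : w ^ 2 = N + 1 := Real.sq_sqrt (by positivity)
    have hw1 : 1 ≤ w := by
      rw [Real.one_le_sqrt]; linarith
    have hYb : ∀ n ∈ Finset.Ico (2 ^ N) (2 ^ (N + 1)),
        |Real.log (stern n) - sternMartingale n| ≤ K + Real.log (N + 1) := by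
      intro n hn
      have h2 := abs_log_stern_sub_log_sternMax hn
      have h3 := (hb _ (sternRatio_mem (one_le_of_mem_row hn))).1
      rw [sternMartingale, ← sub_sub]
      linarith [abs_sub (Real.log (stern n) - Real.log (sternMax n))
        (poissonSolution (sternRatio n))]
    have hmean : |sternLogMean N - (sternMartingale 1 + sternAlpha * N)| ≤
        K + Real.log (N + 1) := by
      rw [← rowMean_sternMartingale, show sternLogMean N =
        rowMean N fun n => Real.log (stern n) from rfl, ← rowMean_sub]
      exact abs_rowMean_le hYb
    have hE : ∀ n ∈ Finset.Ico (2 ^ N) (2 ^ (N + 1)),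
        |Real.log (stern n) - sternLogMean N - X N n| ≤ C + 2 * Real.log (N + 1) := by
      intro n hn
      have h1 := hYb n hn
      have e : Real.log (stern n) - sternLogMean N - X N n =
          (Real.log (stern n) - sternMartingale n) -
          (sternLogMean N - (sternMartingale 1 + sternAlpha * N)) - sternMartingale 1 := by
        simp only [hX]; ring
      rw [e]
      have h2 := abs_sub (Real.log (stern n) - sternMartingale n)
        (sternLogMean N - (sternMartingale 1 + sternAlpha * N))
      have h3 := abs_sub ((Real.log (stern n) - sternMartingale n) -
        (sternLogMean N - (sternMartingale 1 + sternAlpha * N))) (sternMartingale 1)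
      linarith
    -- With δ of order N^(-1/2), both δV(N)/N and the term of order (log N)^2/(δN) tend to 0.
    have hmain := abs_rowMean_add_sq_sub_le (X := X N) (δ := w⁻¹) (by positivity) hE
    have e : rowMean N (fun n => (X N n + (Real.log (stern n) - sternLogMean N - X N n)) ^ 2) =
        sternLogVar N := by
      simp only [add_sub_cancel]
      rfl
    rw [e, inv_inv] at hmain
    rw [← sub_div, Real.norm_eq_abs, abs_div, abs_of_pos (by linarith : (0 : ℝ) < N),
      div_le_iff₀ (by linarith)]
    refine hmain.trans ?_
    set B2 := (C + 2 * Real.log (N + 1)) ^ 2 with hB2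
    have hB : 0 ≤ B2 := sq_nonneg _
    have h5 : (V N / N * w⁻¹ + 4 * (B2 / w)) * N = w⁻¹ * V N + B2 * (4 * N / w) := by
      field_simp
    rw [h5]
    gcongr
    -- The constant 4 comes from w + w^2 ≤ 2(N+1) ≤ 4N.
    rw [le_div_iff₀ (by linarith)]
    nlinarith
  have := hdiff.add hVlim
  rw [zero_add] at this
  exact this.congr fun N => by ring

/-! ### Products of the matrices `A₀` and `A₁` -/

instance instBorelSpaceGLTwo : BorelSpace (Matrix.GeneralLinearGroup (Fin 2) ℝ) := ⟨rfl⟩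

instance instBorelSpaceOnePointReal : BorelSpace (OnePoint ℝ) := ⟨rfl⟩

/-- Second countability makes the Borel σ-algebra of a product the product σ-algebra, so that
multiplication is jointly measurable. -/
instance instSecondCountableTopologyGLTwo :
    SecondCountableTopology (Matrix.GeneralLinearGroup (Fin 2) ℝ) := by
  have h1 : SecondCountableTopology (Matrix (Fin 2) (Fin 2) ℝ) :=
    inferInstanceAs (SecondCountableTopology (Fin 2 → Fin 2 → ℝ))
  have h2 : SecondCountableTopology (Matrix (Fin 2) (Fin 2) ℝ)ᵐᵒᵖ :=
    MulOpposite.opHomeomorph.symm.isEmbedding.secondCountableTopology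
  exact (Units.isEmbedding_embedProduct (M := Matrix (Fin 2) (Fin 2) ℝ)).secondCountableTopology

/-- The product of the matrices `A₀` and `A₁` prescribed by the binary digits of `n`. -/
noncomputable def sternMatrix : ℕ → Matrix.GeneralLinearGroup (Fin 2) ℝ
  | 0 => 1
  | 1 => 1
  | n + 2 => (if n % 2 = 0 then matA1 else matA0) * sternMatrix (n / 2 + 1)
  decreasing_by all_goals omega

theorem sternMatrix_one : sternMatrix 1 = 1 := by simp [sternMatrix]

theorem sternMatrix_two_mul {n : ℕ} (h : 1 ≤ n) :
    sternMatrix (2 * n) = matA1 * sternMatrix n := by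
  obtain ⟨n, rfl⟩ := Nat.exists_eq_add_of_le' h
  rw [show 2 * (n + 1) = 2 * n + 2 by ring, sternMatrix]
  simp

theorem sternMatrix_two_mul_add_one {n : ℕ} (h : 1 ≤ n) :
    sternMatrix (2 * n + 1) = matA0 * sternMatrix n := by
  obtain ⟨n, rfl⟩ := Nat.exists_eq_add_of_le' h
  rw [show 2 * (n + 1) + 1 = (2 * n + 1) + 2 by ring, sternMatrix]
  have h1 : (2 * n + 1) % 2 = 1 := by omega
  have h2 : (2 * n + 1) / 2 = n := by omega
  simp [h1, h2]

/-- The row sums are the image of the vector (1,1). Since A₁ sends (u,v) to (u, u+v) and A₀ sends it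
to (u+v, v), they follow the recursion of (s(n), s(n+1)). -/
theorem sternMatrix_entries {n : ℕ} (h : 1 ≤ n) :
    (∀ i j, 0 ≤ (sternMatrix n).val i j) ∧
      (sternMatrix n).val 0 0 + (sternMatrix n).val 0 1 = stern n ∧
      (sternMatrix n).val 1 0 + (sternMatrix n).val 1 1 = stern (n + 1) := by
  induction n using Nat.strong_induction_on with
  | _ n ih =>
    rcases Nat.even_or_odd' n with ⟨k, rfl | rfl⟩
    · obtain ⟨h1, h2, h3⟩ := ih k (by omega) (by omega)
      have e : (sternMatrix (2 * k)).val = !![1, 0; 1, 1] * (sternMatrix k).val := by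
        rw [sternMatrix_two_mul (by omega)]; rfl
      rw [e, stern_two_mul, stern_two_mul_add_one]
      simp only [Matrix.mul_apply, Fin.sum_univ_two, Fin.forall_fin_two]
      simp only [Matrix.of_apply, Matrix.cons_val', Matrix.cons_val_zero, Matrix.cons_val_one,
        Matrix.cons_val_fin_one, one_mul, zero_mul, add_zero]
      push_cast
      refine ⟨⟨⟨h1 0 0, h1 0 1⟩, add_nonneg (h1 0 0) (h1 1 0), add_nonneg (h1 0 1) (h1 1 1)⟩,
        h2, by linarith⟩
    · rcases Nat.eq_zero_or_pos k with rfl | hk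
      · have : stern 2 = 1 := by rw [show 2 = 2 * 1 by ring, stern_two_mul]; simp [stern]
        simp only [mul_zero, zero_add, sternMatrix_one, this]
        simp [stern, Fin.forall_fin_two]
      obtain ⟨h1, h2, h3⟩ := ih k (by omega) hk
      have e : (sternMatrix (2 * k + 1)).val = !![1, 1; 0, 1] * (sternMatrix k).val := by
        rw [sternMatrix_two_mul_add_one hk]; rfl
      rw [e, show 2 * k + 1 + 1 = 2 * (k + 1) by ring, stern_two_mul, stern_two_mul_add_one]
      simp only [Matrix.mul_apply, Fin.sum_univ_two, Fin.forall_fin_two]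
      simp only [Matrix.of_apply, Matrix.cons_val', Matrix.cons_val_zero, Matrix.cons_val_one,
        Matrix.cons_val_fin_one, one_mul, zero_mul, zero_add]
      push_cast
      refine ⟨⟨⟨add_nonneg (h1 0 0) (h1 1 0), add_nonneg (h1 0 1) (h1 1 1)⟩, h1 1 0, h1 1 1⟩,
        by linarith, h3⟩

/-- The operator norm of a nonnegative matrix is comparable to its largest row sum. -/
theorem glNorm_bounds {g : Matrix.GeneralLinearGroup (Fin 2) ℝ} (hg : ∀ i j, 0 ≤ g.val i j) :
    max (g.val 0 0 + g.val 0 1) (g.val 1 0 + g.val 1 1) ≤ 2 * glNorm g ∧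
      glNorm g ≤ 2 * max (g.val 0 0 + g.val 0 1) (g.val 1 0 + g.val 1 1) := by
  set r := max (g.val 0 0 + g.val 0 1) (g.val 1 0 + g.val 1 1) with hr
  have hr0 : g.val 0 0 + g.val 0 1 ≤ r := le_max_left _ _
  have hr1 : g.val 1 0 + g.val 1 1 ≤ r := le_max_right _ _
  have hrn : 0 ≤ r := (add_nonneg (hg 0 0) (hg 0 1)).trans hr0
  have hcoord : ∀ (v : EuclideanSpace ℝ (Fin 2)) (i : Fin 2), |v i| ≤ ‖v‖ := fun v i =>
    PiLp.norm_apply_le v i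
  constructor
  -- The row sums are the coordinates of the image of (1,1), a vector of norm √2 ≤ 2.
  · set v : EuclideanSpace ℝ (Fin 2) := WithLp.toLp 2 ![1, 1] with hv
    have hvn : ‖v‖ ≤ 2 := by
      rw [EuclideanSpace.norm_eq, Real.sqrt_le_left (by norm_num)]
      simp [hv, Fin.sum_univ_two]
      norm_num
    have h1 : ‖Matrix.toEuclideanCLM (n := Fin 2) (𝕜 := ℝ) g.val v‖ ≤ glNorm g * 2 :=
      (ContinuousLinearMap.le_opNorm _ _).trans
        (mul_le_mul_of_nonneg_left hvn (norm_nonneg _))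
    have hrow : ∀ i, g.val i 0 + g.val i 1 ≤ 2 * glNorm g := by
      intro i
      have h2 := hcoord (Matrix.toEuclideanCLM (n := Fin 2) (𝕜 := ℝ) g.val v) i
      have e : (Matrix.toEuclideanCLM (n := Fin 2) (𝕜 := ℝ) g.val v) i =
          g.val i 0 + g.val i 1 := by
        rw [Matrix.ofLp_toEuclideanCLM]
        simp [hv, Matrix.mulVec, dotProduct, Fin.sum_univ_two]
      rw [e] at h2
      rw [mul_comm]
      exact (le_abs_self _).trans (h2.trans h1)
    exact max_le (hrow 0) (hrow 1)
  · refine ContinuousLinearMap.opNorm_le_bound _ (by positivity) fun v => ?_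
    have hv0 := hcoord v 0
    have hv1 := hcoord v 1
    have hrow : ∀ i, g.val i 0 + g.val i 1 ≤ r := by
      intro i; fin_cases i
      · exact hr0
      · exact hr1
    have h1 : ∀ i, |(Matrix.toEuclideanCLM (n := Fin 2) (𝕜 := ℝ) g.val v) i| ≤ r * ‖v‖ := by
      intro i
      have e : (Matrix.toEuclideanCLM (n := Fin 2) (𝕜 := ℝ) g.val v) i =
          g.val i 0 * v 0 + g.val i 1 * v 1 := by
        rw [Matrix.ofLp_toEuclideanCLM]
        simp [Matrix.mulVec, dotProduct, Fin.sum_univ_two]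
      rw [e]
      calc |g.val i 0 * v 0 + g.val i 1 * v 1| ≤ |g.val i 0 * v 0| + |g.val i 1 * v 1| :=
            abs_add_le _ _
        _ = g.val i 0 * |v 0| + g.val i 1 * |v 1| := by
            rw [abs_mul, abs_mul, abs_of_nonneg (hg i 0), abs_of_nonneg (hg i 1)]
        _ ≤ g.val i 0 * ‖v‖ + g.val i 1 * ‖v‖ :=
            add_le_add (mul_le_mul_of_nonneg_left hv0 (hg i 0))
              (mul_le_mul_of_nonneg_left hv1 (hg i 1))
        _ = (g.val i 0 + g.val i 1) * ‖v‖ := by ring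
        _ ≤ r * ‖v‖ := mul_le_mul_of_nonneg_right (hrow i) (norm_nonneg v)
    rw [EuclideanSpace.norm_eq, Real.sqrt_le_left (by positivity), Fin.sum_univ_two]
    simp only [Real.norm_eq_abs]
    have a0 := pow_le_pow_left₀ (abs_nonneg _) (h1 0) 2
    have a1 := pow_le_pow_left₀ (abs_nonneg _) (h1 1) 2
    nlinarith [sq_nonneg (r * ‖v‖)]

theorem abs_log_glNorm_sternMatrix_sub_le {n : ℕ} (h : 1 ≤ n) :
    |Real.log (glNorm (sternMatrix n)) - Real.log (sternMax n)| ≤ Real.log 2 := by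
  obtain ⟨h1, h2, h3⟩ := sternMatrix_entries h
  obtain ⟨h4, h5⟩ := glNorm_bounds h1
  rw [h2, h3] at h4 h5
  change sternMax n ≤ _ at h4
  change _ ≤ 2 * sternMax n at h5
  have hpos := sternMax_pos h
  have h6 : 0 < glNorm (sternMatrix n) := by linarith
  have h7 := Real.log_le_log hpos h4
  have h8 := Real.log_le_log h6 h5
  rw [Real.log_mul two_ne_zero (by positivity)] at h7 h8
  rw [abs_le]
  constructor <;> linarith

instance isProbabilityMeasure_sternEta : IsProbabilityMeasure sternEta := by
  constructor
  simp [sternEta, ENNReal.inv_two_add_inv_two]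

instance isProbabilityMeasure_convPow (n : ℕ) : IsProbabilityMeasure (convPow sternEta n) := by
  induction n with
  | zero => rw [convPow]; infer_instance
  | succ n ih => rw [convPow]; infer_instance

/-- Words of length `N` in A₀, A₁ correspond to the binary digits below the leading one of the
integers in `[2^N, 2^(N+1))`; convolving on the left appends a digit. -/
theorem convPow_sternEta (N : ℕ) : convPow sternEta N =
    ((1 / 2 : ENNReal) ^ N) • ∑ n ∈ Finset.Ico (2 ^ N) (2 ^ (N + 1)),
      Measure.dirac (sternMatrix n) := by
  induction N with
  | zero => simp [convPow, sternMatrix_one]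
  | succ N ih =>
    have e : convPow sternEta (N + 1) =
        (1 / 2 : ENNReal) • (convPow sternEta N).map (fun y => matA0 * y) +
        (1 / 2 : ENNReal) • (convPow sternEta N).map (fun y => matA1 * y) := by
      have h : ∀ ν : Measure (Matrix.GeneralLinearGroup (Fin 2) ℝ), IsProbabilityMeasure ν →
          Measure.mconv sternEta ν = (1 / 2 : ENNReal) • ν.map (fun y => matA0 * y) +
            (1 / 2 : ENNReal) • ν.map (fun y => matA1 * y) := by
        intro ν _
        rw [sternEta, Measure.add_mconv, Measure.mconv_smul_left, Measure.mconv_smul_left,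
          Measure.dirac_mconv, Measure.dirac_mconv]
      exact h _ inferInstance
    rw [e, ih, sum_row_succ, Measure.map_smul, Measure.map_smul, Measure.map_finset_sum,
      Measure.map_finset_sum, smul_smul, smul_smul, ← smul_add, ← Finset.sum_add_distrib,
      ← pow_succ']
    · congr 1
      refine Finset.sum_congr rfl fun n hn => ?_
      have hn' := one_le_of_mem_row hn
      rw [Measure.map_dirac' (by fun_prop), Measure.map_dirac' (by fun_prop),
        sternMatrix_two_mul hn', sternMatrix_two_mul_add_one hn', add_comm]
    · exact Measurable.aemeasurable (by fun_prop)
    · exact Measurable.aemeasurable (by fun_prop)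

theorem integrable_convPow_sternEta (N : ℕ) (f : Matrix.GeneralLinearGroup (Fin 2) ℝ → ℝ) :
    Integrable f (convPow sternEta N) := by
  rw [convPow_sternEta]
  refine Integrable.smul_measure ?_ (by finiteness)
  exact integrable_finsetSum_measure.2 fun n _ => integrable_dirac (by simp)

theorem integral_convPow_sternEta (N : ℕ) (f : Matrix.GeneralLinearGroup (Fin 2) ℝ → ℝ) :
    ∫ g, f g ∂(convPow sternEta N) = rowMean N fun n => f (sternMatrix n) := by
  rw [convPow_sternEta, integral_smul_measure, integral_finsetSum_measure, rowMean]
  · simp only [integral_dirac, smul_eq_mul]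
    rw [div_eq_inv_mul]
    congr 1
    simp
  · exact fun n _ => integrable_dirac (by simp)

theorem isMaxLyapunovExponent_sternAlpha : IsMaxLyapunovExponent sternEta sternAlpha := by
  refine ⟨?_, fun n => integrable_convPow_sternEta n _, ?_⟩
  · rw [sternEta, integrable_add_measure]
    exact ⟨(integrable_dirac (by simp)).smul_measure (by finiteness),
      (integrable_dirac (by simp)).smul_measure (by finiteness)⟩
  · simp_rw [integral_convPow_sternEta]
    refine tendsto_rowMean_div (C := Real.log 2)
      (f := fun _ n => Real.log (glNorm (sternMatrix n))) fun N n hn => ?_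
    have h1 := abs_log_glNorm_sternMatrix_sub_le (one_le_of_mem_row hn)
    linarith [Real.log_nonneg (show (1 : ℝ) ≤ N + 1 by simp)]

/-! ### The stationary measure on the projective line -/

theorem measurable_coe_onePoint : Measurable fun x : ℝ => (x : OnePoint ℝ) :=
  OnePoint.continuous_coe.measurable

/-- The line is open in its one-point compactification, and the extra point is a measurable set. -/
theorem measurable_of_comp_coe_onePoint {β : Type*} [MeasurableSpace β] {f : OnePoint ℝ → β}
    (hf : Measurable fun x : ℝ => f x) : Measurable f := by
  intro S hS
  have he : MeasurableEmbedding fun x : ℝ => (x : OnePoint ℝ) :=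
    OnePoint.isOpenEmbedding_coe.measurableEmbedding
  have h1 := he.measurableSet_image.2 (hf hS)
  have h2 : MeasurableSet ({OnePoint.infty} ∩ f ⁻¹' S) :=
    (Set.subsingleton_singleton.anti inter_subset_left).measurableSet
  convert h1.union h2 using 1
  ext p
  induction p using OnePoint.rec with
  | infty => simp
  | coe x => simp

theorem measurable_projInv : Measurable projInv := by
  refine measurable_of_comp_coe_onePoint ?_
  change Measurable fun x : ℝ => if x = 0 then OnePoint.infty else ((1 / x : ℝ) : OnePoint ℝ)
  refine Measurable.ite (measurableSet_singleton 0) measurable_const ?_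
  exact measurable_coe_onePoint.comp (by fun_prop)

theorem projInv_coe {x : ℝ} (h : x ≠ 0) : projInv (x : OnePoint ℝ) = ((1 / x : ℝ) : OnePoint ℝ) :=
  if_neg h

theorem measurable_gl_entry (i j : Fin 2) :
    Measurable fun g : Matrix.GeneralLinearGroup (Fin 2) ℝ => g.val i j :=
  ((Units.continuous_val (M := Matrix (Fin 2) (Fin 2) ℝ)).matrix_elem i j).measurable

theorem measurable_gl_smul_onePoint :
    Measurable fun p : Matrix.GeneralLinearGroup (Fin 2) ℝ × OnePoint ℝ => p.1 • p.2 := by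
  classical
  set r : OnePoint ℝ → ℝ := fun p => p.elim 0 id with hr
  have hrm : Measurable r := measurable_of_comp_coe_onePoint (f := r) measurable_id
  have h00 := measurable_gl_entry 0 0
  have h01 := measurable_gl_entry 0 1
  have h10 := measurable_gl_entry 1 0
  have h11 := measurable_gl_entry 1 1
  have e : (fun p : Matrix.GeneralLinearGroup (Fin 2) ℝ × OnePoint ℝ => p.1 • p.2) = fun p =>
      if p.2 = OnePoint.infty then
        (if p.1.val 1 0 = 0 then OnePoint.infty else
          ((p.1.val 0 0 / p.1.val 1 0 : ℝ) : OnePoint ℝ))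
      else if p.1.val 1 0 * r p.2 + p.1.val 1 1 = 0 then OnePoint.infty else
        (((p.1.val 0 0 * r p.2 + p.1.val 0 1) / (p.1.val 1 0 * r p.2 + p.1.val 1 1) : ℝ) :
          OnePoint ℝ) := by
    funext ⟨g, p⟩
    induction p using OnePoint.rec with
    | infty => simp [OnePoint.smul_infty_eq_ite]
    | coe x => simp [OnePoint.smul_some_eq_ite, hr]
  rw [e]
  refine Measurable.ite (measurable_snd (measurableSet_singleton _)) ?_ ?_
  · refine Measurable.ite ?_ measurable_const ?_
    · exact (h10.comp measurable_fst) (measurableSet_singleton 0)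
    · exact measurable_coe_onePoint.comp (by fun_prop)
  · refine Measurable.ite ?_ measurable_const ?_
    · have : Measurable fun p : Matrix.GeneralLinearGroup (Fin 2) ℝ × OnePoint ℝ =>
          p.1.val 1 0 * r p.2 + p.1.val 1 1 := by fun_prop
      exact this (measurableSet_singleton 0)
    · exact measurable_coe_onePoint.comp (by fun_prop)

theorem map_minkowskiMeasure_eq {β : Type*} [MeasurableSpace β] {h : ℝ → β} (hh : Measurable h) :
    minkowskiMeasure.map h = (1 / 2 : ENNReal) • minkowskiMeasure.map (fun x => h (fareyLeft x)) +
      (1 / 2 : ENNReal) • minkowskiMeasure.map (fun x => h (fareyRight x)) := by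
  conv_lhs => rw [minkowskiMeasure_selfSimilar]
  rw [Measure.map_add _ _ hh, Measure.map_smul, Measure.map_smul,
    Measure.map_map hh measurable_fareyLeft, Measure.map_map hh measurable_fareyRight]
  rfl

theorem matA0_smul_coe {x : ℝ} : matA0 • (x : OnePoint ℝ) = ((x + 1 : ℝ) : OnePoint ℝ) := by
  rw [OnePoint.smul_some_eq_ite]
  simp [matA0, Matrix.GeneralLinearGroup.mkOfDetNeZero]

theorem matA1_smul_coe {x : ℝ} (h : x + 1 ≠ 0) :
    matA1 • (x : OnePoint ℝ) = ((x / (x + 1) : ℝ) : OnePoint ℝ) := by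
  rw [OnePoint.smul_some_eq_ite]
  simp [matA1, Matrix.GeneralLinearGroup.mkOfDetNeZero, h]

/-- On (0,1): A₀·x = 1/R(x), A₀·(1/x) = 1/L(x), A₁·x = L(x) and A₁·(1/x) = R(x). So A₁ rebuilds the
self-similar decomposition of μ, and A₀ that of its inverted image. -/
theorem isStationaryMeasure_sternXi : IsStationaryMeasure sternEta sternXi := by
  have hc := measurable_coe_onePoint
  have hp : IsProbabilityMeasure minkowskiMeasureProj :=
    Measure.isProbabilityMeasure_map hc.aemeasurable
  have hp' : IsProbabilityMeasure (minkowskiMeasureProj.map projInv) :=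
    Measure.isProbabilityMeasure_map measurable_projInv.aemeasurable
  have hξ : IsProbabilityMeasure sternXi := by
    constructor
    simp [sternXi, ENNReal.inv_two_add_inv_two]
  refine ⟨hξ, ?_⟩
  have hs := measurable_gl_smul_onePoint
  have hsc : ∀ g : Matrix.GeneralLinearGroup (Fin 2) ℝ,
      Measurable fun p : OnePoint ℝ => g • p := fun g => hs.comp measurable_prodMk_left
  have hTc : Measurable fun x : ℝ => projInv (x : OnePoint ℝ) := measurable_projInv.comp hc
  have e1 : ∀ g : Matrix.GeneralLinearGroup (Fin 2) ℝ, sternXi.map (fun p : OnePoint ℝ => g • p) =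
      (1 / 2 : ENNReal) • minkowskiMeasure.map (fun x : ℝ => g • (x : OnePoint ℝ)) +
      (1 / 2 : ENNReal) • minkowskiMeasure.map (fun x : ℝ => g • projInv (x : OnePoint ℝ)) := by
    intro g
    rw [sternXi, Measure.map_add _ _ (hsc g), Measure.map_smul, Measure.map_smul,
      minkowskiMeasureProj, Measure.map_map (hsc g) hc, Measure.map_map measurable_projInv hc,
      Measure.map_map (hsc g) (measurable_projInv.comp hc)]
    rfl
  have e2 : ∀ {a b : ℝ → OnePoint ℝ}, (∀ x ∈ Ioo (0 : ℝ) 1, a x = b x) →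
      minkowskiMeasure.map a = minkowskiMeasure.map b := fun h =>
    Measure.map_congr (ae_minkowskiMeasure_mem_Ioo.mono h)
  rw [sternEta, Measure.add_prod, Measure.prod_smul_left, Measure.prod_smul_left,
    Measure.dirac_prod, Measure.dirac_prod, Measure.map_add _ _ hs, Measure.map_smul,
    Measure.map_smul, Measure.map_map hs measurable_prodMk_left,
    Measure.map_map hs measurable_prodMk_left]
  change (1 / 2 : ENNReal) • sternXi.map (fun p : OnePoint ℝ => matA0 • p) +
    (1 / 2 : ENNReal) • sternXi.map (fun p : OnePoint ℝ => matA1 • p) = sternXi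
  rw [e1, e1, e2 (a := fun x : ℝ => matA0 • (x : OnePoint ℝ))
      (b := fun x => projInv (fareyRight x : ℝ)),
    e2 (a := fun x : ℝ => matA0 • projInv (x : OnePoint ℝ))
      (b := fun x => projInv (fareyLeft x : ℝ)),
    e2 (a := fun x : ℝ => matA1 • (x : OnePoint ℝ)) (b := fun x => (fareyLeft x : ℝ)),
    e2 (a := fun x : ℝ => matA1 • projInv (x : OnePoint ℝ)) (b := fun x => (fareyRight x : ℝ))]
  · rw [sternXi, minkowskiMeasureProj, Measure.map_map measurable_projInv hc]
    change _ = (1 / 2 : ENNReal) • minkowskiMeasure.map (fun x : ℝ => (x : OnePoint ℝ)) +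
      (1 / 2 : ENNReal) • minkowskiMeasure.map (fun x : ℝ => projInv (x : OnePoint ℝ))
    rw [map_minkowskiMeasure_eq hc, map_minkowskiMeasure_eq hTc]
    abel_nf
  · intro x hx
    have hx0 := hx.1
    rw [projInv_coe hx0.ne', matA1_smul_coe (by positivity), fareyRight]
    congr 1
    field_simp
  · intro x hx
    have hx0 := hx.1
    rw [matA1_smul_coe (by positivity), fareyLeft, add_comm]
  · intro x hx
    have hx0 := hx.1
    rw [projInv_coe hx0.ne', projInv_coe (fareyLeft_mem_Ioo hx).1.ne', matA0_smul_coe,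
      one_div_fareyLeft hx0]
  · intro x hx
    have hx0 := hx.1
    rw [projInv_coe (fareyRight_mem_Ioo hx).1.ne', matA0_smul_coe, fareyRight, one_div_one_div,
      add_comm]

/-! ### Birkhoff sums of the logarithmic derivative of the Farey map -/

@[fun_prop]
theorem measurable_fareyMap : Measurable fareyMap := by
  unfold fareyMap; fun_prop

/-- Both branches are right inverses of the Farey map, so each half of the self-similar
decomposition is mapped back to μ/2. -/
theorem measurePreserving_fareyMap :
    MeasurePreserving fareyMap minkowskiMeasure minkowskiMeasure := by
  refine ⟨measurable_fareyMap, ?_⟩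
  rw [map_minkowskiMeasure_eq measurable_fareyMap,
    Measure.map_congr (ae_minkowskiMeasure_mem_Ioo.mono fun x hx => fareyMap_fareyLeft hx),
    Measure.map_congr (ae_minkowskiMeasure_mem_Ioo.mono fun x hx => fareyMap_fareyRight hx),
    Measure.map_id', ← add_smul]
  simp [ENNReal.inv_two_add_inv_two]

/-- The points whose Farey orbit stays in the domain where the Farey map is smooth. -/
def fareyRegular : Set ℝ := {x | ∀ n : ℕ, fareyMap^[n] x ∈ Ioo (0 : ℝ) 1 ∧ fareyMap^[n] x ≠ 1 / 2}

theorem ae_mem_fareyRegular : ∀ᵐ x ∂minkowskiMeasure, x ∈ fareyRegular := by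
  refine ae_all_iff.2 fun n => ?_
  exact (measurePreserving_fareyMap.iterate n).quasiMeasurePreserving.ae ae_minkowskiMeasure_ne_half

/-! ### Reversed martingale and strong law -/

/-- The martingale increment of the logarithmic derivative of the Farey map. -/
noncomputable def derivIncrement (x : ℝ) : ℝ :=
  Real.log |deriv fareyMap x| - 2 * sternAlpha + 2 * poissonSolution x -
    2 * poissonSolution (fareyMap x)

@[fun_prop]
theorem measurable_derivIncrement : Measurable derivIncrement := by
  have := measurable_log_abs_deriv_fareyMap
  unfold derivIncrement
  fun_prop

theorem derivIncrement_fareyLeft {x : ℝ} (hx : x ∈ Ioo (0 : ℝ) 1) :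
    derivIncrement (fareyLeft x) = 2 * logIncrement x := by
  have := poissonSolution_fareyLeft_eq (Ioo_subset_Icc_self hx)
  rw [derivIncrement, log_abs_deriv_fareyMap_fareyLeft hx, fareyMap_fareyLeft hx]
  linarith

theorem derivIncrement_fareyRight {x : ℝ} (hx : x ∈ Ioo (0 : ℝ) 1) :
    derivIncrement (fareyRight x) = -(2 * logIncrement x) := by
  have := poissonSolution_fareyRight_eq (Ioo_subset_Icc_self hx)
  rw [derivIncrement, log_abs_deriv_fareyMap_fareyRight hx, fareyMap_fareyRight hx]
  linarith

theorem exists_derivIncrement_bound :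
    ∃ D : ℝ, 0 ≤ D ∧ ∀ x ∈ Ioo (0 : ℝ) 1, x ≠ 1 / 2 → |derivIncrement x| ≤ D := by
  obtain ⟨C, hC, hb⟩ := exists_poissonSolution_bound
  refine ⟨2 * C, by positivity, fun x hx hne => ?_⟩
  obtain ⟨hm, h⟩ := exists_farey_preimage hx hne
  have h1 := (hb _ (Ioo_subset_Icc_self hm)).2.1
  rcases h with h | h
  · rw [h, derivIncrement_fareyLeft hm, abs_mul, abs_two]
    linarith
  · rw [h, derivIncrement_fareyRight hm, abs_neg, abs_mul, abs_two]
    linarith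

theorem measurable_birkhoffSum_derivIncrement (n : ℕ) :
    Measurable (birkhoffSum fareyMap derivIncrement n) := by
  unfold birkhoffSum
  refine Finset.measurable_sum _ fun i _ => ?_
  exact measurable_derivIncrement.comp (measurable_fareyMap.iterate i)

theorem integrable_birkhoffSum_derivIncrement_sq (n : ℕ) :
    Integrable (fun x => birkhoffSum fareyMap derivIncrement n x ^ 2) minkowskiMeasure := by
  obtain ⟨D, hD, hb⟩ := exists_derivIncrement_bound
  refine Integrable.of_bound (C := (n * D) ^ 2)
    ((measurable_birkhoffSum_derivIncrement n).pow_const 2).aestronglyMeasurable ?_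
  filter_upwards [ae_mem_fareyRegular] with x hx
  rw [Real.norm_of_nonneg (sq_nonneg _), ← sq_abs]
  refine pow_le_pow_left₀ (abs_nonneg _) ?_ 2
  refine (Finset.abs_sum_le_sum_abs _ _).trans ?_
  simpa using Finset.sum_le_card_nsmul (Finset.range n) _ D fun i _ => hb _ (hx i).1 (hx i).2

/-- At the two preimages of x, the sum of order n + 1 is the sum of order n at x plus or minus the
same number. Averaging the squares kills the cross term. -/
theorem integral_birkhoffSum_derivIncrement_sq (n : ℕ) :
    ∫ x, birkhoffSum fareyMap derivIncrement n x ^ 2 ∂minkowskiMeasure =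
      n * (4 * ∫ x, logIncrement x ^ 2 ∂minkowskiMeasure) := by
  induction n with
  | zero => simp
  | succ n ih =>
    have h0 := integrable_birkhoffSum_derivIncrement_sq (n + 1)
    have hl := integrable_comp_fareyLeft h0
    have hr := integrable_comp_fareyRight h0
    rw [integral_minkowskiMeasure h0, ← integral_add hl hr, div_eq_iff two_ne_zero]
    have e : ∀ x ∈ Ioo (0 : ℝ) 1,
        birkhoffSum fareyMap derivIncrement (n + 1) (fareyLeft x) ^ 2 +
          birkhoffSum fareyMap derivIncrement (n + 1) (fareyRight x) ^ 2 =
        8 * logIncrement x ^ 2 + 2 * birkhoffSum fareyMap derivIncrement n x ^ 2 := by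
      intro x hx
      rw [birkhoffSum_succ', birkhoffSum_succ', fareyMap_fareyLeft hx, fareyMap_fareyRight hx,
        derivIncrement_fareyLeft hx, derivIncrement_fareyRight hx]
      ring
    rw [integral_minkowskiMeasure_congr e, integral_add (integrable_logIncrement_sq.const_mul 8)
      ((integrable_birkhoffSum_derivIncrement_sq n).const_mul 2), integral_const_mul,
      integral_const_mul, ih]
    push_cast
    ring

/-- Along squares the second moments of the averages are summable, so almost surely the squared
averages form a convergent series. The shift by one avoids a zero denominator. -/
theorem ae_tendsto_birkhoffSum_derivIncrement_sq_index : ∀ᵐ x ∂minkowskiMeasure,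
    Tendsto (fun j : ℕ => birkhoffSum fareyMap derivIncrement ((j + 1) ^ 2) x / ((j + 1) ^ 2 : ℕ))
      atTop (𝓝 0) := by
  set f : ℕ → ℝ → ℝ := fun j x =>
    birkhoffSum fareyMap derivIncrement ((j + 1) ^ 2) x / ((j + 1) ^ 2 : ℕ) with hf
  set E := 4 * ∫ x, logIncrement x ^ 2 ∂minkowskiMeasure with hE
  have hint : ∀ j, ∫⁻ x, ENNReal.ofReal (f j x ^ 2) ∂minkowskiMeasure =
      ENNReal.ofReal (E / ((j + 1) ^ 2 : ℕ)) := by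
    intro j
    have e : ∀ x, f j x ^ 2 =
        birkhoffSum fareyMap derivIncrement ((j + 1) ^ 2) x ^ 2 / (((j + 1) ^ 2 : ℕ) : ℝ) ^ 2 :=
      fun x => div_pow _ _ _
    rw [← ofReal_integral_eq_lintegral_ofReal]
    · congr 1
      simp_rw [e]
      rw [integral_div, integral_birkhoffSum_derivIncrement_sq]
      have : (((j + 1) ^ 2 : ℕ) : ℝ) ≠ 0 := by positivity
      field_simp
      rfl
    · simp_rw [e]
      exact (integrable_birkhoffSum_derivIncrement_sq _).div_const _
    · exact ae_of_all _ fun x => sq_nonneg _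
  have hsum : Summable fun j : ℕ => E / ((j + 1) ^ 2 : ℕ) := by
    have h1 := (summable_nat_add_iff 1).2 (Real.summable_one_div_nat_pow.2 one_lt_two)
    refine (h1.mul_left E).congr fun j => ?_
    push_cast
    ring
  have hmeas : ∀ j, Measurable fun x => ENNReal.ofReal (f j x ^ 2) := fun j =>
    (((measurable_birkhoffSum_derivIncrement _).div_const _).pow_const 2).ennreal_ofReal
  have hfin : ∫⁻ x, ∑' j, ENNReal.ofReal (f j x ^ 2) ∂minkowskiMeasure ≠ ⊤ := by
    rw [lintegral_tsum fun j => (hmeas j).aemeasurable]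
    simp_rw [hint]
    exact hsum.tsum_ofReal_ne_top
  filter_upwards [ae_lt_top (Measurable.tsum hmeas) hfin] with x hx
  have h1 := ENNReal.tendsto_atTop_zero_of_tsum_ne_top hx.ne
  have h2 := (ENNReal.tendsto_toReal ENNReal.zero_ne_top).comp h1
  simp only [ENNReal.toReal_zero] at h2
  have h3 : Tendsto (fun j => f j x ^ 2) atTop (𝓝 0) :=
    h2.congr fun j => ENNReal.toReal_ofReal (sq_nonneg _)
  have h4 := (Real.continuous_sqrt.tendsto 0).comp h3
  rw [Real.sqrt_zero] at h4
  refine (tendsto_zero_iff_abs_tendsto_zero _).2 (h4.congr fun j => ?_)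
  exact Real.sqrt_sq_eq_abs _

theorem ae_tendsto_birkhoffSum_derivIncrement : ∀ᵐ x ∂minkowskiMeasure,
    Tendsto (fun n : ℕ => birkhoffSum fareyMap derivIncrement n x / n) atTop (𝓝 0) := by
  obtain ⟨D, hD, hb⟩ := exists_derivIncrement_bound
  filter_upwards [ae_tendsto_birkhoffSum_derivIncrement_sq_index, ae_mem_fareyRegular] with x hx hr
  set M : ℕ → ℝ := fun n => birkhoffSum fareyMap derivIncrement n x with hM
  have hinc : ∀ m k, |M (m + k) - M m| ≤ k * D := by
    intro m k
    induction k with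
    | zero => simp
    | succ k ih =>
      have e : M (m + (k + 1)) = M (m + k) + derivIncrement (fareyMap^[m + k] x) :=
        birkhoffSum_succ _ _ _ _
      have h1 := hb _ (hr (m + k)).1 (hr (m + k)).2
      rw [e, add_sub_right_comm]
      refine (abs_add_le _ _).trans ?_
      push_cast
      linarith
  have hsq : Tendsto (fun n : ℕ => Nat.sqrt n - 1) atTop atTop := by
    refine tendsto_atTop.2 fun K => ?_
    filter_upwards [eventually_ge_atTop ((K + 1) ^ 2)] with n hn
    have := Nat.le_sqrt'.2 hn
    omega
  have hbd : Tendsto (fun j : ℕ => |M ((j + 1) ^ 2) / ((j + 1) ^ 2 : ℕ)| +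
      2 * D * (1 / ((j : ℝ) + 1))) atTop (𝓝 0) := by
    have h1 := hx.abs
    have h2 := (tendsto_one_div_add_atTop_nhds_zero_nat (𝕜 := ℝ)).const_mul (2 * D)
    simpa using h1.add h2
  refine squeeze_zero_norm' ?_ (hbd.comp hsq)
  filter_upwards [eventually_ge_atTop 1] with n hn
  obtain ⟨j, hj⟩ : ∃ j, Nat.sqrt n = j + 1 :=
    Nat.exists_eq_add_of_le' (Nat.le_sqrt'.2 (by simpa using hn))
  have h1 : (j + 1) ^ 2 ≤ n := hj ▸ Nat.sqrt_le' n
  -- Between consecutive squares the sum moves by at most 2(j+1)D, negligible against (j+1)^2.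
  have h2 : n ≤ (j + 1) ^ 2 + 2 * (j + 1) := by
    have := Nat.sqrt_le_add n
    rw [hj] at this
    nlinarith
  obtain ⟨k, rfl⟩ := Nat.exists_eq_add_of_le h1
  have h3 := hinc ((j + 1) ^ 2) k
  have hk : (k : ℝ) ≤ 2 * (j + 1) := by
    have : k ≤ 2 * (j + 1) := by omega
    exact_mod_cast this
  simp only [Function.comp, hj, Nat.add_sub_cancel, Real.norm_eq_abs, abs_div, Nat.abs_cast]
  have hp : (0 : ℝ) < ((j + 1) ^ 2 : ℕ) := by positivity
  have h4 : |M ((j + 1) ^ 2 + k)| ≤ |M ((j + 1) ^ 2)| + 2 * (j + 1) * D := by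
    have := abs_sub_abs_le_abs_sub (M ((j + 1) ^ 2 + k)) (M ((j + 1) ^ 2))
    nlinarith
  calc |M ((j + 1) ^ 2 + k)| / (((j + 1) ^ 2 + k : ℕ) : ℝ)
      ≤ |M ((j + 1) ^ 2 + k)| / ((j + 1) ^ 2 : ℕ) := by
        refine div_le_div_of_nonneg_left (abs_nonneg _) hp ?_
        push_cast
        simp
    _ ≤ (|M ((j + 1) ^ 2)| + 2 * (j + 1) * D) / ((j + 1) ^ 2 : ℕ) := by gcongr
    _ = _ := by
        push_cast
        field_simp

/-- The Lyapunov exponent of almost every Farey orbit is `2 α`. -/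
theorem ae_tendsto_birkhoffSum_log_deriv : ∀ᵐ x ∂minkowskiMeasure,
    Tendsto (fun n : ℕ => birkhoffSum fareyMap (fun y => Real.log |deriv fareyMap y|) n x / n)
      atTop (𝓝 (2 * sternAlpha)) := by
  obtain ⟨C, hC, hb⟩ := exists_poissonSolution_bound
  filter_upwards [ae_tendsto_birkhoffSum_derivIncrement, ae_mem_fareyRegular] with x hx hr
  -- The coboundary part telescopes to two values of the bounded Poisson solution.
  have e : ∀ n : ℕ, birkhoffSum fareyMap (fun y => Real.log |deriv fareyMap y|) n x =
      birkhoffSum fareyMap derivIncrement n x + 2 * sternAlpha * n +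
        (2 * poissonSolution (fareyMap^[n] x) - 2 * poissonSolution x) := by
    intro n
    induction n with
    | zero => simp
    | succ n ih =>
      rw [birkhoffSum_succ, birkhoffSum_succ, ih, Function.iterate_succ_apply', derivIncrement]
      push_cast
      ring
  have h1 : Tendsto (fun n : ℕ => (2 * poissonSolution (fareyMap^[n] x) - 2 * poissonSolution x) /
      (n : ℝ)) atTop (𝓝 0) := by
    refine squeeze_zero_norm (a := fun n : ℕ => 4 * C / (n : ℝ)) (fun n => ?_)
      (tendsto_const_nhds.div_atTop tendsto_natCast_atTop_atTop)
    rw [norm_div, Real.norm_natCast, Real.norm_eq_abs]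
    gcongr
    have h2 := (hb _ (Ioo_subset_Icc_self (hr n).1)).1
    have h3 := (hb _ (Ioo_subset_Icc_self (hr 0).1)).1
    simp only [Function.iterate_zero, id] at h3
    rw [abs_le] at *
    constructor <;> linarith [h2.1, h2.2, h3.1, h3.2]
  have h2 := (hx.add_const (2 * sternAlpha)).add h1
  rw [zero_add, add_zero] at h2
  refine h2.congr' ?_
  filter_upwards [eventually_ge_atTop 1] with n hn
  have : (n : ℝ) ≠ 0 := by positivity
  rw [e]
  field_simp

/-! ### Distance to the end points of Farey intervals -/

/-- For t ≤ 1/2 one has ?(t) = ?(t/(1-t))/2 with t/(1-t) ≤ 2t, so an additive error in the bound 2t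
is halved at each step. The start is the trivial bound by 1. -/
theorem questionMark_le_two_mul {t : ℝ} (ht : t ∈ Icc (0 : ℝ) 1) : questionMark t ≤ 2 * t := by
  have h : ∀ n : ℕ, ∀ t ∈ Icc (0 : ℝ) 1, questionMark t ≤ 2 * t + (1 / 2) ^ n := by
    intro n
    induction n with
    | zero =>
      intro t ht
      simp only [pow_zero]
      linarith [(questionMark_mem ht).2, ht.1]
    | succ n ih =>
      intro t ht
      have hp : (0 : ℝ) < (1 / 2) ^ n := by positivity
      rcases le_total (1 / 2) t with h | h
      · have := (questionMark_mem ht).2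
        rw [pow_succ]
        linarith
      · have hd : 0 < 1 - t := by linarith
        have hs : t / (1 - t) ∈ Icc (0 : ℝ) 1 := by
          refine ⟨div_nonneg ht.1 hd.le, ?_⟩
          rw [div_le_one hd]; linarith
        have e : t = fareyLeft (t / (1 - t)) := by
          rw [fareyLeft]; field_simp; ring
        have h2 : t / (1 - t) ≤ 2 * t := by
          rw [div_le_iff₀ hd]; nlinarith [ht.1]
        have h1 := ih _ hs
        have h3 := questionMark_fareyLeft hs
        rw [← e] at h3
        rw [h3, pow_succ]
        linarith
  have hlim : Tendsto (fun n : ℕ => 2 * t + (1 / 2 : ℝ) ^ n) atTop (𝓝 (2 * t)) := by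
    simpa using (tendsto_pow_atTop_nhds_zero_of_lt_one (r := (1 / 2 : ℝ)) (by norm_num)
      (by norm_num)).const_add (2 * t)
  exact ge_of_tendsto' hlim fun n => h n t ht

theorem one_sub_questionMark_le {t : ℝ} (ht : t ∈ Icc (0 : ℝ) 1) :
    1 - questionMark t ≤ 2 * (1 - t) := by
  rcases le_total t (1 / 2) with h | h
  · linarith [(questionMark_mem ht).1]
  · have hd : 0 < t := by linarith
    have hs : (1 - t) / t ∈ Icc (0 : ℝ) 1 := by
      refine ⟨div_nonneg (by linarith [ht.2]) hd.le, ?_⟩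
      rw [div_le_one hd]; linarith
    have e : t = fareyRight ((1 - t) / t) := by
      rw [fareyRight]; field_simp; ring
    have h1 := questionMark_le_two_mul hs
    have h2 := questionMark_fareyRight hs
    rw [← e] at h2
    have h3 : (1 - t) / t ≤ 2 * (1 - t) := by
      rw [div_le_iff₀ hd]; nlinarith [ht.2]
    linarith

/-- A continuous distribution function pushes its measure to the uniform one; choosing a point with
value ε gives the bound. -/
theorem minkowskiMeasure_cdf_lt {ε : ℝ} (h0 : 0 ≤ ε) (h1 : ε ≤ 1) :
    minkowskiMeasure {x | minkowskiCDF x < ε} ≤ ENNReal.ofReal ε := by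
  obtain ⟨c, hc, he⟩ := intermediate_value_Icc zero_le_one questionMark_continuousOn
    (show ε ∈ Icc (questionMark 0) (questionMark 1) by
      rw [questionMark_zero, questionMark_one]; exact ⟨h0, h1⟩)
  rw [← minkowskiCDF_of_mem hc] at he
  rw [← he, ← minkowskiMeasure_Iic]
  exact measure_mono fun x hx => (minkowskiCDF_monotone.reflect_lt hx).le

theorem minkowskiMeasure_one_sub_cdf_lt {ε : ℝ} (h0 : 0 ≤ ε) (h1 : ε ≤ 1) :
    minkowskiMeasure {x | 1 - minkowskiCDF x < ε} ≤ ENNReal.ofReal ε := by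
  obtain ⟨c, hc, he⟩ := intermediate_value_Icc zero_le_one questionMark_continuousOn
    (show 1 - ε ∈ Icc (questionMark 0) (questionMark 1) by
      rw [questionMark_zero, questionMark_one]; exact ⟨by linarith, by linarith⟩)
  rw [← minkowskiCDF_of_mem hc] at he
  have e : ε = 1 - minkowskiCDF c := by linarith
  rw [e, ← minkowskiMeasure_Ici]
  refine measure_mono fun x hx => (minkowskiCDF_monotone.reflect_lt ?_).le
  have : 1 - minkowskiCDF x < 1 - minkowskiCDF c := hx
  linarith

/-- Borel-Cantelli: by invariance, the exceptional set at time n has measure at most 1/(n+1)^2 at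
each end. -/
theorem ae_eventually_orbit_far_from_ends : ∀ᵐ x ∂minkowskiMeasure, ∀ᶠ n : ℕ in atTop,
    1 / ((n : ℝ) + 1) ^ 2 ≤ questionMark (fareyMap^[n] x) ∧
      1 / ((n : ℝ) + 1) ^ 2 ≤ 1 - questionMark (fareyMap^[n] x) := by
  have hs : Summable fun n : ℕ => 1 / ((n : ℝ) + 1) ^ 2 := by
    have h1 := (summable_nat_add_iff 1).2 (Real.summable_one_div_nat_pow.2 one_lt_two)
    exact h1.congr fun j => by push_cast; rfl
  have hε : ∀ n : ℕ, 1 / ((n : ℝ) + 1) ^ 2 ≤ 1 := fun n => by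
    rw [div_le_one (by positivity)]
    nlinarith [(Nat.cast_nonneg n : (0 : ℝ) ≤ n)]
  have hm := minkowskiCDF_continuous.measurable
  have h1 : ∀ᵐ x ∂minkowskiMeasure, ∀ᶠ n : ℕ in atTop,
      x ∉ fareyMap^[n] ⁻¹' {y | minkowskiCDF y < 1 / ((n : ℝ) + 1) ^ 2} := by
    refine ae_eventually_notMem (ne_top_of_le_ne_top hs.tsum_ofReal_ne_top ?_)
    refine ENNReal.tsum_le_tsum fun n => ?_
    rw [(measurePreserving_fareyMap.iterate n).measure_preimage
      (measurableSet_lt hm measurable_const).nullMeasurableSet]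
    exact minkowskiMeasure_cdf_lt (by positivity) (hε n)
  have h2 : ∀ᵐ x ∂minkowskiMeasure, ∀ᶠ n : ℕ in atTop,
      x ∉ fareyMap^[n] ⁻¹' {y | 1 - minkowskiCDF y < 1 / ((n : ℝ) + 1) ^ 2} := by
    refine ae_eventually_notMem (ne_top_of_le_ne_top hs.tsum_ofReal_ne_top ?_)
    refine ENNReal.tsum_le_tsum fun n => ?_
    rw [(measurePreserving_fareyMap.iterate n).measure_preimage
      (measurableSet_lt (show Measurable fun y => 1 - minkowskiCDF y from hm.const_sub 1)
        measurable_const).nullMeasurableSet]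
    exact minkowskiMeasure_one_sub_cdf_lt (by positivity) (hε n)
  filter_upwards [h1, h2, ae_mem_fareyRegular] with x hx1 hx2 hr
  filter_upwards [hx1, hx2] with n hn1 hn2
  simp only [mem_preimage, mem_ofPred_eq, not_lt,
    minkowskiCDF_of_mem (Ioo_subset_Icc_self (hr n).1)] at hn1 hn2
  exact ⟨hn1, hn2⟩

/-! ### Farey intervals -/

/-- The branch of the inverse of the `n`-th iterate of the Farey map through a regular point is
a Möbius transformation on which the question mark function is affine. -/
theorem exists_farey_branch {x : ℝ} (hx : x ∈ fareyRegular) (n : ℕ) :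
    ∃ a b c d u v : ℝ, |a * d - b * c| = 1 ∧ 0 ≤ c ∧ 0 < d ∧ c ≤ n * d ∧
      |v| = (1 / 2) ^ n ∧
      (∀ s ∈ Icc (0 : ℝ) 1, (a * s + b) / (c * s + d) ∈ Icc (0 : ℝ) 1 ∧
        questionMark ((a * s + b) / (c * s + d)) = u + v * questionMark s) ∧
      (a * fareyMap^[n] x + b) / (c * fareyMap^[n] x + d) = x ∧
      birkhoffSum fareyMap (fun y => Real.log |deriv fareyMap y|) n x =
        2 * Real.log (c * fareyMap^[n] x + d) := by
  induction n with
  | zero =>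
    refine ⟨1, 0, 0, 1, 0, 1, by simp, le_rfl, one_pos, by simp, by simp, ?_, by simp, by simp⟩
    intro s hs
    simpa using hs
  | succ n ih =>
    obtain ⟨a, b, c, d, u, v, hdet, hc, hd, hcd, hv, hmap, hpt, hS⟩ := ih
    obtain ⟨hm, h⟩ := exists_farey_preimage (hx n).1 (hx n).2
    rw [← Function.iterate_succ_apply' fareyMap n x] at hm h
    set t := fareyMap^[n] x with ht
    set t' := fareyMap^[n + 1] x with ht'
    have ht0 := hm.1
    rcases h with h | h
    -- Composing with the left branch adds the second column to the first. The inequality c ≤ n d,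
    -- which controls distortion, becomes c + d ≤ (n+1) d.
    · have e : ∀ s ∈ Icc (0 : ℝ) 1, ((a + b) * s + b) / ((c + d) * s + d) =
          (a * fareyLeft s + b) / (c * fareyLeft s + d) := by
        intro s hs
        have h0 := hs.1
        have h1 : 0 < (c + d) * s + d := by positivity
        have h2 : 0 < c * s + d * (1 + s) := by positivity
        rw [fareyLeft]
        field_simp
        ring
      refine ⟨a + b, b, c + d, d, u, v / 2, ?_, by positivity, hd, ?_, ?_, ?_, ?_, ?_⟩
      · rw [← hdet]; congr 1; ring
      · push_cast; linarith
      · rw [abs_div, hv, abs_two, pow_succ]; ring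
      · intro s hs
        rw [e s hs]
        obtain ⟨h1, h2⟩ := hmap _ (fareyLeft_mem hs)
        refine ⟨h1, ?_⟩
        rw [h2, questionMark_fareyLeft hs]
        ring
      · rw [e _ (Ioo_subset_Icc_self hm), ← h]
        exact hpt
      -- Chain rule: the denominator of the composed map is the old denominator at Ls times 1 + s.
      · rw [birkhoffSum_succ, hS, ← ht, h, log_abs_deriv_fareyMap_fareyLeft hm, ← mul_add,
          ← Real.log_mul _ (by positivity)]
        · congr 2
          rw [fareyLeft]
          field_simp
          ring
        · rw [← h]
          have := (hx n).1.1
          positivity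
    -- The right branch reverses orientation, which flips the signs of the determinant and of `v`.
    · have e : ∀ s ∈ Icc (0 : ℝ) 1, (b * s + (a + b)) / (d * s + (c + d)) =
          (a * fareyRight s + b) / (c * fareyRight s + d) := by
        intro s hs
        have h0 := hs.1
        have h1 : 0 < d * s + (c + d) := by positivity
        have h2 : 0 < c + d * (1 + s) := by positivity
        rw [fareyRight]
        field_simp
        ring
      refine ⟨b, a + b, d, c + d, u + v, -(v / 2), ?_, hd.le, by positivity, ?_, ?_, ?_, ?_, ?_⟩
      · rw [← hdet, ← abs_neg]; congr 1; ring
      · push_cast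
        have : 0 ≤ (n : ℝ) * (c + d) := by positivity
        linarith
      · rw [abs_neg, abs_div, hv, abs_two, pow_succ]; ring
      · intro s hs
        rw [e s hs]
        obtain ⟨h1, h2⟩ := hmap _ (fareyRight_mem hs)
        refine ⟨h1, ?_⟩
        rw [h2, questionMark_fareyRight hs]
        ring
      · rw [e _ (Ioo_subset_Icc_self hm), ← h]
        exact hpt
      · rw [birkhoffSum_succ, hS, ← ht, h, log_abs_deriv_fareyMap_fareyRight hm, ← mul_add,
          ← Real.log_mul _ (by positivity)]
        · congr 2
          rw [fareyRight]
          field_simp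
          ring
        · rw [← h]
          have := (hx n).1.1
          positivity

/-- Lower bounds at a point outside of an interval which contains `x`. -/
theorem min_le_abs_sub_of_notMem {p q x y : ℝ} {I : Set ℝ} (hp : p ∈ Icc (0 : ℝ) 1)
    (hq : q ∈ Icc (0 : ℝ) 1) (hx : x ∈ Icc (0 : ℝ) 1) (hpx : p ≤ x) (hxq : x ≤ q)
    (hI : Icc p q ⊆ I) (hy : y ∈ Icc (0 : ℝ) 1) (hyI : y ∉ I) :
    min |p - x| |q - x| ≤ |y - x| ∧
      min |questionMark p - questionMark x| |questionMark q - questionMark x| ≤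
        |questionMark y - questionMark x| := by
  have h1 := questionMark_monotoneOn hp hx hpx
  have h2 := questionMark_monotoneOn hx hq hxq
  by_cases h : y < p
  · have h3 := questionMark_monotoneOn hy hp h.le
    refine ⟨(min_le_left _ _).trans ?_, (min_le_left _ _).trans ?_⟩
    · rw [abs_of_nonpos (by linarith), abs_of_nonpos (by linarith)]; linarith
    · rw [abs_of_nonpos (by linarith), abs_of_nonpos (by linarith)]; linarith
  · have hqy : q < y := by
      by_contra h'
      exact hyI (hI ⟨not_lt.1 h, not_lt.1 h'⟩)
    have h3 := questionMark_monotoneOn hq hy hqy.le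
    refine ⟨(min_le_right _ _).trans ?_, (min_le_right _ _).trans ?_⟩
    · rw [abs_of_nonneg (by linarith), abs_of_nonneg (by linarith)]; linarith
    · rw [abs_of_nonneg (by linarith), abs_of_nonneg (by linarith)]; linarith

/-- The Farey interval of order `n` around a regular point. -/
theorem exists_farey_interval {x : ℝ} (hx : x ∈ fareyRegular) (n : ℕ) :
    ∃ I : Set ℝ,
      (∀ y ∈ I, |y - x| ≤ (n + 1) * Real.exp
          (-birkhoffSum fareyMap (fun y => Real.log |deriv fareyMap y|) n x) ∧
        |questionMark y - questionMark x| ≤ (1 / 2) ^ n) ∧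
      ∀ y ∈ Icc (0 : ℝ) 1, y ∉ I →
        min (fareyMap^[n] x) (1 - fareyMap^[n] x) / (n + 1) * Real.exp
          (-birkhoffSum fareyMap (fun y => Real.log |deriv fareyMap y|) n x) ≤ |y - x| ∧
        (1 / 2) ^ n * min (questionMark (fareyMap^[n] x)) (1 - questionMark (fareyMap^[n] x)) ≤
          |questionMark y - questionMark x| := by
  obtain ⟨a, b, c, d, u, v, hdet, hc, hd, hcd, hv, hmap, hpt, hS⟩ := exists_farey_branch hx n
  have htm := (hx n).1
  set t := fareyMap^[n] x with ht
  have htI := Ioo_subset_Icc_self htm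
  set S := birkhoffSum fareyMap (fun y => Real.log |deriv fareyMap y|) n x
  set φ : ℝ → ℝ := fun s => (a * s + b) / (c * s + d) with hφ
  have hpos : ∀ s ∈ Icc (0 : ℝ) 1, 0 < c * s + d := fun s hs => by
    have := mul_nonneg hc hs.1
    positivity
  have hlow : ∀ s ∈ Icc (0 : ℝ) 1, d ≤ c * s + d := fun s hs => by
    linarith [mul_nonneg hc hs.1]
  -- All denominators lie between d and (n+1)d, so the derivative at `t` represents the scale of the
  -- whole interval up to a factor n + 1.
  have hup : ∀ s ∈ Icc (0 : ℝ) 1, c * s + d ≤ (n + 1) * d := fun s hs => by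
    nlinarith [mul_le_mul_of_nonneg_left hs.2 hc]
  have hexp : Real.exp (-S) = ((c * t + d) ^ 2)⁻¹ := by
    rw [hS, Real.exp_neg, ← Real.log_rpow (hpos t htI), Real.exp_log (by
      have := hpos t htI
      positivity)]
    norm_num
  have hxφ : φ t = x := hpt
  have hdiff : ∀ s ∈ Icc (0 : ℝ) 1,
      φ s - x = (a * d - b * c) * (s - t) / ((c * s + d) * (c * t + d)) := by
    intro s hs
    have h1 := (hpos s hs).ne'
    have h2 := (hpos t htI).ne'
    rw [← hxφ]
    simp only [hφ]
    rw [div_sub_div _ _ h1 h2]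
    congr 1
    ring
  have habs : ∀ s ∈ Icc (0 : ℝ) 1, |φ s - x| = |s - t| / ((c * s + d) * (c * t + d)) := by
    intro s hs
    rw [hdiff s hs, abs_div, abs_mul, hdet, one_mul,
      abs_of_pos (mul_pos (hpos s hs) (hpos t htI))]
  have hQ : ∀ s ∈ Icc (0 : ℝ) 1,
      |questionMark (φ s) - questionMark x| = (1 / 2) ^ n * |questionMark s - questionMark t| := by
    intro s hs
    rw [← hxφ, (hmap s hs).2, (hmap t htI).2, add_sub_add_left_eq_sub, ← mul_sub, abs_mul, hv]
  have hn : (0 : ℝ) < n + 1 := by positivity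
  have hlower : ∀ s ∈ Icc (0 : ℝ) 1, |s - t| / (n + 1) * Real.exp (-S) ≤ |φ s - x| := by
    intro s hs
    have h1 := hpos s hs
    have h2 := hpos t htI
    rw [habs s hs, hexp, div_mul_eq_mul_div, ← div_eq_mul_inv, div_div]
    refine div_le_div_of_nonneg_left (abs_nonneg _) (by positivity) ?_
    have h3 : c * s + d ≤ (n + 1) * (c * t + d) :=
      (hup s hs).trans (mul_le_mul_of_nonneg_left (hlow t htI) hn.le)
    nlinarith
  refine ⟨φ '' Icc 0 1, ?_, ?_⟩
  · rintro y ⟨s, hs, rfl⟩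
    constructor
    · have h1 := hpos s hs
      have h2 := hpos t htI
      rw [habs s hs, hexp, ← div_eq_mul_inv, div_le_div_iff₀ (by positivity) (by positivity)]
      have h3 : c * t + d ≤ (n + 1) * (c * s + d) :=
        (hup t htI).trans (mul_le_mul_of_nonneg_left (hlow s hs) hn.le)
      have h4 : |s - t| ≤ 1 := by
        rw [abs_le]; constructor <;> linarith [hs.1, hs.2, htm.1, htm.2]
      calc |s - t| * (c * t + d) ^ 2 ≤ 1 * (c * t + d) ^ 2 := by gcongr
        _ = (c * t + d) * (c * t + d) := by ring
        _ ≤ (n + 1) * (c * s + d) * (c * t + d) := by gcongr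
        _ = _ := by ring
    · rw [hQ s hs]
      refine mul_le_of_le_one_right (by positivity) ?_
      have h1 := questionMark_mem hs
      have h2 := questionMark_mem htI
      rw [abs_le]; constructor <;> linarith [h1.1, h1.2, h2.1, h2.2]
  · intro y hy hyI
    have h0 : (0 : ℝ) ∈ Icc (0 : ℝ) 1 := ⟨le_rfl, zero_le_one⟩
    have h1 : (1 : ℝ) ∈ Icc (0 : ℝ) 1 := ⟨zero_le_one, le_rfl⟩
    have hcont : ContinuousOn φ (Icc 0 1) := by
      refine ContinuousOn.div (by fun_prop) (by fun_prop) fun s hs => (hpos s hs).ne'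
    have hmin : min |φ 0 - x| |φ 1 - x| ≤ |y - x| ∧
        min |questionMark (φ 0) - questionMark x| |questionMark (φ 1) - questionMark x| ≤
          |questionMark y - questionMark x| := by
      have hden0 := mul_pos (hpos 0 h0) (hpos t htI)
      have hden1 := mul_pos (hpos 1 h1) (hpos t htI)
      have hxI : x ∈ Icc (0 : ℝ) 1 := hxφ ▸ (hmap t htI).1
      -- The sign of the determinant decides which of φ(0), φ(1) is the left end.
      rcases (abs_eq zero_le_one).1 hdet with hd1 | hd1
      · refine min_le_abs_sub_of_notMem (hmap 0 h0).1 (hmap 1 h1).1 hxI ?_ ?_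
          (intermediate_value_Icc zero_le_one hcont) hy hyI
        · rw [← sub_nonpos, hdiff 0 h0, hd1]
          exact div_nonpos_of_nonpos_of_nonneg (by linarith [htm.1]) hden0.le
        · rw [← sub_nonneg, hdiff 1 h1, hd1]
          exact div_nonneg (by linarith [htm.2]) hden1.le
      · rw [min_comm, min_comm |questionMark (φ 0) - questionMark x|]
        refine min_le_abs_sub_of_notMem (hmap 1 h1).1 (hmap 0 h0).1 hxI ?_ ?_
          (intermediate_value_Icc' zero_le_one hcont) hy hyI
        · rw [← sub_nonpos, hdiff 1 h1, hd1]
          exact div_nonpos_of_nonpos_of_nonneg (by linarith [htm.2]) hden1.le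
        · rw [← sub_nonneg, hdiff 0 h0, hd1]
          exact div_nonneg (by linarith [htm.1]) hden0.le
    constructor
    · refine le_trans ?_ hmin.1
      have a0 := hlower 0 h0
      have a1 := hlower 1 h1
      rw [zero_sub, abs_neg, abs_of_pos htm.1] at a0
      rw [abs_of_pos (by linarith [htm.2])] at a1
      refine le_min (le_trans ?_ a0) (le_trans ?_ a1)
      · gcongr
        exact min_le_left _ _
      · gcongr
        exact min_le_right _ _
    · refine le_trans ?_ hmin.2
      have h2 := questionMark_mem htI
      rw [hQ 0 h0, hQ 1 h1, questionMark_zero, questionMark_one, zero_sub, abs_neg,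
        abs_of_nonneg h2.1, abs_of_nonneg (by linarith [h2.2])]
      refine le_min ?_ ?_
      · gcongr
        exact min_le_left _ _
      · gcongr
        exact min_le_right _ _

/-! ### The Lipschitz exponent of the question mark function -/

/-- If nested bounds on two scales hold along an exhausting sequence of sets `I n`, then the
quotient of the logarithms has a limit. -/
theorem tendsto_div_of_scale_bounds {x β : ℝ} {f g : ℝ → ℝ} {I : ℕ → Set ℝ} {A A' B B' : ℕ → ℝ}
    (hI : ∀ n, ∀ᶠ y in 𝓝 x, y ∈ I n) (hexh : ∀ᶠ y in 𝓝[≠] x, ∃ n, y ∉ I n)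
    (hlo : Tendsto (fun n => B n / A' n) atTop (𝓝 β))
    (hhi : Tendsto (fun n => B' n / A n) atTop (𝓝 β))
    (hA : ∀ᶠ n in atTop, 0 < A n) (hB : ∀ n, 0 ≤ B n)
    (hb : ∀ᶠ n in atTop, ∀ᶠ y in 𝓝[≠] x, ∀ k, n ≤ k → y ∈ I k → y ∉ I (k + 1) →
      A k ≤ g y ∧ g y ≤ A' k ∧ B k ≤ f y ∧ f y ≤ B' k) :
    Tendsto (fun y => f y / g y) (𝓝[≠] x) (𝓝 β) := by
  rw [Metric.tendsto_nhds]
  intro ε hε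
  obtain ⟨K, hK⟩ := ((Metric.tendsto_nhds.1 hlo ε hε).and ((Metric.tendsto_nhds.1 hhi ε hε).and
    (hA.and hb))).exists_forall_of_atTop
  have hnear : ∀ᶠ y in 𝓝 x, ∀ m ∈ Iic K, y ∈ I m :=
    (eventually_all_finite (finite_Iic K)).2 fun m _ => hI m
  filter_upwards [nhdsWithin_le_nhds hnear, hexh, (hK K le_rfl).2.2.2] with y hy hex hbd
  classical
  -- At the first index whose set misses `y`, the preceding set still contains it, and `y` lying
  -- close to `x` forces this index beyond `K`. The sets need not be nested.
  have h1 := Nat.find_spec hex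
  have h2 : K < Nat.find hex := by
    by_contra h
    exact h1 (hy _ (not_lt.1 h))
  obtain ⟨n, hn⟩ := Nat.exists_eq_add_of_lt h2
  have h3 : y ∈ I (K + n) := by
    by_contra h
    have := Nat.find_min' hex h
    omega
  rw [hn] at h1
  obtain ⟨hlo', hhi', hA', -⟩ := hK (K + n) (by omega)
  obtain ⟨b1, b2, b3, b4⟩ := hbd (K + n) (by omega) h3 h1
  have hg : 0 < g y := hA'.trans_le b1
  have hl : B (K + n) / A' (K + n) ≤ f y / g y :=
    div_le_div₀ ((hB _).trans b3) b3 hg b2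
  have hu : f y / g y ≤ B' (K + n) / A (K + n) :=
    div_le_div₀ (((hB _).trans b3).trans b4) b4 hA' b1
  rw [Real.dist_eq, abs_lt] at *
  constructor <;> linarith [hlo'.1, hhi'.2]

/-- If `y` lies in the Farey interval of order k but not in that of order k + 1, then -log|y-x| is
S_k or S_(k+1) up to O(log k), and -log|?(y)-?(x)| is k log 2 up to O(log k). Since S_k/k tends to
2α, the quotient tends to log 2/(2α). -/
theorem ae_hasLipschitzExponentAt_questionMark : ∀ᵐ x ∂minkowskiMeasure,
    HasLipschitzExponentAt questionMark (Real.log 2 / (2 * sternAlpha)) x := by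
  filter_upwards [ae_tendsto_birkhoffSum_log_deriv, ae_mem_fareyRegular,
    ae_eventually_orbit_far_from_ends] with x hlim hreg hends
  have hα := sternAlpha_pos
  have hlog2 : 0 < Real.log 2 := Real.log_pos one_lt_two
  choose I hIin hIout using exists_farey_interval hreg
  set S : ℕ → ℝ := fun n => birkhoffSum fareyMap (fun y => Real.log |deriv fareyMap y|) n x with hS
  set t : ℕ → ℝ := fun n => fareyMap^[n] x with ht
  have htI : ∀ n, t n ∈ Ioo (0 : ℝ) 1 := fun n => (hreg n).1
  set A : ℕ → ℝ := fun n => S n - Real.log (n + 1) with hA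
  set A' : ℕ → ℝ := fun n => S (n + 1) + (4 * Real.log 2 + 3 * Real.log (n + 1)) with hA'
  set B : ℕ → ℝ := fun n => n * Real.log 2 with hB
  set B' : ℕ → ℝ := fun n => (n + 1) * Real.log 2 + 2 * (Real.log 2 + Real.log (n + 1)) with hB'
  have hAlim : Tendsto (fun n : ℕ => A n / n) atTop (𝓝 (2 * sternAlpha)) := by
    have h1 := hlim.sub (tendsto_log_nat_add_one_div_nat 0)
    rw [sub_zero] at h1
    refine h1.congr fun n => ?_
    simp only [hA, hS]
    ring
  have hA'lim : Tendsto (fun n : ℕ => A' n / n) atTop (𝓝 (2 * sternAlpha)) := by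
    have h1 : Tendsto (fun n : ℕ => S (n + 1) / ((n + 1 : ℕ) : ℝ)) atTop (𝓝 (2 * sternAlpha)) :=
      hlim.comp (tendsto_add_atTop_nat 1)
    have h2 : Tendsto (fun n : ℕ => 1 + 1 / (n : ℝ)) atTop (𝓝 (1 + 0)) :=
      tendsto_const_nhds.add tendsto_one_div_atTop_nhds_zero_nat
    have h3 := (h1.mul h2).add
      ((tendsto_log_nat_add_one_div_nat (4 / 3 * Real.log 2)).const_mul 3)
    rw [add_zero, mul_one, mul_zero, add_zero] at h3
    refine h3.congr' ?_
    filter_upwards [eventually_ge_atTop 1] with n hn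
    have hn0 : (n : ℝ) ≠ 0 := by positivity
    simp only [hA']
    push_cast
    field_simp
  have hBlim : Tendsto (fun n : ℕ => B n / n) atTop (𝓝 (Real.log 2)) := by
    refine tendsto_const_nhds.congr' ?_
    filter_upwards [eventually_ge_atTop 1] with n hn
    have hn0 : (n : ℝ) ≠ 0 := by positivity
    simp only [hB]
    field_simp
  have hB'lim : Tendsto (fun n : ℕ => B' n / n) atTop (𝓝 (Real.log 2)) := by
    have h3 := hBlim.add
      ((tendsto_log_nat_add_one_div_nat (3 / 2 * Real.log 2)).const_mul 2)
    rw [mul_zero, add_zero] at h3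
    refine h3.congr' ?_
    filter_upwards [eventually_ge_atTop 1] with n hn
    have hn0 : (n : ℝ) ≠ 0 := by positivity
    simp only [hB', hB]
    field_simp
    ring
  have hquot : ∀ {U V : ℕ → ℝ} {a b : ℝ}, Tendsto (fun n : ℕ => U n / n) atTop (𝓝 a) →
      Tendsto (fun n : ℕ => V n / n) atTop (𝓝 b) → b ≠ 0 →
      Tendsto (fun n => U n / V n) atTop (𝓝 (a / b)) := by
    intro U V a b hU hV hb
    refine (hU.div hV hb).congr' ?_
    filter_upwards [eventually_ge_atTop 1] with n hn
    have hn0 : (n : ℝ) ≠ 0 := by positivity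
    exact div_div_div_cancel_right₀ hn0 _ _
  have hαne : 2 * sternAlpha ≠ 0 := by positivity
  have hAtop : Tendsto A atTop atTop := by
    have h1 := hAlim.pos_mul_atTop (by positivity) tendsto_natCast_atTop_atTop
    refine h1.congr' ?_
    filter_upwards [eventually_ge_atTop 1] with n hn
    have hn0 : (n : ℝ) ≠ 0 := by positivity
    field_simp
  have hexpA : ∀ n : ℕ, ((n : ℝ) + 1) * Real.exp (-S n) = Real.exp (-A n) := by
    intro n
    have hn : (0 : ℝ) < n + 1 := by positivity
    simp only [hA]
    rw [neg_sub, sub_eq_add_neg, Real.exp_add, Real.exp_log hn]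
  have hx01 : Icc (0 : ℝ) 1 ∈ 𝓝 x := Icc_mem_nhds (hreg 0).1.1 (hreg 0).1.2
  -- Both logarithms are negated so that the scale bounds concern positive quantities.
  have hmain : Tendsto (fun y => -Real.log |questionMark y - questionMark x| /
      -Real.log |y - x|) (𝓝[≠] x) (𝓝 (Real.log 2 / (2 * sternAlpha))) := by
    refine tendsto_div_of_scale_bounds (I := I) (A := A) (A' := A') (B := B) (B' := B')
      (fun n => ?_) ?_ (hquot hBlim hA'lim hαne) (hquot hB'lim hAlim hαne)
      (hAtop.eventually_gt_atTop 0) (fun n => by positivity) ?_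
    · have hδ : 0 < min (t n) (1 - t n) / (n + 1) * Real.exp (-S n) := by
        have : 0 < min (t n) (1 - t n) := lt_min (htI n).1 (by linarith [(htI n).2])
        positivity
      filter_upwards [hx01, Metric.ball_mem_nhds x hδ] with y hy hyb
      by_contra h
      rw [Metric.mem_ball, Real.dist_eq] at hyb
      exact absurd (hIout n y hy h).1 (not_le.2 hyb)
    · filter_upwards [self_mem_nhdsWithin] with y hy
      have h0 : 0 < |y - x| := abs_pos.2 (sub_ne_zero.2 hy)
      have hexp0 := Real.tendsto_exp_neg_atTop_nhds_zero.comp hAtop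
      obtain ⟨m, hm⟩ := (hexp0.eventually_lt_const h0).exists
      refine ⟨m, fun h => ?_⟩
      have h1 := (hIin m y h).1
      rw [hexpA] at h1
      exact absurd h1 (not_le.2 hm)
    · obtain ⟨K, hK⟩ := hends.exists_forall_of_atTop
      filter_upwards [eventually_ge_atTop K] with n hn
      filter_upwards [nhdsWithin_le_nhds hx01, self_mem_nhdsWithin] with y hy hne k hk hin hout
      have h0 : 0 < |y - x| := abs_pos.2 (sub_ne_zero.2 hne)
      obtain ⟨a1, a2⟩ := hIin k y hin
      obtain ⟨b1, b2⟩ := hIout (k + 1) y hy hout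
      obtain ⟨c1, c2⟩ := hK (k + 1) (by omega)
      change 1 / (((k + 1 : ℕ) : ℝ) + 1) ^ 2 ≤ questionMark (t (k + 1)) at c1
      change 1 / (((k + 1 : ℕ) : ℝ) + 1) ^ 2 ≤ 1 - questionMark (t (k + 1)) at c2
      have d1 := questionMark_le_two_mul (Ioo_subset_Icc_self (htI (k + 1)))
      have d2 := one_sub_questionMark_le (Ioo_subset_Icc_self (htI (k + 1)))
      have hk1 : (0 : ℝ) < (k : ℝ) + 1 := by positivity
      set w : ℝ := 2 * (k + 1) with hw
      have hw0 : 0 < w := by positivity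
      have hwlog : Real.log w = Real.log 2 + Real.log (k + 1) :=
        Real.log_mul two_ne_zero hk1.ne'
      have hkw : ((k + 1 : ℕ) : ℝ) + 1 ≤ w := by
        rw [hw]; push_cast; linarith
      have hkp : (0 : ℝ) < ((k + 1 : ℕ) : ℝ) + 1 := by positivity
      have hwinv : 1 / w ^ 2 ≤ 1 / (((k + 1 : ℕ) : ℝ) + 1) ^ 2 := by gcongr
      have hminQ : 1 / w ^ 2 ≤ min (questionMark (t (k + 1))) (1 - questionMark (t (k + 1))) :=
        le_min (hwinv.trans c1) (hwinv.trans c2)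
      have hmint : 1 / w ^ 2 / 2 ≤ min (t (k + 1)) (1 - t (k + 1)) :=
        le_min (by linarith) (by linarith)
      have e1 : 1 / w ^ 2 / 2 / w * Real.exp (-S (k + 1)) ≤ |y - x| := by
        refine le_trans ?_ b1
        gcongr
        exact le_trans (by positivity) hmint
      have e2 : (1 / 2) ^ (k + 1) * (1 / w ^ 2) ≤ |questionMark y - questionMark x| := by
        refine le_trans ?_ b2
        gcongr
      have hQ0 : 0 < |questionMark y - questionMark x| := lt_of_lt_of_le (by positivity) e2
      refine ⟨?_, ?_, ?_, ?_⟩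
      · rw [hexpA] at a1
        have := Real.log_le_log h0 a1
        rw [Real.log_exp] at this
        linarith
      · have := Real.log_le_log (by positivity) e1
        rw [Real.log_mul (by positivity) (by positivity), Real.log_exp,
          Real.log_div (by positivity) hw0.ne', Real.log_div (by positivity) two_ne_zero, one_div,
          Real.log_inv, Real.log_pow, hwlog] at this
        push_cast at this
        simp only [hA']
        linarith
      · have := Real.log_le_log hQ0 a2
        rw [Real.log_pow, one_div, Real.log_inv] at this
        simp only [hB]
        linarith
      · have := Real.log_le_log (by positivity) e2
        rw [Real.log_mul (by positivity) (by positivity), Real.log_pow, one_div, one_div,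
          Real.log_inv, Real.log_inv, Real.log_pow, hwlog] at this
        push_cast at this
        simp only [hB']
        linarith
  unfold HasLipschitzExponentAt
  simpa only [neg_div_neg_eq] using hmain

theorem theorem3 :
    -- the constant `α = -(1/2) ∫ log x dμ(x)`, the asymptotic mean of `log s(n)`
    (Integrable Real.log minkowskiMeasure ∧ 0 < sternAlpha ∧
      Tendsto (fun N : ℕ => sternLogMean N / N) atTop (𝓝 sternAlpha)) ∧
    -- (i)
    ((∀ k : ℕ, Integrable (fun x : ℝ => x ^ k) minkowskiMeasure) ∧
      ∃ S : ℝ, HasSum (fun k : ℕ =>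
          (∫ x, x ^ (k + 1) ∂minkowskiMeasure) / (((k + 1 : ℕ) : ℝ) * 2 ^ (k + 1))) S ∧
        sternAlpha = Real.log 2 - S) ∧
    -- (ii)
    (Integrable (fun x : ℝ => Real.log (1 + x)) minkowskiMeasure ∧
      sternAlpha = ∫ x, Real.log (1 + x) ∂minkowskiMeasure ∧
      ∀ᵐ x ∂minkowskiMeasure,
        HasLipschitzExponentAt questionMark (Real.log 2 / (2 * sternAlpha)) x) ∧
    -- (iii)
    ((∀ᵐ x ∂minkowskiMeasure, DifferentiableAt ℝ fareyMap x) ∧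
      Integrable (fun x : ℝ => Real.log |deriv fareyMap x|) minkowskiMeasure ∧
      2 * sternAlpha = ∫ x, Real.log |deriv fareyMap x| ∂minkowskiMeasure) ∧
    -- (iv)
    (IsMaxLyapunovExponent sternEta sternAlpha ∧ IsStationaryMeasure sternEta sternXi) ∧
    -- (v): the constant `σ²` is the limit of the variance of `log s(n)` divided by `N`
    ((∀ x ∈ Icc (0 : ℝ) 1, Integrable
        (fun y : ℝ => Real.log ((1 + y * Int.fract (1 / x)) / (1 + y * x))) minkowskiMeasure) ∧
      Integrable (fun x : ℝ => (Real.log x + sternAlpha * (⌊1 / x⌋ : ℝ) +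
        ∫ y, Real.log ((1 + y * Int.fract (1 / x)) / (1 + y * x)) ∂minkowskiMeasure) ^ 2)
        minkowskiMeasure ∧
      Tendsto (fun N : ℕ => sternLogVar N / N) atTop
        (𝓝 (1 / 2 * ∫ x, (Real.log x + sternAlpha * (⌊1 / x⌋ : ℝ) +
          ∫ y, Real.log ((1 + y * Int.fract (1 / x)) / (1 + y * x)) ∂minkowskiMeasure) ^ 2
          ∂minkowskiMeasure))) := by
  have hW : ∀ᵐ x ∂minkowskiMeasure, gaussIncrement x ^ 2 =
      (Real.log x + sternAlpha * (⌊1 / x⌋ : ℝ) +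
        ∫ y, Real.log ((1 + y * Int.fract (1 / x)) / (1 + y * x)) ∂minkowskiMeasure) ^ 2 := by
    filter_upwards [ae_minkowskiMeasure_mem_Icc] with x hx
    rw [(integrable_log_ratio hx).2, gaussIncrement, add_sub_assoc]
  refine ⟨⟨integrable_log_minkowskiMeasure, sternAlpha_pos, tendsto_sternLogMean_div⟩,
    ⟨integrable_pow_minkowskiMeasure, sternAlpha_eq_log_two_sub_moments⟩,
    ⟨integrable_log_one_add_minkowskiMeasure, sternAlpha_eq_integral_log_one_add,
      ae_hasLipschitzExponentAt_questionMark⟩,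
    ⟨ae_differentiableAt_fareyMap, integrable_log_abs_deriv_fareyMap,
      two_mul_sternAlpha_eq_integral_log_deriv⟩,
    ⟨isMaxLyapunovExponent_sternAlpha, isStationaryMeasure_sternXi⟩,
    fun x hx => (integrable_log_ratio hx).1, integrable_gaussIncrement_sq.congr hW, ?_⟩
  rw [← integral_congr_ae hW, integral_gaussIncrement_sq, ← mul_assoc, one_div,
    inv_mul_cancel₀ two_ne_zero, one_mul]
  exact tendsto_sternLogVar_div
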